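/- Let $n\ge 1$ and let $F(x)=Bx+f(x)$ be (the germ at $0$ of) an analytic diffeomorphism of $(\mathbb C^n,0)$, i.e. $F$ is analytic near $0$, $B\in M_n(\mathbb C)$ is invertible and $f(x)=O(|x|^2)$. Assume that at least one eigenvalue of $B$ does not lie on the unit circle. Let $P$ be any invertible matrix such that $J=P^{-1}BP$ is in lower triangular Jordan normal form (such a $P$ always exists), let $\mu=(\mu_1,\dots,\mu_n)$ be the diagonal of $J$, i.e. the eigenvalues of $B$, and put $\widetilde F=P^{-1}\circ F\circ P$ (so $\widetilde F=F$ if $B$ itself is in Jordan normal form and $P=I$). Definitions. - $F$ is *analytically integrable* if there are $n-1$ functions $V_1,\dots,V_{n-1}$, analytic near $0$, with $V_k\circ F=V_k$ near $0$, which are functionally independent: their gradients are linearly independent on an open dense subset of a neighbourhood of $0$. - For $m\in\mathbb Z_+^n$ write $\mu^m=\mu_1^{m_1}\cdots\mu_n^{m_n}$ and $|m|=m_1+\dots+m_n$. The *resonant set* is $\mathcal D=\{m\in\mathbb Z_+^n:\mu^m=1,\ |m|\ge 2\}$, its elements are called *resonant lattices*, and $d_\mu$ is its rank (the dimension of its $\mathbb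 Q$-linear span). An element $m\in\mathcal D$ is *simple* if it cannot be divided within $\mathcal D$ by an integer $q\ge2$, i.e. if it is not of the form $m=q\,m'$ with $q\ge 2$ and $m'\in\mathcal D$. - An analytic map $G(y)=Jy+g(y)$ is in *normal form* if $J$ is in Jordan normal form with diagonal $\mu$ and the Taylor series of $g$ contains only monomials $y^m e_j$ with $|m|\ge2$ and $\mu^m=\mu_j$. - A *distinguished analytic normalization* between $\widetilde F$ and $G$ is an analytic map $x=\Phi(y)=y+\phi(y)$ with $\widetilde F\circ\Phi=\Phi\circ G$ near $0$ such that the Taylor series of $\phi$ contains only monomials $y^m e_j$ with $|m|\ge 2$ and $\mu^m\ne\mu_j$. Theorem. $F$ is analytically integrable if and only if the following two statements hold. (a) The resonant set has rank $d_\mu=n-1$. (b) $\widetilde F$ is conjugate, by a distinguished analytic normalization, to a map in normal form of the type $$G(y)=\bigl(\mu_1y_1(1+p_1(y)),\dots,\mu_ny_n(1+p_n(y))\bigr),$$ where $p_1,\dots,p_n$ are analytic near $0$ and there are $n-1$ linearly independent simple resonant lattices $m_k=(m_{k1},\dots,m_{kn})\in\mathcal D$, $k=1,\dots,n-1$, such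 that near $0$ $$(1+p_1(y))^{m_{k1}}\cdots(1+p_n(y))^{m_{kn}}=1,\qquad k=1,\dots,n-1.$$ -/

import Mathlib

open Filter Topology Asymptotics

/-- The monomial `x ^ m = x₁ ^ m₁ ⋯ xₙ ^ mₙ`. -/
def monomialAt {n : ℕ} (x : Fin n → ℂ) (m : Fin n →₀ ℕ) : ℂ :=
  ∏ i, x i ^ m i

/-- The total degree `|m| = m₁ + ⋯ + mₙ`. -/
def totalDeg {n : ℕ} (m : Fin n →₀ ℕ) : ℕ :=
  ∑ i, m i

/-- `c` is the Taylor series at the origin of the scalar function `g`: near the origin `g` is the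
(unconditionally convergent) sum of the monomials of `c`. -/
def HasTaylorSeries {n : ℕ} (g : (Fin n → ℂ) → ℂ) (c : MvPowerSeries (Fin n) ℂ) : Prop :=
  ∀ᶠ x in 𝓝 (0 : Fin n → ℂ), HasSum (fun m => MvPowerSeries.coeff m c * monomialAt x m) (g x)

/-- The function `g` has a convergent Taylor series at the origin, and all the monomials that occur
in it with a nonzero coefficient satisfy `S`. -/
def ConsistsOfMonomials {n : ℕ} (g : (Fin n → ℂ) → ℂ) (S : (Fin n →₀ ℕ) → Prop) : Prop :=
  ∃ c : MvPowerSeries (Fin n) ℂ, HasTaylorSeries g c ∧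
    ∀ m, MvPowerSeries.coeff m c ≠ 0 → S m

/-- `V` is (the germ at the origin of) an analytic first integral of `F`. -/
def IsAnalyticFirstIntegral {n : ℕ} (F : (Fin n → ℂ) → (Fin n → ℂ))
    (V : (Fin n → ℂ) → ℂ) : Prop :=
  AnalyticAt ℂ V 0 ∧ ∀ᶠ x in 𝓝 (0 : Fin n → ℂ), V (F x) = V x

/-- The differentials of the functions `V k` are linearly independent on an open dense subset of
some neighbourhood of the origin. -/
def FunctionallyIndependent {n r : ℕ} (V : Fin r → (Fin n → ℂ) → ℂ) : Prop :=
  ∃ U W : Set (Fin n → ℂ), IsOpen U ∧ (0 : Fin n → ℂ) ∈ U ∧ IsOpen W ∧ W ⊆ U ∧ U ⊆ closure W ∧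
    ∀ x ∈ W, LinearIndependent ℂ (fun k => fderiv ℂ (V k) x)

/-- `F` has `n - 1` functionally independent analytic first integrals near the origin of `ℂⁿ`. -/
def IsAnalyticallyIntegrable {n : ℕ} (F : (Fin n → ℂ) → (Fin n → ℂ)) : Prop :=
  ∃ V : Fin (n - 1) → (Fin n → ℂ) → ℂ,
    (∀ k, IsAnalyticFirstIntegral F (V k)) ∧ FunctionallyIndependent V

/-- The resonant set `{m ∈ ℤ₊ⁿ : μ ^ m = 1, |m| ≥ 2}`; its elements are the resonant lattices. -/
def resonantSet {n : ℕ} (μ : Fin n → ℂ) : Set (Fin n →₀ ℕ) :=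
  {m | monomialAt μ m = 1 ∧ 2 ≤ totalDeg m}

/-- An exponent vector, seen as a vector of `ℚⁿ`. -/
def ratVec {n : ℕ} (m : Fin n →₀ ℕ) : Fin n → ℚ :=
  fun i => (m i : ℚ)

/-- The rank of the resonant set. -/
noncomputable def resonantRank {n : ℕ} (μ : Fin n → ℂ) : ℕ :=
  Module.finrank ℚ (Submodule.span ℚ (ratVec '' resonantSet μ))

/-- A resonant lattice is simple if it cannot be divided, within the resonant set, by an integer
`q ≥ 2`. -/
def IsSimpleResonant {n : ℕ} (μ : Fin n → ℂ) (m : Fin n →₀ ℕ) : Prop :=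
  m ∈ resonantSet μ ∧ ∀ q : ℕ, 2 ≤ q → ∀ m' ∈ resonantSet μ, m ≠ q • m'

/-- `J` is in lower triangular Jordan normal form: every nonzero entry off the diagonal is a `1`
directly below the diagonal that links two equal diagonal entries. -/
def IsLowerJordan {n : ℕ} (J : Matrix (Fin n) (Fin n) ℂ) : Prop :=
  ∀ i j, i ≠ j → J i j = 0 ∨ (J i j = 1 ∧ (i : ℕ) = (j : ℕ) + 1 ∧ J i i = J j j)

/-- `G` is in normal form with linear part `J`: the matrix `J` is in Jordan normal form, and the
nonlinear part of `G` consists of resonant monomials `y ^ m e_j`, those with `μ ^ m = μ_j`, where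
`μ` is the diagonal of `J`. -/
def IsNormalForm {n : ℕ} (J : Matrix (Fin n) (Fin n) ℂ) (G : (Fin n → ℂ) → (Fin n → ℂ)) : Prop :=
  IsLowerJordan J ∧ ∀ j, ConsistsOfMonomials (fun y => G y j - J.mulVec y j)
    (fun m => 2 ≤ totalDeg m ∧ monomialAt J.diag m = J j j)

/-- `x = Φ(y) = y + φ(y)` is a distinguished analytic normalization between `F` and `G`: it is
analytic, it conjugates `F` to `G`, and `φ` consists of monomials `y ^ m e_j` of degree at least
two that are nonresonant, that is `μ ^ m ≠ μ_j`. -/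
def IsDistinguishedAnalyticNormalization {n : ℕ} (μ : Fin n → ℂ)
    (F G Φ : (Fin n → ℂ) → (Fin n → ℂ)) : Prop :=
  AnalyticAt ℂ Φ 0 ∧
    (∀ j, ConsistsOfMonomials (fun y => Φ y j - y j)
      (fun m => 2 ≤ totalDeg m ∧ monomialAt μ m ≠ μ j)) ∧
    ∀ᶠ y in 𝓝 (0 : Fin n → ℂ), F (Φ y) = Φ (G y)

/-- The map `y ↦ (μ₁ y₁ (1 + p₁(y)), …, μₙ yₙ (1 + pₙ(y)))`. -/
def scalingMap {n : ℕ} (μ : Fin n → ℂ) (p : Fin n → (Fin n → ℂ) → ℂ) :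
    (Fin n → ℂ) → (Fin n → ℂ) :=
  fun y i => μ i * y i * (1 + p i y)

/-! After the linear change of variables the map has linear part `J`. Give the coordinates weights
for which the nilpotent part of `J` raises weight by one and quadratic terms raise it by at least
two (`jordanWeight`). The leading weighted part of the map is then diag(μ), so the leading part of a
first integral is a polynomial all of whose monomials satisfy μ^m = 1. A lemma of Ziglin type,
`exists_algebraicIndependent_lead`, replaces n - 1 functionally independent integrals by n - 1
integrals with algebraically independent leads P_k.

Necessity rests on one algebraic fact: polynomial vector fields that kill all the P_k are
proportional (`vectorField_proportional`). One such field is L = ∑ λ_i y_i ∂_i with λ_i = log |μ_i|,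
nonzero because some eigenvalue is off the unit circle. Since two independent diagonal fields cannot
both kill the P_k, the resonant set has rank at least n - 1 (`le_resonantRank`); the linear form
given by L bounds the rank by n - 1 (`resonantRank_lt`). Moreover, if the map differs from a
suitable model by an error whose lead is resonant, then that lead, divided componentwise by μ_i,
also kills the P_k (`lead_error_tangent`). Applied to the model diag(μ), this makes the nilpotent
part of `J` proportional to L, hence zero.

Rank n - 1 also forces some fixed power of every μ^m to be an integer power of a single μ_{i₀} off
the unit circle, so there are no small divisors (`exists_le_norm_monomialAt_sub`). This allows a
direct convergent construction: Φ = id + φ conjugates the map, up to an error E, to G(y) = (μ_i y_i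
e^{λ_i h(y)}), which is diag(μ) composed with the flow of L for the time h. Here φ absorbs all
nonresonant terms, while the one function h removes from component i₀ the resonant terms divisible
by y_{i₀}. Monomials with μ^m = 1 are unchanged by G, so the homological equation reduces to
inverting μ^m e^{log|μ^m| h} - μ_j in the Banach algebra of absolutely summable power series. A
contraction then produces φ and h together (`exists_normalization_series`).

So far integrability entered only through the rank and the diagonal form of `J`. It is now used
again: the lead of E would be proportional to L, but its component i₀ does not involve y_{i₀}, which
forces E = 0 (`error_eventually_zero`). The normal form has 1 + p_i = e^{λ_i h}, and the required
product relations are ∑ m_i λ_i = 0, the logarithm of |μ^m| = 1.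

Conversely, the monomials y^{m_k} are integrals of a scaling map satisfying the relations,
independent off the coordinate hyperplanes, and they are carried back by the inverses of Φ and of
the linear map. -/

/-! ### Monomials and convergent Taylor series. -/

theorem totalDeg_add {n : ℕ} (a b : Fin n →₀ ℕ) : totalDeg (a + b) = totalDeg a + totalDeg b := by
  simp [totalDeg, Finset.sum_add_distrib]

theorem totalDeg_single {n : ℕ} (i : Fin n) (k : ℕ) : totalDeg (Finsupp.single i k) = k := by
  simp [totalDeg, Finsupp.single_apply]

theorem totalDeg_zero {n : ℕ} : totalDeg (0 : Fin n →₀ ℕ) = 0 := by simp [totalDeg]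

theorem monomialAt_add {n : ℕ} (x : Fin n → ℂ) (a b : Fin n →₀ ℕ) :
    monomialAt x (a + b) = monomialAt x a * monomialAt x b := by
  simp [monomialAt, pow_add, Finset.prod_mul_distrib]

theorem monomialAt_zero {n : ℕ} (x : Fin n → ℂ) : monomialAt x 0 = 1 := by simp [monomialAt]

theorem monomialAt_single {n : ℕ} (x : Fin n → ℂ) (i : Fin n) (k : ℕ) :
    monomialAt x (Finsupp.single i k) = x i ^ k := by
  rw [monomialAt, Finset.prod_eq_single i]
  · simp
  · intro b _ hb; simp [hb.symm]
  · simp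

theorem monomialAt_mul {n : ℕ} (x y : Fin n → ℂ) (a : Fin n →₀ ℕ) :
    monomialAt (fun i => x i * y i) a = monomialAt x a * monomialAt y a := by
  simp [monomialAt, mul_pow, Finset.prod_mul_distrib]

theorem monomialAt_const {n : ℕ} (ρ : ℂ) (a : Fin n →₀ ℕ) :
    monomialAt (fun _ : Fin n => ρ) a = ρ ^ totalDeg a := by
  simp [monomialAt, totalDeg, Finset.prod_pow_eq_pow_sum]

theorem monomialAt_smul_vec {n : ℕ} (t : ℂ) (y : Fin n → ℂ) (a : Fin n →₀ ℕ) :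
    monomialAt (t • y) a = t ^ totalDeg a * monomialAt y a := by
  rw [← monomialAt_const, ← monomialAt_mul]; rfl

theorem norm_monomialAt_le {n : ℕ} {x : Fin n → ℂ} {ρ : ℝ} (h : ‖x‖ ≤ ρ) (a : Fin n →₀ ℕ) :
    ‖monomialAt x a‖ ≤ ρ ^ totalDeg a := by
  rw [monomialAt, norm_prod, totalDeg, ← Finset.prod_pow_eq_pow_sum]
  refine Finset.prod_le_prod (fun i _ => norm_nonneg _) fun i _ => ?_
  rw [norm_pow]
  exact pow_le_pow_left₀ (norm_nonneg _) ((norm_le_pi_norm x i).trans h) _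

theorem monomialAt_sum_single {n k : ℕ} (x : Fin n → ℂ) (i : Fin k → Fin n) :
    monomialAt x (∑ j, Finsupp.single (i j) 1) = ∏ j, x (i j) := by
  have : ∀ s : Finset (Fin k), monomialAt x (∑ j ∈ s, Finsupp.single (i j) 1)
      = ∏ j ∈ s, x (i j) := by
    intro s
    induction s using Finset.induction_on with
    | empty => simp [monomialAt_zero]
    | insert a s ha ih =>
      rw [Finset.sum_insert ha, Finset.prod_insert ha, monomialAt_add, ih, monomialAt_single, pow_one]
  exact this _

/-- A convergent Taylor series converges absolutely on a polydisc. -/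
theorem HasTaylorSeries.exists_summable {n : ℕ} {g : (Fin n → ℂ) → ℂ}
    {c : MvPowerSeries (Fin n) ℂ} (h : HasTaylorSeries g c) :
    ∃ ρ : ℝ, 0 < ρ ∧ Summable (fun m => ‖MvPowerSeries.coeff m c‖ * ρ ^ totalDeg m) ∧
      ∀ x : Fin n → ℂ, ‖x‖ ≤ ρ →
        HasSum (fun m => MvPowerSeries.coeff m c * monomialAt x m) (g x) := by
  obtain ⟨ε, hε, H⟩ := Metric.eventually_nhds_iff.1 h
  refine ⟨ε / 2, by positivity, ?_, fun x hx => H ?_⟩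
  · have hρ : dist (fun _ : Fin n => ((ε / 2 : ℝ) : ℂ)) 0 < ε := by
      rw [dist_zero_right]
      refine lt_of_le_of_lt ((pi_norm_le_iff_of_nonneg (r := ε / 2) (by positivity)).2 fun i => ?_)
        (by linarith)
      rw [Complex.norm_real, Real.norm_of_nonneg (by positivity)]
    have := (H hρ).summable.norm
    refine this.congr fun m => ?_
    rw [monomialAt_const, norm_mul, norm_pow, Complex.norm_real,
      Real.norm_of_nonneg (by positivity)]
  · rw [dist_zero_right]; linarith

/-- Expanding each multilinear term over words of basis vectors gives an absolutely convergent sum;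
words with the same exponent are then grouped into one coefficient. -/
theorem exists_hasTaylorSeries {n : ℕ} {g : (Fin n → ℂ) → ℂ} (hg : AnalyticAt ℂ g 0) :
    ∃ c, HasTaylorSeries g c := by
  obtain ⟨p, r, hp⟩ := hg
  let a : (Σ k : ℕ, Fin k → Fin n) → ℂ := fun q => p q.1 (fun j => Pi.single (q.2 j) 1)
  let e : (Σ k : ℕ, Fin k → Fin n) → (Fin n →₀ ℕ) := fun q => ∑ j, Finsupp.single (q.2 j) 1
  obtain ⟨r', hr'0, hr'⟩ := ENNReal.lt_iff_exists_nnreal_btwn.1 hp.r_pos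
  have hr'p : (0:ℝ) < r' := by exact_mod_cast hr'0
  -- There are `n ^ k` words of length `k`, so convergence needs `n * ρ ≤ r'`; the extra 1 keeps the
  -- denominator nonzero when `n = 0`.
  set ρ : ℝ := r' / (n + 1) with hρ
  have hρ0 : 0 < ρ := by positivity
  have hnρ : n * ρ ≤ r' := by
    rw [hρ, mul_div_assoc', div_le_iff₀ (by positivity)]; nlinarith
  have hnorm : ∀ q, ‖a q‖ ≤ ‖p q.1‖ := by
    intro q
    refine ((p q.1).le_opNorm _).trans ?_
    refine mul_le_of_le_one_right (norm_nonneg _) (Finset.prod_le_one (fun _ _ => norm_nonneg _) ?_)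
    intro j _
    refine (pi_norm_le_iff_of_nonneg zero_le_one).2 fun i => ?_
    by_cases h : i = q.2 j
    · subst h; simp
    · simp [h]
  have hsum0 : Summable (fun q : (Σ k : ℕ, Fin k → Fin n) => ‖a q‖ * ρ ^ q.1) := by
    rw [summable_sigma_of_nonneg (fun q => by positivity)]
    refine ⟨fun k => Summable.of_finite, ?_⟩
    have hs : Summable fun k => ‖p k‖ * (r' : ℝ) ^ k :=
      p.summable_norm_mul_pow (lt_of_lt_of_le hr' hp.r_le)
    refine Summable.of_nonneg_of_le (fun k => tsum_nonneg fun _ => by positivity) (fun k => ?_) hs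
    rw [tsum_fintype]
    calc ∑ i : Fin k → Fin n, ‖a ⟨k, i⟩‖ * ρ ^ k ≤ ∑ i : Fin k → Fin n, ‖p k‖ * ρ ^ k :=
          Finset.sum_le_sum fun i _ => mul_le_mul_of_nonneg_right (hnorm ⟨k, i⟩) (by positivity)
      _ = ‖p k‖ * (n * ρ) ^ k := by
          simp [mul_pow]; ring
      _ ≤ ‖p k‖ * (r' : ℝ) ^ k := by gcongr
  refine ⟨fun m => ∑' q : {q // e q = m}, a q, ?_⟩
  have hball : ∀ᶠ x : Fin n → ℂ in 𝓝 0, ‖x‖ < ρ := by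
    have := Metric.ball_mem_nhds (0 : Fin n → ℂ) hρ0
    filter_upwards [this] with x hx using by simpa using hx
  filter_upwards [hball] with x hx
  have hsx : Summable (fun q => a q * monomialAt x (e q)) := by
    refine Summable.of_norm_bounded hsum0 fun q => ?_
    rw [norm_mul]
    refine mul_le_mul_of_nonneg_left ?_ (norm_nonneg _)
    refine (norm_monomialAt_le hx.le _).trans (le_of_eq ?_)
    congr 1
    have : ∀ s : Finset (Fin q.1), totalDeg (∑ j ∈ s, Finsupp.single (q.2 j) 1) = s.card := by
      intro s
      induction s using Finset.induction_on with
      | empty => simp [totalDeg_zero]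
      | insert b s hb ih =>
        rw [Finset.sum_insert hb, totalDeg_add, totalDeg_single, ih, Finset.card_insert_of_notMem hb]
        ring
    simpa using this Finset.univ
  have hval : HasSum (fun q => a q * monomialAt x (e q)) (g x) := by
    have h1 := hsx.hasSum.sigma (fun k => (hsx.sigma_factor k).hasSum)
    have hxb : x ∈ Metric.eball (0 : Fin n → ℂ) r := by
      rw [Metric.mem_eball, edist_zero_right]
      refine lt_trans ?_ hr'
      rw [enorm_eq_nnnorm, ENNReal.coe_lt_coe, ← NNReal.coe_lt_coe, coe_nnnorm]
      refine hx.trans_le ?_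
      rw [hρ]; exact div_le_self (NNReal.coe_nonneg _) (by linarith [(Nat.cast_nonneg n : (0:ℝ) ≤ n)])
    have h2 := hp.hasSum hxb
    rw [zero_add] at h2
    have h3 : (fun k => ∑' i : Fin k → Fin n, a ⟨k, i⟩ * monomialAt x (e ⟨k, i⟩))
        = fun k => p k fun _ => x := by
      funext k
      rw [tsum_fintype]
      have hx' : (fun _ : Fin k => x) = fun _ : Fin k => ∑ i, x i • (Pi.single i (1:ℂ) : Fin n → ℂ) := by
        funext _; ext i; simp [Finset.sum_apply, Pi.single_apply]
      rw [hx', (p k).map_sum]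
      refine Finset.sum_congr rfl fun i _ => ?_
      rw [(p k).map_smul_univ, monomialAt_sum_single]
      simp [a, mul_comm]
    rw [h3] at h1
    have := hsx.hasSum
    rwa [h1.unique h2] at this
  have h4 := ((Equiv.sigmaFiberEquiv e).hasSum_iff.2 hval).sigma
    (fun m => (((Equiv.sigmaFiberEquiv e).summable_iff.2 hsx).sigma_factor m).hasSum)
  convert h4 using 2 with m
  change (∑' q : {q // e q = m}, a q) * _ = _
  rw [← tsum_mul_right]
  refine tsum_congr fun q => ?_
  simp [Equiv.sigmaFiberEquiv, q.2]

theorem exists_sum_single_eq {n : ℕ} (k : ℕ) (m : Fin n →₀ ℕ) (hk : totalDeg m = k) :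
    ∃ i : Fin k → Fin n, ∑ j, Finsupp.single (i j) 1 = m := by
  induction k generalizing m with
  | zero =>
    refine ⟨Fin.elim0, ?_⟩
    ext a
    simp only [totalDeg, Finset.sum_eq_zero_iff, Finset.mem_univ, true_imp_iff] at hk
    simp [hk a]
  | succ k ih =>
    obtain ⟨a, ha⟩ : ∃ a, m a ≠ 0 := by
      by_contra! h
      simp [totalDeg, h] at hk
    have hm : Finsupp.single a 1 + (m - Finsupp.single a 1) = m := by
      ext b
      by_cases hb : b = a
      · subst hb; simp; omega
      · simp [hb]
    obtain ⟨i, hi⟩ := ih (m - Finsupp.single a 1) (by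
      rw [← hm, totalDeg_add, totalDeg_single] at hk; omega)
    refine ⟨Fin.cons a i, ?_⟩
    rw [Fin.sum_univ_succ]
    simpa [hi] using hm

theorem exists_multilinear_monomialAt {n : ℕ} (m : Fin n →₀ ℕ) (k : ℕ) (hk : totalDeg m = k) :
    ∃ M : ContinuousMultilinearMap ℂ (fun _ : Fin k => Fin n → ℂ) ℂ, ‖M‖ ≤ 1 ∧
      ∀ y, M (fun _ => y) = monomialAt y m := by
  obtain ⟨i, hi⟩ := exists_sum_single_eq k m hk
  refine ⟨(ContinuousMultilinearMap.mkPiAlgebra ℂ (Fin k) ℂ).compContinuousLinearMap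
    (fun j => ContinuousLinearMap.proj (i j)), ?_, fun y => ?_⟩
  · refine ContinuousMultilinearMap.opNorm_le_bound zero_le_one fun v => ?_
    simp only [ContinuousMultilinearMap.compContinuousLinearMap_apply,
      ContinuousLinearMap.proj_apply, ContinuousMultilinearMap.mkPiAlgebra_apply, norm_prod, one_mul]
    exact Finset.prod_le_prod (fun _ _ => norm_nonneg _) fun j _ => norm_le_pi_norm _ _
  · conv_rhs => rw [← hi]
    rw [monomialAt_sum_single]
    simp

/-- Each monomial of degree `k` is the diagonal of a `k`-linear form of norm at most one, so
grouping the monomials by degree gives a power series that converges on the same polydisc. -/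
theorem HasTaylorSeries.analyticAt {n : ℕ} {g : (Fin n → ℂ) → ℂ}
    {c : MvPowerSeries (Fin n) ℂ} (h : HasTaylorSeries g c) : AnalyticAt ℂ g 0 := by
  obtain ⟨ρ, hρ, hs, H⟩ := h.exists_summable
  choose M hM1 hM using fun m : Fin n →₀ ℕ => exists_multilinear_monomialAt m (totalDeg m) rfl
  let N : ∀ k : ℕ, (Fin n →₀ ℕ) → ContinuousMultilinearMap ℂ (fun _ : Fin k => Fin n → ℂ) ℂ :=
    fun k m => if hk : totalDeg m = k then hk ▸ M m else 0
  have hmem : ∀ (k : ℕ) (m : Fin n →₀ ℕ), m ∈ Finset.univ.finsuppAntidiag k ↔ totalDeg m = k := by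
    intro k m; simp [Finset.mem_finsuppAntidiag, totalDeg]
  have hN1 : ∀ k m, ‖N k m‖ ≤ 1 := by
    intro k m
    by_cases hk : totalDeg m = k
    · subst hk; simpa [N] using hM1 m
    · simp [N, hk]
  have hN : ∀ m y, N (totalDeg m) m (fun _ => y) = monomialAt y m := by
    intro m y; simp [N, hM]
  let p : FormalMultilinearSeries ℂ (Fin n → ℂ) ℂ :=
    fun k => ∑ m ∈ Finset.univ.finsuppAntidiag k, MvPowerSeries.coeff m c • N k m
  let E : (Σ k : ℕ, {m // m ∈ (Finset.univ.finsuppAntidiag k : Finset (Fin n →₀ ℕ))}) ≃ (Fin n →₀ ℕ) :=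
    { toFun := fun q => q.2.1
      invFun := fun m => ⟨totalDeg m, m, (hmem _ _).2 rfl⟩
      left_inv := by
        rintro ⟨k, m, hm⟩
        obtain rfl := (hmem _ _).1 hm
        rfl
      right_inv := fun m => rfl }
  refine ⟨p, ENNReal.ofReal ρ, ⟨?_, by simpa using hρ, ?_⟩⟩
  · have h1 := (E.summable_iff.2 hs).sigma
    have : Summable fun k => ‖p k‖ * (⟨ρ, hρ.le⟩ : NNReal) ^ k := by
      refine Summable.of_nonneg_of_le (fun k => by positivity) (fun k => ?_) h1
      rw [tsum_fintype]
      change _ ≤ ∑ q : {m // m ∈ (Finset.univ.finsuppAntidiag k : Finset (Fin n →₀ ℕ))},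
        ‖MvPowerSeries.coeff q.1 c‖ * ρ ^ totalDeg q.1
      rw [Finset.sum_coe_sort (Finset.univ.finsuppAntidiag k : Finset (Fin n →₀ ℕ))
        (fun m => ‖MvPowerSeries.coeff m c‖ * ρ ^ totalDeg m)]
      refine (mul_le_mul_of_nonneg_right (norm_sum_le _ _) (by positivity)).trans ?_
      rw [Finset.sum_mul]
      refine Finset.sum_le_sum fun m hm => ?_
      rw [(hmem _ _).1 hm, norm_smul]
      refine mul_le_mul_of_nonneg_right ?_ (by positivity)
      exact mul_le_of_le_one_right (norm_nonneg _) (hN1 _ _)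
    have := p.le_radius_of_summable_norm this
    convert this using 1
    rw [ENNReal.ofReal, Real.toNNReal_of_nonneg hρ.le]; rfl
  · intro y hy
    rw [zero_add]
    have hyρ : ‖y‖ ≤ ρ := by
      rw [Metric.mem_eball, edist_zero_right, ← ofReal_norm] at hy
      exact ((ENNReal.ofReal_lt_ofReal_iff hρ).1 hy).le
    have h1 := (E.hasSum_iff.2 (H y hyρ)).sigma (fun k => hasSum_fintype _)
    have h2 : ∀ k, p k (fun _ => y) = ∑ q : {m // m ∈ (Finset.univ.finsuppAntidiag k :
        Finset (Fin n →₀ ℕ))}, MvPowerSeries.coeff q.1 c * monomialAt y q.1 := ?_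
    · simp only [h2]; exact h1
    intro k
    rw [Finset.sum_coe_sort (Finset.univ.finsuppAntidiag k : Finset (Fin n →₀ ℕ))
        (fun m => MvPowerSeries.coeff m c * monomialAt y m)]
    simp only [p, sum_apply, smul_apply]
    refine Finset.sum_congr rfl fun m hm => ?_
    obtain rfl := (hmem _ _).1 hm
    rw [hN]; rfl


/-! ### Leading weighted homogeneous parts of analytic germs. -/

/-- The weighted dilation `y ↦ (t ^ ω₁ y₁, …, t ^ ωₙ yₙ)`. -/
def wscale {n : ℕ} (ω : Fin n → ℕ) (t : ℂ) (y : Fin n → ℂ) : Fin n → ℂ :=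
  fun i => t ^ ω i * y i

/-- The function `V` has, for the weights `ω`, order at least `d` at the origin, and `P` is its
component of weighted degree `d`. -/
def HasLead {n : ℕ} (ω : Fin n → ℕ) (V : (Fin n → ℂ) → ℂ) (d : ℕ)
    (P : MvPolynomial (Fin n) ℂ) : Prop :=
  ∀ y : Fin n → ℂ, Tendsto (fun q : ℂ × (Fin n → ℂ) => (q.1 ^ d)⁻¹ * V (wscale ω q.1 q.2))
    (𝓝[≠] 0 ×ˢ 𝓝 y) (𝓝 (MvPolynomial.eval y P))

theorem eval_eq_sum_monomialAt {n : ℕ} (p : MvPolynomial (Fin n) ℂ) (y : Fin n → ℂ) :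
    MvPolynomial.eval y p = ∑ m ∈ p.support, p.coeff m * monomialAt y m := by
  rw [MvPolynomial.eval_eq]
  refine Finset.sum_congr rfl fun m _ => ?_
  rw [monomialAt]
  congr 1
  exact Finset.prod_subset (Finset.subset_univ _) fun i _ hi => by
    simp [Finsupp.notMem_support_iff.1 hi]

theorem hasTaylorSeries_eval {n : ℕ} (p : MvPolynomial (Fin n) ℂ) :
    HasTaylorSeries (fun x => MvPolynomial.eval x p) (p : MvPowerSeries (Fin n) ℂ) := by
  refine Eventually.of_forall fun x => ?_
  simp only [eval_eq_sum_monomialAt, MvPolynomial.coeff_coe]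
  refine hasSum_sum_of_ne_finset_zero fun m hm => ?_
  rw [MvPolynomial.notMem_support_iff.1 hm, zero_mul]

theorem monomialAt_wscale {n : ℕ} (ω : Fin n → ℕ) (t : ℂ) (y : Fin n → ℂ) (m : Fin n →₀ ℕ) :
    monomialAt (wscale ω t y) m = t ^ Finsupp.weight ω m * monomialAt y m := by
  unfold wscale
  rw [monomialAt_mul, Finsupp.weight_apply, Finsupp.sum_fintype _ _ (by simp),
    monomialAt, ← Finset.prod_pow_eq_pow_sum]
  congr 1
  refine Finset.prod_congr rfl fun i _ => ?_
  rw [← pow_mul, smul_eq_mul, mul_comm]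

theorem totalDeg_le_weight {n : ℕ} {ω : Fin n → ℕ} (hω : ∀ i, 1 ≤ ω i) (m : Fin n →₀ ℕ) :
    totalDeg m ≤ Finsupp.weight ω m := by
  rw [Finsupp.weight_apply, Finsupp.sum_fintype _ _ (by simp), totalDeg]
  exact Finset.sum_le_sum fun i _ => by simpa using Nat.le_mul_of_pos_right (m i) (hω i)

/-- The exponents of total degree less than `N`. -/
noncomputable def degLT (n N : ℕ) : Finset (Fin n →₀ ℕ) :=
  (Finset.range N).biUnion fun k => Finset.univ.finsuppAntidiag k

theorem mem_degLT {n N : ℕ} (m : Fin n →₀ ℕ) : m ∈ degLT n N ↔ totalDeg m < N := by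
  simp [degLT, Finset.mem_finsuppAntidiag, totalDeg]

/-- The Taylor polynomial: the part of degree less than `N` of a power series. -/
noncomputable def truncDeg {n : ℕ} (c : MvPowerSeries (Fin n) ℂ) (N : ℕ) :
    MvPolynomial (Fin n) ℂ :=
  ∑ m ∈ degLT n N, MvPolynomial.monomial m (MvPowerSeries.coeff m c)

theorem eval_truncDeg {n : ℕ} (c : MvPowerSeries (Fin n) ℂ) (N : ℕ) (x : Fin n → ℂ) :
    MvPolynomial.eval x (truncDeg c N) =
      ∑ m ∈ degLT n N, MvPowerSeries.coeff m c * monomialAt x m := by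
  rw [truncDeg, map_sum]
  refine Finset.sum_congr rfl fun m _ => ?_
  rw [MvPolynomial.eval_monomial, Finsupp.prod_fintype _ _ (by simp)]; rfl

theorem coeff_truncDeg {n : ℕ} (c : MvPowerSeries (Fin n) ℂ) (N : ℕ) (m : Fin n →₀ ℕ) :
    (truncDeg c N).coeff m = if totalDeg m < N then MvPowerSeries.coeff m c else 0 := by
  classical
  simp [truncDeg, MvPolynomial.coeff_sum, MvPolynomial.coeff_monomial, mem_degLT]

/-- The component of weighted degree `d` of a power series. -/
noncomputable def wcomp {n : ℕ} (ω : Fin n → ℕ) (c : MvPowerSeries (Fin n) ℂ) (d : ℕ) :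
    MvPolynomial (Fin n) ℂ :=
  MvPolynomial.weightedHomogeneousComponent ω d (truncDeg c (d + 1))

/-- Weights are at least one, so the total degree never exceeds the weight, and truncating at total
degree `d` loses nothing of weighted degree `d`. -/
theorem coeff_wcomp {n : ℕ} {ω : Fin n → ℕ} (hω : ∀ i, 1 ≤ ω i) (c : MvPowerSeries (Fin n) ℂ)
    (d : ℕ) (m : Fin n →₀ ℕ) :
    (wcomp ω c d).coeff m = if Finsupp.weight ω m = d then MvPowerSeries.coeff m c else 0 := by
  rw [wcomp, MvPolynomial.coeff_weightedHomogeneousComponent, coeff_truncDeg]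
  have := totalDeg_le_weight hω m
  split_ifs <;> first | rfl | omega

theorem eval_wcomp {n : ℕ} {ω : Fin n → ℕ} (hω : ∀ i, 1 ≤ ω i) (c : MvPowerSeries (Fin n) ℂ)
    (d : ℕ) {N : ℕ} (hN : d < N) (y : Fin n → ℂ) :
    MvPolynomial.eval y (wcomp ω c d) = ∑ m ∈ degLT n N,
      if Finsupp.weight ω m = d then MvPowerSeries.coeff m c * monomialAt y m else 0 := by
  rw [eval_eq_sum_monomialAt]
  have h1 : (wcomp ω c d).support ⊆ degLT n N := by
    intro m hm
    rw [MvPolynomial.mem_support_iff, coeff_wcomp hω] at hm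
    rw [mem_degLT]
    have := totalDeg_le_weight hω m
    split_ifs at hm
    · omega
    · simp at hm
  rw [Finset.sum_subset h1 fun m _ hm => by rw [MvPolynomial.notMem_support_iff.1 hm, zero_mul]]
  refine Finset.sum_congr rfl fun m _ => ?_
  rw [coeff_wcomp hω, ite_mul, zero_mul]

theorem HasTaylorSeries.isBigO_sub_truncDeg {n : ℕ} {g : (Fin n → ℂ) → ℂ}
    {c : MvPowerSeries (Fin n) ℂ} (h : HasTaylorSeries g c) (N : ℕ) :
    (fun x => g x - MvPolynomial.eval x (truncDeg c N)) =O[𝓝 0] fun x => ‖x‖ ^ N := by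
  obtain ⟨ρ, hρ, hs, H⟩ := h.exists_summable
  refine IsBigO.of_bound ((∑' m, ‖MvPowerSeries.coeff m c‖ * ρ ^ totalDeg m) / ρ ^ N) ?_
  filter_upwards [Metric.ball_mem_nhds (0 : Fin n → ℂ) hρ] with x hx
  have hx : ‖x‖ ≤ ρ := by simpa using (Metric.mem_ball.1 hx).le
  have h1 : HasSum (fun m => if m ∈ degLT n N then MvPowerSeries.coeff m c * monomialAt x m else 0)
      (∑ m ∈ degLT n N, if m ∈ degLT n N then MvPowerSeries.coeff m c * monomialAt x m else 0) :=
    hasSum_sum_of_ne_finset_zero fun m hm => by simp [hm]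
  rw [Finset.sum_congr rfl (g := fun m => MvPowerSeries.coeff m c * monomialAt x m)
    (fun m hm => by simp [hm]), ← eval_truncDeg] at h1
  have h2 := (H x hx).sub h1
  rw [← h2.tsum_eq]
  have hb : ∀ m, ‖MvPowerSeries.coeff m c * monomialAt x m - (if m ∈ degLT n N then
      MvPowerSeries.coeff m c * monomialAt x m else 0)‖ ≤
      ‖MvPowerSeries.coeff m c‖ * ρ ^ totalDeg m * (‖x‖ ^ N / ρ ^ N) := by
    intro m
    by_cases hm : m ∈ degLT n N
    · simp only [hm, if_true, sub_self, norm_zero]; positivity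
    · simp only [hm, if_false, sub_zero, norm_mul]
      rw [mul_assoc]
      refine mul_le_mul_of_nonneg_left ?_ (norm_nonneg _)
      refine (norm_monomialAt_le le_rfl m).trans ?_
      rw [mem_degLT, not_lt] at hm
      obtain ⟨k, hk⟩ := Nat.exists_eq_add_of_le hm
      rw [hk, pow_add, pow_add, mul_div_assoc', le_div_iff₀ (by positivity)]
      have : ‖x‖ ^ k ≤ ρ ^ k := pow_le_pow_left₀ (norm_nonneg _) hx _
      calc ‖x‖ ^ N * ‖x‖ ^ k * ρ ^ N ≤ ‖x‖ ^ N * ρ ^ k * ρ ^ N := by gcongr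
        _ = _ := by ring
  refine (tsum_of_norm_bounded (hs.mul_right _).hasSum hb).trans (le_of_eq ?_)
  rw [tsum_mul_right, Real.norm_of_nonneg (by positivity)]
  ring

theorem tendsto_wscale {n : ℕ} {ω : Fin n → ℕ} (hω : ∀ i, 1 ≤ ω i) {α : Type*} {l : Filter α}
    {t : α → ℂ} {ξ : α → Fin n → ℂ} {y : Fin n → ℂ} (ht : Tendsto t l (𝓝 0))
    (hξ : Tendsto ξ l (𝓝 y)) : Tendsto (fun a => wscale ω (t a) (ξ a)) l (𝓝 0) := by
  rw [tendsto_pi_nhds] at hξ ⊢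
  intro i
  have := (ht.pow (ω i)).mul (hξ i)
  simpa [wscale, zero_pow (Nat.one_le_iff_ne_zero.1 (hω i))] using this

theorem isBigO_wscale {n : ℕ} {ω : Fin n → ℕ} (hω : ∀ i, 1 ≤ ω i) {α : Type*} {l : Filter α}
    {t : α → ℂ} {ξ : α → Fin n → ℂ} {y : Fin n → ℂ} (ht : Tendsto t l (𝓝 0))
    (hξ : Tendsto ξ l (𝓝 y)) : (fun a => wscale ω (t a) (ξ a)) =O[l] t := by
  rw [isBigO_pi]
  intro i
  have h1 : (fun a => t a ^ ω i) =O[l] t := by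
    obtain ⟨k, hk⟩ := Nat.exists_eq_add_of_le (hω i)
    have : (fun a => t a ^ ω i) = fun a => t a * t a ^ k := by
      funext a; rw [hk, pow_add, pow_one]
    rw [this]
    simpa using (isBigO_refl t l).mul ((ht.pow k).isBigO_one ℂ)
  have h2 := ((tendsto_pi_nhds.1 hξ) i).isBigO_one ℂ
  simpa [wscale] using h1.mul h2

/-- A remainder of order `N > K` does not contribute in weighted degree `K`. -/
theorem tendsto_remainder {n : ℕ} {α : Type*} {l : Filter α}
    {t : α → ℂ} {x : α → Fin n → ℂ} (ht : Tendsto t l (𝓝[≠] 0))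
    (hx : x =O[l] t) {R : (Fin n → ℂ) → ℂ} {N K : ℕ} (hK : K < N)
    (hR : R =O[𝓝 0] fun x => ‖x‖ ^ N) :
    Tendsto (fun a => (t a ^ K)⁻¹ * R (x a)) l (𝓝 0) := by
  have ht0 := tendsto_nhds_of_tendsto_nhdsWithin ht
  have hx0 : Tendsto x l (𝓝 0) := hx.trans_tendsto ht0
  have h1 : (fun a => R (x a)) =O[l] fun a => t a ^ N :=
    (hR.comp_tendsto hx0).trans ((hx.norm_left.pow N))
  have h2 : (fun a => (t a ^ K)⁻¹ * R (x a)) =O[l] fun a => (t a ^ K)⁻¹ * t a ^ N :=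
    (isBigO_refl _ l).mul h1
  refine h2.trans_tendsto ?_
  have h3 : Tendsto (fun a => t a ^ (N - K)) l (𝓝 0) := by
    simpa [zero_pow (Nat.sub_ne_zero_of_lt hK)] using ht0.pow (N - K)
  refine h3.congr' ?_
  filter_upwards [ht (self_mem_nhdsWithin)] with a ha
  have ha : t a ≠ 0 := ha
  rw [eq_inv_mul_iff_mul_eq₀ (pow_ne_zero _ ha), ← pow_add]
  congr 1; omega

theorem continuous_monomialAt {n : ℕ} (m : Fin n →₀ ℕ) :
    Continuous fun x : Fin n → ℂ => monomialAt x m := by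
  unfold monomialAt; fun_prop

/-- Only finitely many monomials matter: the part of total degree above `d` is negligible against `t
^ d`, and a remaining monomial of weight `d + k` contributes a multiple of `t ^ k`. -/
theorem HasTaylorSeries.hasLead {n : ℕ} {ω : Fin n → ℕ} (hω : ∀ i, 1 ≤ ω i)
    {g : (Fin n → ℂ) → ℂ} {c : MvPowerSeries (Fin n) ℂ} (h : HasTaylorSeries g c) {d : ℕ}
    (hd : ∀ m, Finsupp.weight ω m < d → MvPowerSeries.coeff m c = 0) :
    HasLead ω g d (wcomp ω c d) := by
  intro y
  have ht : Tendsto (Prod.fst : ℂ × (Fin n → ℂ) → ℂ) (𝓝[≠] 0 ×ˢ 𝓝 y) (𝓝[≠] 0) := tendsto_fst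
  have ht0 := tendsto_nhds_of_tendsto_nhdsWithin ht
  have hξ : Tendsto (Prod.snd : ℂ × (Fin n → ℂ) → _) (𝓝[≠] 0 ×ˢ 𝓝 y) (𝓝 y) := tendsto_snd
  have h1 := tendsto_remainder ht (isBigO_wscale hω ht0 hξ) (Nat.lt_succ_self d)
    (h.isBigO_sub_truncDeg (d + 1))
  have h2 : Tendsto (fun q : ℂ × (Fin n → ℂ) => ∑ m ∈ degLT n (d + 1),
      (q.1 ^ d)⁻¹ * (MvPowerSeries.coeff m c * monomialAt (wscale ω q.1 q.2) m))
      (𝓝[≠] 0 ×ˢ 𝓝 y) (𝓝 (MvPolynomial.eval y (wcomp ω c d))) := by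
    rw [eval_wcomp hω c d (Nat.lt_succ_self d)]
    refine tendsto_finsetSum _ fun m _ => ?_
    have hm : Tendsto (fun q : ℂ × (Fin n → ℂ) => monomialAt q.2 m) (𝓝[≠] 0 ×ˢ 𝓝 y)
      (𝓝 (monomialAt y m)) := ((continuous_monomialAt m).tendsto y).comp hξ
    rcases lt_or_ge (Finsupp.weight ω m) d with hlt | hge
    · simp [hd m hlt]
    · obtain ⟨k, hk⟩ := Nat.exists_eq_add_of_le hge
      have h3 := ((ht0.pow k).mul hm).const_mul (MvPowerSeries.coeff m c)
      have h4 : MvPowerSeries.coeff m c * (0 ^ k * monomialAt y m) =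
          if Finsupp.weight ω m = d then MvPowerSeries.coeff m c * monomialAt y m else 0 := by
        rcases Nat.eq_zero_or_pos k with rfl | hk0
        · simp [hk]
        · rw [if_neg (by omega), zero_pow hk0.ne']; simp
      rw [h4] at h3
      refine h3.congr' ?_
      filter_upwards [ht self_mem_nhdsWithin] with q hq
      have hq : q.1 ≠ 0 := hq
      rw [monomialAt_wscale, hk, pow_add]
      field_simp
  have h5 := h2.add h1
  rw [add_zero] at h5
  refine h5.congr fun q => ?_
  rw [eval_truncDeg, ← Finset.mul_sum]
  ring

theorem HasLead.lower {n : ℕ} {ω : Fin n → ℕ} {g : (Fin n → ℂ) → ℂ} {d d' : ℕ}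
    {P : MvPolynomial (Fin n) ℂ} (h : HasLead ω g d P) (hd : d' < d) : HasLead ω g d' 0 := by
  intro y
  have ht : Tendsto (Prod.fst : ℂ × (Fin n → ℂ) → ℂ) (𝓝[≠] 0 ×ˢ 𝓝 y) (𝓝[≠] 0) := tendsto_fst
  have ht0 := tendsto_nhds_of_tendsto_nhdsWithin ht
  have h1 := (ht0.pow (d - d')).mul (h y)
  rw [zero_pow (by omega), zero_mul] at h1
  rw [map_zero]
  refine h1.congr' ?_
  filter_upwards [ht self_mem_nhdsWithin] with q hq
  have hq : q.1 ≠ 0 := hq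
  rw [← mul_assoc]
  congr 1
  rw [eq_comm, inv_eq_iff_eq_inv, mul_inv, inv_inv, eq_inv_mul_iff_mul_eq₀ (pow_ne_zero _ hq),
    ← pow_add]
  congr 1; omega

instance neBot_lead {n : ℕ} (y : Fin n → ℂ) : NeBot (𝓝[≠] (0 : ℂ) ×ˢ 𝓝 y) := by
  infer_instance

theorem HasLead.unique {n : ℕ} {ω : Fin n → ℕ} {g : (Fin n → ℂ) → ℂ} {d : ℕ}
    {P Q : MvPolynomial (Fin n) ℂ} (h : HasLead ω g d P) (h' : HasLead ω g d Q) : P = Q :=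
  MvPolynomial.funext fun y => tendsto_nhds_unique (h y) (h' y)

/-- Otherwise the lowest nonzero weighted component would be the lead in a degree below `d`, where
the lead is zero. -/
theorem HasLead.coeff_eq_zero {n : ℕ} {ω : Fin n → ℕ} (hω : ∀ i, 1 ≤ ω i)
    {g : (Fin n → ℂ) → ℂ} {c : MvPowerSeries (Fin n) ℂ} (hc : HasTaylorSeries g c) {d : ℕ}
    {P : MvPolynomial (Fin n) ℂ} (h : HasLead ω g d P) (m : Fin n →₀ ℕ)
    (hm : Finsupp.weight ω m < d) : MvPowerSeries.coeff m c = 0 := by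
  by_contra hne
  classical
  have hex : ∃ k, ∃ m, Finsupp.weight ω m = k ∧ k < d ∧ MvPowerSeries.coeff m c ≠ 0 :=
    ⟨_, m, rfl, hm, hne⟩
  obtain ⟨m', hm', hlt, hne'⟩ := Nat.find_spec hex
  have h1 : HasLead ω g (Nat.find hex) (wcomp ω c (Nat.find hex)) := by
    refine hc.hasLead hω fun a ha => ?_
    by_contra h0
    exact Nat.find_min hex ha ⟨a, rfl, ha.trans hlt, h0⟩
  have h2 := h1.unique (h.lower hlt)
  have h3 := coeff_wcomp hω c (Nat.find hex) m'
  rw [h2, if_pos hm', MvPolynomial.coeff_zero] at h3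
  exact hne' h3.symm

theorem HasLead.eq_wcomp {n : ℕ} {ω : Fin n → ℕ} (hω : ∀ i, 1 ≤ ω i)
    {g : (Fin n → ℂ) → ℂ} {c : MvPowerSeries (Fin n) ℂ} (hc : HasTaylorSeries g c) {d : ℕ}
    {P : MvPolynomial (Fin n) ℂ} (h : HasLead ω g d P) : P = wcomp ω c d :=
  h.unique (hc.hasLead hω (h.coeff_eq_zero hω hc))

theorem HasLead.isWeightedHomogeneous {n : ℕ} {ω : Fin n → ℕ} (hω : ∀ i, 1 ≤ ω i)
    {g : (Fin n → ℂ) → ℂ} (hg : AnalyticAt ℂ g 0) {d : ℕ} {P : MvPolynomial (Fin n) ℂ}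
    (h : HasLead ω g d P) : MvPolynomial.IsWeightedHomogeneous ω P d := by
  obtain ⟨c, hc⟩ := exists_hasTaylorSeries hg
  rw [h.eq_wcomp hω hc]
  exact MvPolynomial.weightedHomogeneousComponent_isWeightedHomogeneous _ _

theorem exists_hasLead {n : ℕ} {ω : Fin n → ℕ} (hω : ∀ i, 1 ≤ ω i) {g : (Fin n → ℂ) → ℂ}
    (hg : AnalyticAt ℂ g 0) (h0 : ¬ ∀ᶠ x in 𝓝 0, g x = 0) :
    ∃ d P, P ≠ 0 ∧ HasLead ω g d P := by
  classical
  obtain ⟨c, hc⟩ := exists_hasTaylorSeries hg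
  have hex : ∃ k, ∃ m, Finsupp.weight ω m = k ∧ MvPowerSeries.coeff m c ≠ 0 := by
    by_contra! H
    refine h0 ?_
    filter_upwards [hc] with x hx
    have : (fun m => MvPowerSeries.coeff m c * monomialAt x m) = fun _ => 0 := by
      funext m; rw [H _ m rfl, zero_mul]
    rw [this] at hx
    exact hx.unique hasSum_zero
  obtain ⟨m, hm, hne⟩ := Nat.find_spec hex
  refine ⟨Nat.find hex, wcomp ω c (Nat.find hex), fun h => ?_, hc.hasLead hω fun a ha => ?_⟩
  · have := coeff_wcomp hω c (Nat.find hex) m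
    rw [h, if_pos hm, MvPolynomial.coeff_zero] at this
    exact hne this.symm
  · by_contra h1
    exact Nat.find_min hex ha ⟨a, rfl, h1⟩

theorem HasLead.not_eventually_zero {n : ℕ} {ω : Fin n → ℕ} (hω : ∀ i, 1 ≤ ω i)
    {g : (Fin n → ℂ) → ℂ} {d : ℕ} {P : MvPolynomial (Fin n) ℂ} (h : HasLead ω g d P)
    (hP : P ≠ 0) : ¬ ∀ᶠ x in 𝓝 0, g x = 0 := by
  intro h0
  refine hP (h.unique fun y => ?_)
  rw [map_zero]
  have : Tendsto (fun q : ℂ × (Fin n → ℂ) => wscale ω q.1 q.2) (𝓝[≠] 0 ×ˢ 𝓝 y) (𝓝 0) :=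
    tendsto_wscale hω (tendsto_nhds_of_tendsto_nhdsWithin tendsto_fst) tendsto_snd
  refine tendsto_const_nhds.congr' ?_
  filter_upwards [this.eventually h0] with q hq
  rw [hq, mul_zero]

theorem HasLead.mul {n : ℕ} {ω : Fin n → ℕ} {g g' : (Fin n → ℂ) → ℂ} {d d' : ℕ}
    {P P' : MvPolynomial (Fin n) ℂ} (h : HasLead ω g d P) (h' : HasLead ω g' d' P') :
    HasLead ω (fun x => g x * g' x) (d + d') (P * P') := by
  intro y
  rw [map_mul]
  refine ((h y).mul (h' y)).congr fun q => ?_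
  rw [pow_add, mul_inv]; ring

theorem HasLead.add {n : ℕ} {ω : Fin n → ℕ} {g g' : (Fin n → ℂ) → ℂ} {d : ℕ}
    {P P' : MvPolynomial (Fin n) ℂ} (h : HasLead ω g d P) (h' : HasLead ω g' d P') :
    HasLead ω (fun x => g x + g' x) d (P + P') := by
  intro y
  rw [map_add]
  refine ((h y).add (h' y)).congr fun q => ?_
  ring

theorem HasLead.const {n : ℕ} {ω : Fin n → ℕ} (a : ℂ) :
    HasLead ω (fun _ => a) 0 (MvPolynomial.C a) := by
  intro y
  simp only [pow_zero, inv_one, one_mul, MvPolynomial.eval_C]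
  exact tendsto_const_nhds

theorem HasLead.sum {n : ℕ} {ω : Fin n → ℕ} {ι : Type*} (s : Finset ι)
    {g : ι → (Fin n → ℂ) → ℂ} {d : ℕ} {P : ι → MvPolynomial (Fin n) ℂ}
    (h : ∀ i ∈ s, HasLead ω (g i) d (P i)) :
    HasLead ω (fun x => ∑ i ∈ s, g i x) d (∑ i ∈ s, P i) := by
  intro y
  rw [map_sum]
  refine (tendsto_finsetSum s fun i hi => h i hi y).congr fun q => ?_
  rw [Finset.mul_sum]

theorem HasLead.prod {n : ℕ} {ω : Fin n → ℕ} {ι : Type*} (s : Finset ι)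
    {g : ι → (Fin n → ℂ) → ℂ} {d : ι → ℕ} {P : ι → MvPolynomial (Fin n) ℂ}
    (h : ∀ i ∈ s, HasLead ω (g i) (d i) (P i)) :
    HasLead ω (fun x => ∏ i ∈ s, g i x) (∑ i ∈ s, d i) (∏ i ∈ s, P i) := by
  intro y
  rw [map_prod]
  refine (tendsto_finsetProd s fun i hi => h i hi y).congr fun q => ?_
  rw [Finset.prod_mul_distrib, Finset.prod_inv_distrib, Finset.prod_pow_eq_pow_sum]

theorem HasLead.const_mul {n : ℕ} {ω : Fin n → ℕ} {g : (Fin n → ℂ) → ℂ} {d : ℕ}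
    {P : MvPolynomial (Fin n) ℂ} (a : ℂ) (h : HasLead ω g d P) :
    HasLead ω (fun x => a * g x) d (MvPolynomial.C a * P) := by
  simpa using (HasLead.const a).mul h

theorem HasLead.congr {n : ℕ} {ω : Fin n → ℕ} (hω : ∀ i, 1 ≤ ω i) {g g' : (Fin n → ℂ) → ℂ}
    {d : ℕ} {P : MvPolynomial (Fin n) ℂ} (h : HasLead ω g d P) (h' : ∀ᶠ x in 𝓝 0, g x = g' x) :
    HasLead ω g' d P := by
  intro y
  have : Tendsto (fun q : ℂ × (Fin n → ℂ) => wscale ω q.1 q.2) (𝓝[≠] 0 ×ˢ 𝓝 y) (𝓝 0) :=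
    tendsto_wscale hω (tendsto_nhds_of_tendsto_nhdsWithin tendsto_fst) tendsto_snd
  refine (h y).congr' ?_
  filter_upwards [this.eventually h'] with q hq
  rw [hq]

/-- The limit in `HasLead` is joint in scale and point precisely so that the point may move with the
scale. This is what allows leads to be composed with rescaled maps. -/
theorem HasLead.tendsto {n : ℕ} {ω : Fin n → ℕ} {g : (Fin n → ℂ) → ℂ} {d : ℕ}
    {P : MvPolynomial (Fin n) ℂ} (h : HasLead ω g d P) {α : Type*} {l : Filter α}
    {t : α → ℂ} {ξ : α → Fin n → ℂ} {y : Fin n → ℂ} (ht : Tendsto t l (𝓝[≠] 0))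
    (hξ : Tendsto ξ l (𝓝 y)) :
    Tendsto (fun a => (t a ^ d)⁻¹ * g (wscale ω (t a) (ξ a))) l (𝓝 (MvPolynomial.eval y P)) := by
  have h1 : Tendsto (fun a => (t a, ξ a)) l (𝓝[≠] 0 ×ˢ 𝓝 y) := ht.prodMk hξ
  simpa only [Function.comp_def] using (h y).comp h1


/-! ### Increments and Euler derivatives of germs with a given lead. -/

/-- The differential of a polynomial function. -/
noncomputable def polyFDeriv {n : ℕ} (p : MvPolynomial (Fin n) ℂ) (x : Fin n → ℂ) :
    (Fin n → ℂ) →L[ℂ] ℂ :=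
  ∑ i, MvPolynomial.eval x (MvPolynomial.pderiv i p) • ContinuousLinearMap.proj i

theorem polyFDeriv_apply {n : ℕ} (p : MvPolynomial (Fin n) ℂ) (x v : Fin n → ℂ) :
    polyFDeriv p x v = ∑ i, MvPolynomial.eval x (MvPolynomial.pderiv i p) * v i := by
  simp [polyFDeriv]

theorem hasStrictFDerivAt_eval {n : ℕ} (p : MvPolynomial (Fin n) ℂ) (x : Fin n → ℂ) :
    HasStrictFDerivAt (fun x => MvPolynomial.eval x p) (polyFDeriv p x) x := by
  induction p using MvPolynomial.induction_on with
  | C a =>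
    simp only [MvPolynomial.eval_C]
    refine (hasStrictFDerivAt_const (𝕜 := ℂ) a x).congr_fderiv ?_
    ext v; simp [polyFDeriv_apply]
  | add p q hp hq =>
    simp only [map_add]
    refine (hp.fun_add hq).congr_fderiv ?_
    ext v
    simp [polyFDeriv_apply, Finset.sum_add_distrib, add_mul]
  | mul_X p i hp =>
    simp only [map_mul, MvPolynomial.eval_X]
    have h1 : HasStrictFDerivAt (fun x : Fin n → ℂ => x i) (ContinuousLinearMap.proj i) x :=
      (ContinuousLinearMap.proj (R := ℂ) (φ := fun _ : Fin n => ℂ) i).hasStrictFDerivAt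
    refine (hp.fun_mul h1).congr_fderiv ?_
    ext1 v
    simp only [polyFDeriv_apply, MvPolynomial.pderiv_mul, map_add, map_mul, MvPolynomial.eval_X,
      add_mul, Finset.sum_add_distrib, add_apply, smul_apply, ContinuousLinearMap.proj_apply,
      smul_eq_mul, Finset.mul_sum]
    have h2 : ∑ j, MvPolynomial.eval x p * MvPolynomial.eval x
        (MvPolynomial.pderiv j (MvPolynomial.X i)) * v j = MvPolynomial.eval x p * v i := by
      rw [Finset.sum_eq_single i]
      · simp
      · intro j _ hj
        rw [MvPolynomial.pderiv_X_of_ne hj.symm]; simp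
      · simp
    rw [h2, add_comm]
    congr 1
    exact Finset.sum_congr rfl fun j _ => by ring

/-- Both ends of the increment move, which is why strict differentiability is needed. -/
theorem HasStrictFDerivAt.tendsto_diffQuot {E : Type*} [NormedAddCommGroup E] [NormedSpace ℂ E]
    {f : E → ℂ} {f' : E →L[ℂ] ℂ} {x : E} (hf : HasStrictFDerivAt f f' x) {α : Type*}
    {l : Filter α} {s : α → ℂ} {ξ η : α → E} {v : E} (hs : Tendsto s l (𝓝[≠] 0))
    (hξ : Tendsto ξ l (𝓝 x)) (hη : Tendsto η l (𝓝 v)) :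
    Tendsto (fun a => (s a)⁻¹ * (f (ξ a + s a • η a) - f (ξ a))) l (𝓝 (f' v)) := by
  have hs0 := tendsto_nhds_of_tendsto_nhdsWithin hs
  have h1 : Tendsto (fun a => ξ a + s a • η a) l (𝓝 x) := by
    simpa using hξ.add (hs0.smul hη)
  have h2 := hf.isLittleO.comp_tendsto (h1.prodMk_nhds hξ)
  have h3 : (fun a => f (ξ a + s a • η a) - f (ξ a) - s a * f' (η a)) =o[l] s := by
    have h4 : (fun a => s a • η a) =O[l] s := by
      simpa using (isBigO_refl s l).smul (hη.isBigO_one ℂ)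
    refine IsLittleO.trans_isBigO ?_ h4
    simpa [Function.comp_def] using h2
  have h5 := (h3.tendsto_div_nhds_zero).add ((f'.continuous.tendsto v).comp hη)
  rw [zero_add] at h5
  refine h5.congr' ?_
  filter_upwards [hs self_mem_nhdsWithin] with a ha
  have ha : s a ≠ 0 := ha
  simp only [Function.comp]
  field_simp
  ring

/-- The increment of a function between two points that agree up to relative weight `δ`. -/
theorem HasLead.tendsto_sub {n : ℕ} {ω : Fin n → ℕ} (hω : ∀ i, 1 ≤ ω i) {V : (Fin n → ℂ) → ℂ}
    (hV : AnalyticAt ℂ V 0) {d : ℕ} {P : MvPolynomial (Fin n) ℂ} (h : HasLead ω V d P)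
    {δ : ℕ} (hδ : 1 ≤ δ) {α : Type*} {l : Filter α} {t : α → ℂ} {ξ η : α → Fin n → ℂ}
    {x v : Fin n → ℂ} (ht : Tendsto t l (𝓝[≠] 0)) (hξ : Tendsto ξ l (𝓝 x))
    (hη : Tendsto η l (𝓝 v)) :
    Tendsto (fun a => (t a ^ (d + δ))⁻¹ *
      (V (wscale ω (t a) (ξ a + t a ^ δ • η a)) - V (wscale ω (t a) (ξ a)))) l
      (𝓝 (polyFDeriv P x v)) := by
  obtain ⟨c, hc⟩ := exists_hasTaylorSeries hV
  have ht0 := tendsto_nhds_of_tendsto_nhdsWithin ht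
  have hs : Tendsto (fun a => t a ^ δ) l (𝓝[≠] 0) := by
    have h0 := ht0.pow δ
    rw [zero_pow (Nat.one_le_iff_ne_zero.1 hδ)] at h0
    refine tendsto_nhdsWithin_iff.2 ⟨h0, ?_⟩
    filter_upwards [ht self_mem_nhdsWithin] with a ha using pow_ne_zero _ ha
  have hξ' : Tendsto (fun a => ξ a + t a ^ δ • η a) l (𝓝 x) := by
    simpa using hξ.add ((tendsto_nhds_of_tendsto_nhdsWithin hs).smul hη)
  have hK : d + δ < d + δ + 1 := Nat.lt_succ_self _
  have hR := hc.isBigO_sub_truncDeg (d + δ + 1)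
  have hr1 := tendsto_remainder ht (isBigO_wscale hω ht0 hξ') hK hR
  have hr2 := tendsto_remainder ht (isBigO_wscale hω ht0 hξ) hK hR
  have hP : P = ∑ m ∈ degLT n (d + δ + 1), if Finsupp.weight ω m = d then
      MvPolynomial.monomial m (MvPowerSeries.coeff m c) else 0 := by
    refine MvPolynomial.funext fun y => ?_
    rw [h.eq_wcomp hω hc, eval_wcomp hω c d (show d < d + δ + 1 by omega), map_sum]
    refine Finset.sum_congr rfl fun m _ => ?_
    split_ifs
    · rw [MvPolynomial.eval_monomial, Finsupp.prod_fintype _ _ (by simp)]; rfl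
    · simp
  have hder : polyFDeriv P x v = ∑ m ∈ degLT n (d + δ + 1), if Finsupp.weight ω m = d then
      polyFDeriv (MvPolynomial.monomial m (MvPowerSeries.coeff m c)) x v else 0 := by
    conv_lhs => rw [hP]
    simp only [polyFDeriv_apply, map_sum, Finset.sum_mul]
    rw [Finset.sum_comm]
    refine Finset.sum_congr rfl fun m _ => ?_
    split_ifs <;> simp
  have hm : Tendsto (fun a => ∑ m ∈ degLT n (d + δ + 1), (t a ^ (d + δ))⁻¹ *
      (MvPowerSeries.coeff m c * monomialAt (wscale ω (t a) (ξ a + t a ^ δ • η a)) m -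
        MvPowerSeries.coeff m c * monomialAt (wscale ω (t a) (ξ a)) m)) l
      (𝓝 (polyFDeriv P x v)) := by
    rw [hder]
    refine tendsto_finsetSum _ fun m _ => ?_
    rcases lt_or_ge (Finsupp.weight ω m) d with hlt | hge
    · simpa [h.coeff_eq_zero hω hc m hlt, hlt.ne] using tendsto_const_nhds
    · obtain ⟨k, hk⟩ := Nat.exists_eq_add_of_le hge
      have h1 := (hasStrictFDerivAt_eval (MvPolynomial.monomial m (MvPowerSeries.coeff m c))
        x).tendsto_diffQuot hs hξ hη
      -- A monomial of weight `d + k` contributes `t ^ k` times a difference quotient, so only `k =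
      -- 0` survives in the limit.
      have h2 := (ht0.pow k).mul h1
      have h4 : 0 ^ k * polyFDeriv (MvPolynomial.monomial m (MvPowerSeries.coeff m c)) x v =
          if Finsupp.weight ω m = d then
            polyFDeriv (MvPolynomial.monomial m (MvPowerSeries.coeff m c)) x v else 0 := by
        rcases Nat.eq_zero_or_pos k with rfl | hk0
        · simp [hk]
        · rw [if_neg (by omega), zero_pow hk0.ne']; simp
      rw [h4] at h2
      refine h2.congr' ?_
      filter_upwards [ht self_mem_nhdsWithin] with a ha
      have ha : t a ≠ 0 := ha
      have he : ∀ y : Fin n → ℂ, MvPolynomial.eval y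
          (MvPolynomial.monomial m (MvPowerSeries.coeff m c)) =
          MvPowerSeries.coeff m c * monomialAt y m := fun y => by
        rw [MvPolynomial.eval_monomial, Finsupp.prod_fintype _ _ (by simp)]; rfl
      rw [he, he, monomialAt_wscale, monomialAt_wscale, hk, pow_add, pow_add]
      field_simp
  have := (hm.add hr1).sub hr2
  rw [add_zero, sub_zero] at this
  refine this.congr fun a => ?_
  simp only [eval_truncDeg, ← Finset.mul_sum, Finset.sum_sub_distrib]
  ring

/-- Cauchy's estimate: Euler derivatives do not lower the order. -/
theorem isBigO_mul_fderiv {n : ℕ} {R : (Fin n → ℂ) → ℂ} (hR : AnalyticAt ℂ R 0) {N : ℕ}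
    (hO : R =O[𝓝 0] fun x => ‖x‖ ^ N) (j : Fin n) :
    (fun x => x j * fderiv ℂ R x (Pi.single j 1)) =O[𝓝 0] fun x => ‖x‖ ^ N := by
  obtain ⟨C, hC⟩ := hO.bound
  obtain ⟨ε, hε, H⟩ := Metric.eventually_nhds_iff.1 (hC.and hR.eventually_analyticAt)
  have hCnn : ∀ y : Fin n → ℂ, ‖y‖ < ε → ‖R y‖ ≤ C * ‖y‖ ^ N := by
    intro y hy
    have := (H (y := y) (by simpa using hy)).1
    simpa using this
  have hA : ∀ y : Fin n → ℂ, ‖y‖ < ε → AnalyticAt ℂ R y := fun y hy =>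
    (H (y := y) (by simpa using hy)).2
  refine IsBigO.of_bound (C * 2 ^ N) ?_
  filter_upwards [Metric.ball_mem_nhds (0 : Fin n → ℂ) (half_pos hε)] with x hx
  have hx : ‖x‖ < ε / 2 := by simpa using hx
  rw [norm_pow, norm_norm]
  rcases eq_or_ne x 0 with rfl | hx0
  · have := hCnn 0 (by simpa using hε)
    simp only [Pi.zero_apply, zero_mul, norm_zero]
    have h2 := (norm_nonneg _).trans this
    rw [norm_zero] at h2
    nlinarith [pow_pos (zero_lt_two' ℝ) N]
  have hxp : 0 < ‖x‖ := norm_pos_iff.2 hx0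
  set e : Fin n → ℂ := Pi.single j 1
  have hnorm : ∀ z : ℂ, ‖z‖ ≤ ‖x‖ → ‖x + z • e‖ ≤ 2 * ‖x‖ := by
    intro z hz
    refine (norm_add_le _ _).trans ?_
    have : ‖e‖ = 1 := by rw [Pi.norm_single, norm_one]
    rw [norm_smul, this]
    linarith
  have hderiv : ∀ z : ℂ, ‖z‖ ≤ ‖x‖ →
      HasDerivAt (fun z : ℂ => R (x + z • e)) (fderiv ℂ R (x + z • e) e) z := by
    intro z hz
    have h1 := (hA (x + z • e) (by linarith [hnorm z hz])).differentiableAt.hasFDerivAt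
    have h2 : HasDerivAt (fun z : ℂ => x + z • e) e z := by
      simpa using ((hasDerivAt_id z).smul_const e).const_add x
    exact h1.comp_hasDerivAt z h2
  -- Cauchy's estimate on the disc of radius `‖x‖` in direction `j`, which stays in the ball of
  -- radius `2 * ‖x‖`. The loss of `1 / ‖x‖` is compensated by the factor `x j`.
  have h3 := Complex.norm_deriv_le_of_forall_mem_sphere_norm_le (c := 0) (R := ‖x‖)
    (C := C * (2 * ‖x‖) ^ N) (f := fun z : ℂ => R (x + z • e)) hxp ?_ ?_
  · have h4 := (hderiv 0 (by simp)).deriv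
    rw [h4, zero_smul, add_zero, le_div_iff₀ hxp] at h3
    rw [norm_mul]
    calc ‖x j‖ * ‖fderiv ℂ R x e‖ ≤ ‖fderiv ℂ R x e‖ * ‖x‖ := by
          rw [mul_comm]; gcongr; exact norm_le_pi_norm x j
      _ ≤ _ := h3
      _ = _ := by rw [mul_pow]; ring
  · refine DifferentiableOn.diffContOnCl fun z hz => ?_
    rw [closure_ball _ hxp.ne'] at hz
    exact (hderiv z (by simpa using hz)).differentiableAt.differentiableWithinAt
  · intro z hz
    have hz : ‖z‖ = ‖x‖ := by simpa using hz
    have h5 := hnorm z hz.le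
    refine (hCnn _ (by linarith)).trans ?_
    have hC0 : 0 ≤ C := by
      have := (norm_nonneg _).trans (hCnn x (by linarith))
      exact nonneg_of_mul_nonneg_left this (by positivity)
    gcongr

/-- The lead of an Euler derivative. -/
theorem HasLead.euler {n : ℕ} {ω : Fin n → ℕ} (hω : ∀ i, 1 ≤ ω i) {V : (Fin n → ℂ) → ℂ}
    (hV : AnalyticAt ℂ V 0) {d : ℕ} {P : MvPolynomial (Fin n) ℂ} (h : HasLead ω V d P)
    (j : Fin n) : HasLead ω (fun x => x j * fderiv ℂ V x (Pi.single j 1)) d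
      (MvPolynomial.X j * MvPolynomial.pderiv j P) := by
  obtain ⟨c, hc⟩ := exists_hasTaylorSeries hV
  -- The Taylor polynomial is treated coefficient by coefficient, the remainder by Cauchy's
  -- estimate.
  set T := truncDeg c (d + 1) with hT
  have hTan : ∀ x, AnalyticAt ℂ (fun x => MvPolynomial.eval x T) x := fun x =>
    AnalyticOnNhd.eval_mvPolynomial T x trivial
  have hTl : HasLead ω (fun x => MvPolynomial.eval x (MvPolynomial.X j * MvPolynomial.pderiv j T)) d
      (MvPolynomial.X j * MvPolynomial.pderiv j P) := by
    have hcoef : ∀ (Q : MvPolynomial (Fin n) ℂ) m, (MvPolynomial.X j * MvPolynomial.pderiv j Q).coeff m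
        = m j * Q.coeff m := by
      intro Q m
      induction Q using MvPolynomial.induction_on' with
      | monomial u a =>
        classical
        rw [MvPolynomial.X_mul_pderiv_monomial, MvPolynomial.coeff_smul, MvPolynomial.coeff_monomial]
        split_ifs with hu
        · subst hu; simp
        · simp
      | add p q hp hq => simp only [map_add, mul_add, MvPolynomial.coeff_add, hp, hq]
    have h1 := (hasTaylorSeries_eval (MvPolynomial.X j * MvPolynomial.pderiv j T)).hasLead hω (d := d) ?_
    · convert h1 using 1
      ext m
      rw [coeff_wcomp hω, hcoef, h.eq_wcomp hω hc, coeff_wcomp hω, MvPolynomial.coeff_coe, hcoef, hT,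
        coeff_truncDeg]
      have := totalDeg_le_weight hω m
      split_ifs <;> first | rfl | omega | simp
    · intro m hm
      rw [MvPolynomial.coeff_coe, hcoef, hT, coeff_truncDeg, h.coeff_eq_zero hω hc m hm]
      simp
  have hRO := isBigO_mul_fderiv (hV.sub (hTan 0)) (hc.isBigO_sub_truncDeg (d + 1)) j
  have hR : HasLead ω (fun x => x j * fderiv ℂ (V - fun x => MvPolynomial.eval x T) x
      (Pi.single j 1)) d 0 := by
    intro y
    rw [map_zero]
    exact tendsto_remainder tendsto_fst (isBigO_wscale hω
      (tendsto_nhds_of_tendsto_nhdsWithin tendsto_fst) tendsto_snd) (Nat.lt_succ_self d) hRO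
  have := hTl.add hR
  rw [add_zero] at this
  refine this.congr hω ?_
  filter_upwards [hV.eventually_analyticAt] with x hx
  rw [fderiv_sub hx.differentiableAt (hTan x).differentiableAt,
    (hasStrictFDerivAt_eval T x).hasFDerivAt.fderiv, sub_apply, polyFDeriv_apply,
    Finset.sum_eq_single j]
  · simp; ring
  · intro i _ hi; simp [hi]
  · simp


/-! ### Derivations and common first integrals of polynomial vector fields. -/

/-- Apply `δ` to a relation p(x) = 0 of least degree: this gives p'(x) δ(x) = 0, and p'(x) is
nonzero by minimality in characteristic zero. -/
theorem derivation_eq_zero_of_isAlgebraic {A : Type*} [CommRing A] [IsDomain A] [Algebra ℂ A]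
    (S : Subalgebra ℂ A) (δ : Derivation ℂ A A) (hδ : ∀ a ∈ S, δ a = 0) (x : A)
    (hx : IsAlgebraic S x) : δ x = 0 := by
  classical
  have hδp : ∀ p : Polynomial S, δ (Polynomial.aeval x p) =
      Polynomial.aeval x (Polynomial.derivative p) * δ x := by
    intro p
    induction p using Polynomial.induction_on' with
    | add p q hp hq => simp only [map_add, hp, hq, add_mul]
    | monomial k a =>
      rw [Polynomial.aeval_monomial, Derivation.leibniz, Derivation.leibniz_pow,
        Polynomial.derivative_monomial, Polynomial.aeval_monomial]
      have : δ (algebraMap S A a) = 0 := hδ _ a.2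
      rw [this]
      simp only [smul_eq_mul, nsmul_eq_mul, map_mul, map_natCast, mul_zero, add_zero]
      ring
  have hex : ∃ k, ∃ p : Polynomial S, p ≠ 0 ∧ Polynomial.aeval x p = 0 ∧ p.natDegree = k := by
    obtain ⟨p, hp, h⟩ := hx
    exact ⟨_, p, hp, h, rfl⟩
  obtain ⟨p, hp0, hp, hk⟩ := Nat.find_spec hex
  have h1 := hδp p
  rw [hp, map_zero, eq_comm, mul_eq_zero] at h1
  refine h1.resolve_left fun h2 => ?_
  have hS : CharZero S := charZero_of_injective_algebraMap (algebraMap ℂ S).injective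
  by_cases h3 : Polynomial.derivative p = 0
  · have h4 := Polynomial.derivative_eq_zero.1 h3
    rw [Polynomial.eq_C_of_natDegree_eq_zero h4, Polynomial.aeval_C] at hp
    have : p.coeff 0 = 0 := Subtype.ext hp
    exact hp0 (by rw [Polynomial.eq_C_of_natDegree_eq_zero h4, this, map_zero])
  · have h5 : p.natDegree ≠ 0 := fun h => h3 (by
      rw [Polynomial.eq_C_of_natDegree_eq_zero h, Polynomial.derivative_C])
    exact Nat.find_min hex (hk ▸ Polynomial.natDegree_derivative_lt h5) ⟨_, h3, h2, rfl⟩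

/-- The polynomial vector field with components `X i`, as a derivation. -/
noncomputable def vfDeriv {n : ℕ} (X : Fin n → MvPolynomial (Fin n) ℂ) :
    Derivation ℂ (MvPolynomial (Fin n) ℂ) (MvPolynomial (Fin n) ℂ) :=
  MvPolynomial.mkDerivation ℂ X

theorem vfDeriv_apply {n : ℕ} (X : Fin n → MvPolynomial (Fin n) ℂ) (p : MvPolynomial (Fin n) ℂ) :
    vfDeriv X p = ∑ i, X i * MvPolynomial.pderiv i p := by
  have hsum : ∀ q, (∑ i, X i • MvPolynomial.pderiv (R := ℂ) i) q =
      ∑ i, X i * MvPolynomial.pderiv i q := fun q => by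
    rw [← Derivation.coeFnAddMonoidHom_apply, map_sum, Finset.sum_apply]; rfl
  have h : vfDeriv X = ∑ i, X i • MvPolynomial.pderiv i := by
    refine MvPolynomial.derivation_ext fun j => ?_
    rw [vfDeriv, MvPolynomial.mkDerivation_X, hsum, Finset.sum_eq_single j]
    · simp
    · intro i _ hi
      rw [MvPolynomial.pderiv_X_of_ne hi.symm, mul_zero]
    · simp
  rw [h, hsum]

/-- Two polynomial vector fields on `ℂⁿ` with `n - 1` common algebraically independent first
integrals are proportional. -/
theorem vectorField_proportional {n : ℕ} {ι : Type} [Fintype ι] (hcard : Fintype.card ι + 1 = n)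
    {P : ι → MvPolynomial (Fin n) ℂ} (hP : AlgebraicIndependent ℂ P)
    {X Y : Fin n → MvPolynomial (Fin n) ℂ}
    (hX : ∀ k, ∑ i, X i * MvPolynomial.pderiv i (P k) = 0)
    (hY : ∀ k, ∑ i, Y i * MvPolynomial.pderiv i (P k) = 0) (i j : Fin n) :
    X i * Y j = X j * Y i := by
  classical
  have hs : AlgebraicIndepOn ℂ id (Set.range P) := by
    simpa [AlgebraicIndepOn] using hP.to_subtype_range
  have htop : Algebra.adjoin ℂ (Set.range P ∪ Set.range (MvPolynomial.X : Fin n → MvPolynomial (Fin n) ℂ)) = ⊤ := by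
    refine top_le_iff.1 ?_
    rw [← MvPolynomial.adjoin_range_X]
    exact Algebra.adjoin_mono Set.subset_union_right
  have : Algebra.IsAlgebraic
      (Algebra.adjoin ℂ (Set.range P ∪ Set.range (MvPolynomial.X : Fin n → MvPolynomial (Fin n) ℂ))) (MvPolynomial (Fin n) ℂ) := by
    refine ⟨fun a => ?_⟩
    have ha : a ∈ Algebra.adjoin ℂ (Set.range P ∪ Set.range (MvPolynomial.X : Fin n → MvPolynomial (Fin n) ℂ)) := by
      rw [htop]; trivial
    exact isAlgebraic_algebraMap (A := MvPolynomial (Fin n) ℂ) (⟨a, ha⟩ : Algebra.adjoin ℂ _)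
  -- The `P k` extend to a transcendence basis; since the transcendence degree is `n`, exactly one
  -- element `z` is added.
  obtain ⟨u, hsu, -, hu⟩ := exists_isTranscendenceBasis_between (R := ℂ) (Set.range P)
    (Set.range P ∪ Set.range (MvPolynomial.X : Fin n → MvPolynomial (Fin n) ℂ)) Set.subset_union_left hs
  have hcu : u.ncard = n := by
    have h1 := hu.cardinalMk_eq_trdeg
    rw [MvPolynomial.trdeg_of_isDomain] at h1
    simp only [Cardinal.mk_fin, Cardinal.lift_natCast] at h1
    rw [Set.ncard_def, Set.encard, ENat.card, h1]
    simp
  have hufin : u.Finite := by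
    rcases Nat.eq_zero_or_pos n with h | h
    · omega
    · exact Set.finite_of_ncard_pos (by omega)
  have hcs : (Set.range P).ncard = Fintype.card ι := by
    rw [← Set.image_univ, Set.ncard_image_of_injective _ hP.injective, Set.ncard_univ,
      Nat.card_eq_fintype_card]
  obtain ⟨z, hz⟩ : ∃ z, u \ Set.range P = {z} := by
    rw [← Set.ncard_eq_one, Set.ncard_sdiff hsu (Set.finite_range P)]
    omega
  have huz : ∀ a ∈ u, a = z ∨ a ∈ Set.range P := by
    intro a ha
    by_cases h : a ∈ Set.range P
    · exact Or.inr h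
    · have : a ∈ u \ Set.range P := ⟨ha, h⟩
      rw [hz] at this
      exact Or.inl this
  -- A field that kills a transcendence basis kills every polynomial, the coordinates in particular.
  have key : ∀ W : Fin n → MvPolynomial (Fin n) ℂ, (∀ k, vfDeriv W (P k) = 0) → vfDeriv W z = 0 → W = 0 := by
    intro W hW hWz
    have halg := hu.isAlgebraic
    rw [Subtype.range_coe] at halg
    funext i
    have h1 : vfDeriv W (MvPolynomial.X i) = W i := MvPolynomial.mkDerivation_X _ _ _
    rw [← h1]
    refine derivation_eq_zero_of_isAlgebraic (Algebra.adjoin ℂ u) (vfDeriv W) ?_ _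
      (halg.isAlgebraic _)
    intro a ha
    induction ha using Algebra.adjoin_induction with
    | mem a ha =>
      rcases huz a ha with rfl | ⟨k, rfl⟩
      · exact hWz
      · exact hW k
    | algebraMap r => exact Derivation.map_algebraMap _ r
    | add a b _ _ ha hb => rw [map_add, ha, hb, add_zero]
    | mul a b _ _ ha hb => rw [Derivation.leibniz, ha, hb, smul_zero, smul_zero, add_zero]
  -- The combination Y(z) X - X(z) Y kills the `P k`, and it kills `z` by construction.
  have hlin : (fun i => vfDeriv Y z * X i - vfDeriv X z * Y i) = 0 := by
    refine key _ (fun k => ?_) ?_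
    · rw [vfDeriv_apply]
      have : ∀ i, (vfDeriv Y z * X i - vfDeriv X z * Y i) * MvPolynomial.pderiv i (P k) =
        vfDeriv Y z * (X i * MvPolynomial.pderiv i (P k)) -
          vfDeriv X z * (Y i * MvPolynomial.pderiv i (P k)) := fun i => by ring
      simp only [this, Finset.sum_sub_distrib, ← Finset.mul_sum, hX, hY, mul_zero, sub_zero]
    · have : ∀ i, (vfDeriv Y z * X i - vfDeriv X z * Y i) * MvPolynomial.pderiv i z =
        vfDeriv Y z * (X i * MvPolynomial.pderiv i z) -
          vfDeriv X z * (Y i * MvPolynomial.pderiv i z) := fun i => by ring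
      rw [vfDeriv_apply]
      simp only [this, Finset.sum_sub_distrib, ← Finset.mul_sum, ← vfDeriv_apply]
      ring
  by_cases hYz : vfDeriv Y z = 0
  · have : Y = 0 := key Y (fun k => by rw [vfDeriv_apply, hY]) hYz
    simp [this]
  · have h1 : ∀ i, vfDeriv Y z * X i = vfDeriv X z * Y i := fun i =>
      sub_eq_zero.1 (congrFun hlin i)
    refine mul_left_cancel₀ hYz ?_
    linear_combination Y j * h1 i - Y i * h1 j


/-! ### From functionally independent integrals to algebraically independent leads. -/

theorem exists_minor_ne_zero {r n : ℕ} (A : Matrix (Fin r) (Fin n) ℂ)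
    (hA : LinearIndependent ℂ A.row) :
    ∃ c : Fin r → Fin n, (A.submatrix id c).det ≠ 0 := by
  have h1 := LinearIndependent.rank_matrix hA
  rw [Matrix.rank_eq_finrank_span_cols, Fintype.card_fin] at h1
  obtain ⟨f, hf, -, hli⟩ := Submodule.exists_fun_fin_finrank_span_eq ℂ (Set.range A.col)
  have hli' : LinearIndependent ℂ (f ∘ Fin.cast h1.symm) := hli.comp _ (Fin.cast_injective _)
  choose c hc using hf
  refine ⟨c ∘ Fin.cast h1.symm, ?_⟩
  have : (A.submatrix id (c ∘ Fin.cast h1.symm)).col = f ∘ Fin.cast h1.symm := by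
    funext j
    exact hc _
  rw [← this, Matrix.linearIndependent_cols_iff_isUnit, Matrix.isUnit_iff_isUnit_det] at hli'
  exact hli'.ne_zero

/-- A minor of the matrix of Euler derivatives of the functions `V k`. -/
noncomputable def eulerMinor {n r : ℕ} (c : Fin r → Fin n) (V : Fin r → (Fin n → ℂ) → ℂ)
    (x : Fin n → ℂ) : ℂ :=
  (Matrix.of fun k j => x (c j) * fderiv ℂ (V k) x (Pi.single (c j) 1)).det

/-- Passing from partial to Euler derivatives multiplies a minor by a product of coordinates. These
are nonzero on a dense set, which meets the open set where the differentials are independent. -/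
theorem FunctionallyIndependent.exists_eulerMinor {n r : ℕ} {V : Fin r → (Fin n → ℂ) → ℂ}
    (hV : FunctionallyIndependent V) :
    ∃ c, ¬ ∀ᶠ x in 𝓝 0, eulerMinor c V x = 0 := by
  by_contra! H
  obtain ⟨U, W, hU, h0, hW, -, hUW, hli⟩ := hV
  have hall : ∀ᶠ x in 𝓝 (0 : Fin n → ℂ), ∀ c : Fin r → Fin n, eulerMinor c V x = 0 :=
    eventually_all.2 H
  obtain ⟨O, hO, hOo, hO0⟩ := eventually_nhds_iff.1 hall
  have hdense : Dense {x : Fin n → ℂ | ∀ i, x i ≠ 0} := by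
    have : {x : Fin n → ℂ | ∀ i, x i ≠ 0} = Set.univ.pi fun _ => {0}ᶜ := by
      ext x; simp
    rw [this]
    exact dense_pi _ fun i _ => dense_compl_singleton 0
  have hne : (O ∩ W).Nonempty := mem_closure_iff.1 (hUW h0) O hOo hO0
  obtain ⟨x, ⟨hxO, hxW⟩, hx⟩ := hdense.inter_open_nonempty _ (hOo.inter hW) hne
  have hrow : LinearIndependent ℂ
      (Matrix.of fun (k : Fin r) (j : Fin n) => fderiv ℂ (V k) x (Pi.single j 1)).row := by
    let T : ((Fin n → ℂ) →L[ℂ] ℂ) →ₗ[ℂ] (Fin n → ℂ) :=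
      { toFun := fun L j => L (Pi.single j 1)
        map_add' := fun _ _ => rfl
        map_smul' := fun _ _ => rfl }
    have hT : LinearMap.ker T = ⊥ := by
      refine LinearMap.ker_eq_bot'.2 fun L hL => ?_
      refine ContinuousLinearMap.coe_injective (LinearMap.pi_ext' fun j => ?_)
      ext
      have h1 : L (Pi.single j 1) = 0 := congrFun hL j
      simpa using h1
    exact (hli x hxW).map' T hT
  obtain ⟨c, hc⟩ := exists_minor_ne_zero _ hrow
  have h1 := hO x hxO c
  rw [eulerMinor] at h1
  have h2 : (Matrix.of fun k j => x (c j) * fderiv ℂ (V k) x (Pi.single (c j) 1)) =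
      (Matrix.of fun k j => fderiv ℂ (V k) x (Pi.single j 1)).submatrix id c *
        Matrix.diagonal fun j => x (c j) := by
    ext k j
    simp [Matrix.mul_diagonal, mul_comm]
  rw [h2, Matrix.det_mul, Matrix.det_diagonal, mul_eq_zero] at h1
  exact h1.elim hc (Finset.prod_ne_zero_iff.2 fun j _ => hx (c j))

/-- Euler derivatives do not lower the order, so every term of the determinant has order at least `∑
k, d k`. The component `Q` in that degree may be zero: how far the actual order exceeds the sum
measures the dependence of the leads. -/
theorem HasLead.eulerMinor {n r : ℕ} {ω : Fin n → ℕ} (hω : ∀ i, 1 ≤ ω i) (c : Fin r → Fin n)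
    {V : Fin r → (Fin n → ℂ) → ℂ} {d : Fin r → ℕ} {P : Fin r → MvPolynomial (Fin n) ℂ}
    (hV : ∀ k, AnalyticAt ℂ (V k) 0) (h : ∀ k, HasLead ω (V k) (d k) (P k)) :
    ∃ Q, HasLead ω (eulerMinor c V) (∑ k, d k) Q := by
  refine ⟨∑ σ : Equiv.Perm (Fin r), MvPolynomial.C ((Equiv.Perm.sign σ : ℤ) : ℂ) *
    ∏ k, (MvPolynomial.X (c k) * MvPolynomial.pderiv (c k) (P (σ k))), ?_⟩
  have h1 := HasLead.sum (ω := ω) Finset.univ fun (σ : Equiv.Perm (Fin r)) _ =>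
    (HasLead.prod Finset.univ fun k _ => (h (σ k)).euler hω (hV (σ k)) (c k)).const_mul
      ((Equiv.Perm.sign σ : ℤ) : ℂ) |> fun h => (show HasLead ω _ (∑ k, d k) _ by
        rwa [Equiv.sum_comp σ d] at h)
  convert h1 using 1
  funext x
  rw [_root_.eulerMinor, Matrix.det_apply']
  rfl

theorem HasLead.pow {n : ℕ} {ω : Fin n → ℕ} {g : (Fin n → ℂ) → ℂ} {d : ℕ}
    {P : MvPolynomial (Fin n) ℂ} (h : HasLead ω g d P) (k : ℕ) :
    HasLead ω (fun x => g x ^ k) (k * d) (P ^ k) := by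
  simpa using HasLead.prod (Finset.range k) fun _ _ => h

theorem HasLead.eval {n r : ℕ} {ω : Fin n → ℕ} {V : Fin r → (Fin n → ℂ) → ℂ} {d : Fin r → ℕ}
    {P : Fin r → MvPolynomial (Fin n) ℂ} (h : ∀ k, HasLead ω (V k) (d k) (P k))
    {Q : MvPolynomial (Fin r) ℂ} {e : ℕ} (hQ : MvPolynomial.IsWeightedHomogeneous d Q e) :
    HasLead ω (fun x => MvPolynomial.eval (fun k => V k x) Q) e (MvPolynomial.aeval P Q) := by
  simp only [MvPolynomial.aeval_def, MvPolynomial.eval_eq', MvPolynomial.eval₂_eq']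
  refine HasLead.sum _ fun m hm => ?_
  refine HasLead.const_mul _ ?_
  have h1 := HasLead.prod Finset.univ fun k _ => (h k).pow (m k)
  have h2 : ∑ k, m k * d k = e := by
    rw [← hQ (MvPolynomial.mem_support_iff.1 hm), Finsupp.weight_apply,
      Finsupp.sum_fintype _ _ (by simp)]
    rfl
  rwa [h2] at h1

/-- A relation between weighted homogeneous polynomials can be chosen weighted homogeneous and so
that one of its partial derivatives is not a relation. -/
theorem exists_homogeneous_relation {n r : ℕ} {ω : Fin n → ℕ} {d : Fin r → ℕ}
    {P : Fin r → MvPolynomial (Fin n) ℂ} (hP : ∀ k, MvPolynomial.IsWeightedHomogeneous ω (P k) (d k))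
    (hdep : ¬ AlgebraicIndependent ℂ P) :
    ∃ (Q : MvPolynomial (Fin r) ℂ) (e : ℕ) (j : Fin r),
      MvPolynomial.IsWeightedHomogeneous d Q e ∧ MvPolynomial.aeval P Q = 0 ∧
      MvPolynomial.aeval P (MvPolynomial.pderiv j Q) ≠ 0 := by
  classical
  -- A relation of least total degree is chosen so that its derivatives cannot be relations.
  have hex : ∃ N, ∃ Q : MvPolynomial (Fin r) ℂ, Q ≠ 0 ∧ MvPolynomial.aeval P Q = 0 ∧
      ∀ m ∈ Q.support, totalDeg m < N := by
    rw [algebraicIndependent_iff] at hdep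
    push Not at hdep
    obtain ⟨Q, hQ, hQ0⟩ := hdep
    refine ⟨Q.support.sup totalDeg + 1, Q, hQ0, hQ, fun m hm => ?_⟩
    exact Nat.lt_succ_of_le (Finset.le_sup (f := totalDeg) hm)
  obtain ⟨Q, hQ0, hQ, hdeg⟩ := Nat.find_spec hex
  obtain ⟨m₀, hm₀⟩ := MvPolynomial.support_nonempty.2 hQ0
  set e := Finsupp.weight d m₀
  set Q' := MvPolynomial.weightedHomogeneousComponent d e Q with hQ'
  have hQ'hom : MvPolynomial.IsWeightedHomogeneous d Q' e :=
    MvPolynomial.weightedHomogeneousComponent_isWeightedHomogeneous _ _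
  have hsupp : ∀ m ∈ Q'.support, m ∈ Q.support := by
    intro m hm
    rw [MvPolynomial.mem_support_iff, hQ', MvPolynomial.coeff_weightedHomogeneousComponent] at hm
    rw [MvPolynomial.mem_support_iff]
    split_ifs at hm
    · exact hm
    · exact absurd rfl hm
  have hcoef₀ : Q'.coeff m₀ ≠ 0 := by
    rw [hQ', MvPolynomial.coeff_weightedHomogeneousComponent, if_pos rfl]
    exact MvPolynomial.mem_support_iff.1 hm₀
  have hrel : MvPolynomial.aeval P Q' = 0 := by
    -- Substituting the homogeneous `P` commutes with taking weighted components, so a component of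
    -- a relation is again a relation.
    have h1 : ∀ R : MvPolynomial (Fin r) ℂ,
        MvPolynomial.weightedHomogeneousComponent ω e (MvPolynomial.aeval P R) =
          MvPolynomial.aeval P (MvPolynomial.weightedHomogeneousComponent d e R) := by
      intro R
      induction R using MvPolynomial.induction_on' with
      | add p q hp hq => simp only [map_add, hp, hq]
      | monomial m a =>
        have hh : MvPolynomial.IsWeightedHomogeneous ω
            (MvPolynomial.aeval P (MvPolynomial.monomial m a)) (Finsupp.weight d m) := by
          rw [MvPolynomial.aeval_monomial, Finsupp.prod_fintype _ _ (by simp),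
            MvPolynomial.algebraMap_eq]
          refine MvPolynomial.IsWeightedHomogeneous.C_mul ?_ _
          rw [Finsupp.weight_apply, Finsupp.sum_fintype _ _ (by simp)]
          exact MvPolynomial.IsWeightedHomogeneous.prod _ _ _ fun k _ => (hP k).pow _
        rw [MvPolynomial.weightedHomogeneousComponent_of_mem hh,
          MvPolynomial.weightedHomogeneousComponent_of_mem
            (MvPolynomial.isWeightedHomogeneous_monomial d m a rfl)]
        split_ifs <;> simp
    rw [hQ', ← h1, hQ, map_zero]
  obtain ⟨m, hm, hmne⟩ : ∃ m ∈ Q'.support, m ≠ 0 := by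
    by_contra! H
    have hm0 : m₀ = 0 := H _ (MvPolynomial.mem_support_iff.2 hcoef₀)
    have h2 : Q' = MvPolynomial.C (Q'.coeff 0) := by
      ext m
      rw [MvPolynomial.coeff_C]
      split_ifs with h
      · rw [h]
      · by_contra h3
        exact h (H m (MvPolynomial.mem_support_iff.2 h3)).symm
    rw [h2, MvPolynomial.aeval_C, MvPolynomial.algebraMap_eq, MvPolynomial.C_eq_zero] at hrel
    exact hcoef₀ (hm0 ▸ hrel)
  obtain ⟨j, hj⟩ : ∃ j, m j ≠ 0 := by
    by_contra! H
    exact hmne (Finsupp.ext H)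
  refine ⟨Q', e, j, hQ'hom, hrel, fun h0 => ?_⟩
  have hpd : MvPolynomial.pderiv j Q' ≠ 0 := by
    intro h
    have h3 := MvPolynomial.coeff_pderiv (i := j) Q' (m - Finsupp.single j 1)
    have h4 : m - Finsupp.single j 1 + Finsupp.single j 1 = m := by
      ext b
      by_cases hb : b = j
      · subst hb; simp; omega
      · simp [hb]
    rw [h, h4, MvPolynomial.coeff_zero, eq_comm, mul_eq_zero] at h3
    refine h3.elim (MvPolynomial.mem_support_iff.1 hm) fun h5 => ?_
    have : (((m - Finsupp.single j 1 : Fin r →₀ ℕ) j : ℕ) : ℂ) + 1 ≠ 0 := Nat.cast_add_one_ne_zero _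
    exact this h5
  -- Differentiation lowers the degree, so a vanishing substitution into the nonzero derivative
  -- would contradict minimality.
  have hN : 0 < Nat.find hex := lt_of_le_of_lt (Nat.zero_le _) (hdeg m₀ hm₀)
  refine Nat.find_min hex (Nat.sub_lt hN one_pos) ⟨_, hpd, h0, fun m' hm' => ?_⟩
  have h6 : m' + Finsupp.single j 1 ∈ Q'.support := by
    rw [MvPolynomial.mem_support_iff, MvPolynomial.coeff_pderiv] at hm'
    exact MvPolynomial.mem_support_iff.2 (left_ne_zero_of_mul hm')
  have h7 := hdeg _ (hsupp _ h6)
  rw [totalDeg_add, totalDeg_single] at h7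
  omega

theorem isWeightedHomogeneous_pderiv {r : ℕ} {d : Fin r → ℕ} {Q : MvPolynomial (Fin r) ℂ} {e : ℕ}
    (hQ : MvPolynomial.IsWeightedHomogeneous d Q e) (j : Fin r)
    (hne : MvPolynomial.pderiv j Q ≠ 0) :
    d j ≤ e ∧ MvPolynomial.IsWeightedHomogeneous d (MvPolynomial.pderiv j Q) (e - d j) := by
  have key : ∀ m, (MvPolynomial.pderiv j Q).coeff m ≠ 0 → Finsupp.weight d m + d j = e := by
    intro m hm
    rw [MvPolynomial.coeff_pderiv] at hm
    have := hQ (left_ne_zero_of_mul hm)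
    rwa [map_add, Finsupp.weight_single, one_smul] at this
  obtain ⟨m, hm⟩ := MvPolynomial.ne_zero_iff.1 hne
  refine ⟨by have := key m hm; omega, fun m hm => ?_⟩
  have := key m hm
  omega

theorem hasFDerivAt_eval_comp {n r : ℕ} {V : Fin r → (Fin n → ℂ) → ℂ} {x : Fin n → ℂ}
    (hV : ∀ k, DifferentiableAt ℂ (V k) x) (Q : MvPolynomial (Fin r) ℂ) (v : Fin n → ℂ) :
    fderiv ℂ (fun x => MvPolynomial.eval (fun k => V k x) Q) x v =
      ∑ k, MvPolynomial.eval (fun k => V k x) (MvPolynomial.pderiv k Q) * fderiv ℂ (V k) x v := by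
  have h1 : HasFDerivAt (fun x k => V k x) (ContinuousLinearMap.pi fun k => fderiv ℂ (V k) x) x :=
    hasFDerivAt_pi.2 fun k => (hV k).hasFDerivAt
  have h2 := (hasStrictFDerivAt_eval Q fun k => V k x).hasFDerivAt.comp x h1
  have h3 : fderiv ℂ (fun x => MvPolynomial.eval (fun k => V k x) Q) x = _ := h2.fderiv
  rw [h3, ContinuousLinearMap.comp_apply, polyFDeriv_apply]
  simp

/-- Functionally independent functions generate an algebra which contains as many functions whose
leading weighted homogeneous components are algebraically independent. -/
theorem exists_algebraicIndependent_lead {n r : ℕ} {ω : Fin n → ℕ} (hω : ∀ i, 1 ≤ ω i)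
    (I : ((Fin n → ℂ) → ℂ) → Prop) (hI : ∀ V, I V → AnalyticAt ℂ V 0)
    (hIQ : ∀ (V : Fin r → (Fin n → ℂ) → ℂ) (Q : MvPolynomial (Fin r) ℂ), (∀ k, I (V k)) →
      I fun x => MvPolynomial.eval (fun k => V k x) Q)
    (V : Fin r → (Fin n → ℂ) → ℂ) (hV : ∀ k, I (V k)) (c : Fin r → Fin n)
    (hc : ¬ ∀ᶠ x in 𝓝 0, eulerMinor c V x = 0) :
    ∃ (V' : Fin r → (Fin n → ℂ) → ℂ) (d : Fin r → ℕ) (P : Fin r → MvPolynomial (Fin n) ℂ),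
      (∀ k, I (V' k)) ∧ (∀ k, HasLead ω (V' k) (d k) (P k)) ∧ AlgebraicIndependent ℂ P := by
  -- Induction on a bound for the defect `D - ∑ k, d k`, the excess of the order of the Euler minor
  -- over the sum of the orders of the functions. It is never negative, and while the leads are
  -- dependent it can be made smaller.
  have main : ∀ (N : ℕ) (V : Fin r → (Fin n → ℂ) → ℂ) (d : Fin r → ℕ)
      (P : Fin r → MvPolynomial (Fin n) ℂ) (D : ℕ) (R : MvPolynomial (Fin n) ℂ),
      (∀ k, I (V k)) → (∀ k, HasLead ω (V k) (d k) (P k)) → R ≠ 0 →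
      HasLead ω (eulerMinor c V) D R → D < ∑ k, d k + N →
      ∃ (V' : Fin r → (Fin n → ℂ) → ℂ) (d : Fin r → ℕ) (P : Fin r → MvPolynomial (Fin n) ℂ),
        (∀ k, I (V' k)) ∧ (∀ k, HasLead ω (V' k) (d k) (P k)) ∧ AlgebraicIndependent ℂ P := by
    intro N
    induction N with
    | zero =>
      intro V d P D R hV hP hR hΔ hD
      obtain ⟨Q, hQ⟩ := HasLead.eulerMinor hω c (fun k => hI _ (hV k)) hP
      exact absurd (hΔ.unique (hQ.lower (by simpa using hD))) hR
    | succ N ih =>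
      intro V d P D R hV hP hR hΔ hD
      by_cases hind : AlgebraicIndependent ℂ P
      · exact ⟨V, d, P, hV, hP, hind⟩
      have hVan : ∀ k, AnalyticAt ℂ (V k) 0 := fun k => hI _ (hV k)
      obtain ⟨Q, e, j, hQ, hQ0, hQj⟩ := exists_homogeneous_relation
        (fun k => (hP k).isWeightedHomogeneous hω (hVan k)) hind
      have hpd0 : MvPolynomial.pderiv j Q ≠ 0 := fun h => hQj (by rw [h, map_zero])
      obtain ⟨hje, hQjhom⟩ := isWeightedHomogeneous_pderiv hQ j hpd0
      set W : (Fin n → ℂ) → ℂ := fun x => MvPolynomial.eval (fun k => V k x) Q with hW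
      set V' := Function.update V j W with hV'
      have hIW : I W := hIQ V Q hV
      have hIV' : ∀ k, I (V' k) := by
        intro k
        by_cases h : k = j
        · subst h; simpa [hV'] using hIW
        · simpa [hV', h] using hV k
      have hWl : HasLead ω W e 0 := hQ0 ▸ HasLead.eval hP hQ
      -- By the chain rule the new row `j` is the combination of the old rows with coefficients (∂_k
      -- Q)(V), so the minor is multiplied by (∂_j Q)(V), of order `e - d j` and with nonzero lead.
      have hΔ' : HasLead ω (eulerMinor c V') (e - d j + D)
          (MvPolynomial.aeval P (MvPolynomial.pderiv j Q) * R) := by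
        refine ((HasLead.eval hP hQjhom).mul hΔ).congr hω ?_
        filter_upwards [eventually_all.2 fun k => (hVan k).eventually_analyticAt] with x hx
        have h1 := Matrix.det_updateRow_sum
          (Matrix.of fun (k : Fin r) j => x (c j) * fderiv ℂ (V k) x (Pi.single (c j) 1)) j
          (fun k => MvPolynomial.eval (fun k => V k x) (MvPolynomial.pderiv k Q))
        rw [eulerMinor, ← smul_eq_mul, ← h1, eulerMinor]
        congr 1
        ext k i
        by_cases h : k = j
        · subst h
          simp only [Matrix.updateRow_self, Finset.sum_apply, Pi.smul_apply, Matrix.of_apply, hV',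
            Function.update_self, smul_eq_mul]
          rw [hW, hasFDerivAt_eval_comp (fun k => (hx k).differentiableAt), Finset.mul_sum]
          exact Finset.sum_congr rfl fun _ _ => by ring
        · simp [hV', h]
      have hne := hΔ'.not_eventually_zero hω (mul_ne_zero hQj hR)
      have hW0 : ¬ ∀ᶠ x in 𝓝 0, W x = 0 := by
        intro h0
        refine hne ?_
        filter_upwards [h0.eventually_nhds] with x hx
        rw [eulerMinor]
        refine Matrix.det_eq_zero_of_row_eq_zero j fun i => ?_
        have : W =ᶠ[𝓝 x] fun _ => 0 := hx
        simp [hV', this.fderiv_eq]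
      obtain ⟨e', P', hP'0, hP'⟩ := exists_hasLead hω (hI _ hIW) hW0
      -- The component of `W` in degree `e` is the relation Q(P) = 0. Thus the minor gains `e - d j`
      -- while the sum of orders gains `e' - d j`, which is more, and the defect drops.
      have hee : e < e' := by
        by_contra! hle
        rcases hle.lt_or_eq with h | h
        · exact hP'0 (hP'.unique (hWl.lower h))
        · subst h; exact hP'0 (hP'.unique hWl)
      refine ih V' (Function.update d j e') (Function.update P j P') (e - d j + D) _ hIV' ?_
        (mul_ne_zero hQj hR) hΔ' ?_
      · intro k
        by_cases h : k = j
        · subst h; simpa [hV'] using hP'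
        · simpa [hV', h] using hP k
      · rw [← Finset.add_sum_erase _ _ (Finset.mem_univ j)] at hD ⊢
        have : ∑ k ∈ Finset.univ.erase j, Function.update d j e' k =
            ∑ k ∈ Finset.univ.erase j, d k :=
          Finset.sum_congr rfl fun k hk => by
            rw [Function.update_of_ne (Finset.ne_of_mem_erase hk)]
        rw [this, Function.update_self]
        omega
  have hrow : ∀ k, ¬ ∀ᶠ x in 𝓝 0, V k x = 0 := by
    intro k h0
    refine hc ?_
    filter_upwards [h0.eventually_nhds] with x hx
    rw [eulerMinor]
    refine Matrix.det_eq_zero_of_row_eq_zero k fun i => ?_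
    have : V k =ᶠ[𝓝 x] fun _ => 0 := hx
    simp [this.fderiv_eq]
  have hΔan : AnalyticAt ℂ (eulerMinor c V) 0 := by
    unfold eulerMinor
    simp only [Matrix.det_apply', Matrix.of_apply]
    refine Finset.analyticAt_fun_sum _ fun σ _ => analyticAt_const.mul ?_
    refine Finset.analyticAt_fun_prod _ fun k _ => AnalyticAt.mul ?_ ?_
    · exact (ContinuousLinearMap.proj (R := ℂ) (φ := fun _ : Fin n => ℂ) (c k)).analyticAt 0
    · exact ((ContinuousLinearMap.apply ℂ ℂ (Pi.single (c k) (1 : ℂ) : Fin n → ℂ)).analyticAt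
        _).comp (hI _ (hV (σ k))).fderiv
  choose d P hP0 hP using fun k => exists_hasLead hω (hI _ (hV k)) (hrow k)
  obtain ⟨D, R, hR, hD⟩ := exists_hasLead hω hΔan hc
  exact main (D + 1) V d P D R hV hP hR hD (by omega)


/-! ### Invariance of leads and tangency of the error. -/

theorem coeff_X_mul_pderiv {n : ℕ} (j : Fin n) (Q : MvPolynomial (Fin n) ℂ) (m : Fin n →₀ ℕ) :
    (MvPolynomial.X j * MvPolynomial.pderiv j Q).coeff m = m j * Q.coeff m := by
  induction Q using MvPolynomial.induction_on' with
  | monomial u a =>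
    classical
    rw [MvPolynomial.X_mul_pderiv_monomial, MvPolynomial.coeff_smul, MvPolynomial.coeff_monomial]
    split_ifs with hu
    · subst hu; simp
    · simp
  | add p q hp hq => simp only [map_add, mul_add, MvPolynomial.coeff_add, hp, hq]

/-- The polynomial `P(μ₁ y₁, …, μₙ yₙ)`. -/
noncomputable def scaleVars {n : ℕ} (μ : Fin n → ℂ) :
    MvPolynomial (Fin n) ℂ →ₐ[ℂ] MvPolynomial (Fin n) ℂ :=
  MvPolynomial.aeval fun i => MvPolynomial.C (μ i) * MvPolynomial.X i

theorem eval_scaleVars {n : ℕ} (μ : Fin n → ℂ) (P : MvPolynomial (Fin n) ℂ) (y : Fin n → ℂ) :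
    MvPolynomial.eval y (scaleVars μ P) = MvPolynomial.eval (fun i => μ i * y i) P := by
  rw [scaleVars, MvPolynomial.aeval_def, MvPolynomial.eval_eval₂]
  simp only [map_mul, MvPolynomial.eval_C, MvPolynomial.eval_X]
  rw [MvPolynomial.eval₂_eq', MvPolynomial.eval_eq']
  simp

theorem coeff_scaleVars {n : ℕ} (μ : Fin n → ℂ) (P : MvPolynomial (Fin n) ℂ) (m : Fin n →₀ ℕ) :
    (scaleVars μ P).coeff m = monomialAt μ m * P.coeff m := by
  induction P using MvPolynomial.induction_on' with
  | monomial u a =>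
    classical
    have h : scaleVars μ (MvPolynomial.monomial u a) =
        MvPolynomial.monomial u (monomialAt μ u * a) := by
      refine MvPolynomial.funext fun y => ?_
      have he : ∀ (b : ℂ) (y : Fin n → ℂ), MvPolynomial.eval y (MvPolynomial.monomial u b) =
          b * monomialAt y u := fun b y => by
        rw [MvPolynomial.eval_monomial, Finsupp.prod_fintype _ _ (by simp)]; rfl
      rw [eval_scaleVars, he, he, monomialAt_mul]; ring
    rw [h, MvPolynomial.coeff_monomial, MvPolynomial.coeff_monomial]
    split_ifs with hu
    · rw [hu]
    · simp
  | add p q hp hq => simp only [map_add, mul_add, MvPolynomial.coeff_add, hp, hq]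

/-- The image of a dilated point under a map whose components have leads of their own weight. -/
theorem tendsto_rescaled {n : ℕ} {ω δ : Fin n → ℕ} {F : (Fin n → ℂ) → (Fin n → ℂ)}
    {P : Fin n → MvPolynomial (Fin n) ℂ} (hF : ∀ i, HasLead ω (fun x => F x i) (δ i) (P i))
    {α : Type*} {l : Filter α} {t : α → ℂ} {ξ : α → Fin n → ℂ} {y : Fin n → ℂ}
    (ht : Tendsto t l (𝓝[≠] 0)) (hξ : Tendsto ξ l (𝓝 y)) :
    Tendsto (fun a i => (t a ^ δ i)⁻¹ * F (wscale ω (t a) (ξ a)) i) l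
      (𝓝 fun i => MvPolynomial.eval y (P i)) :=
  tendsto_pi_nhds.2 fun i => (hF i).tendsto ht hξ

theorem wscale_rescaled {n : ℕ} (ω : Fin n → ℕ) {t : ℂ} (ht : t ≠ 0) (x : Fin n → ℂ) :
    wscale ω t (fun i => (t ^ ω i)⁻¹ * x i) = x := by
  funext i
  simp [wscale, ht]

/-- The lead of a first integral is invariant under the diagonal part of the linearization. -/
theorem HasLead.eval_scale_eq {n : ℕ} {ω : Fin n → ℕ} (hω : ∀ i, 1 ≤ ω i) {μ : Fin n → ℂ}
    {F : (Fin n → ℂ) → (Fin n → ℂ)}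
    (hF : ∀ i, HasLead ω (fun x => F x i) (ω i) (MvPolynomial.C (μ i) * MvPolynomial.X i))
    {V : (Fin n → ℂ) → ℂ} {d : ℕ} {P : MvPolynomial (Fin n) ℂ} (h : HasLead ω V d P)
    (hVF : ∀ᶠ x in 𝓝 0, V (F x) = V x) : scaleVars μ P = P := by
  refine MvPolynomial.funext fun y => ?_
  have ht : Tendsto (Prod.fst : ℂ × (Fin n → ℂ) → ℂ) (𝓝[≠] 0 ×ˢ 𝓝 y) (𝓝[≠] 0) := tendsto_fst
  have ht0 := tendsto_nhds_of_tendsto_nhdsWithin ht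
  have hξ : Tendsto (Prod.snd : ℂ × (Fin n → ℂ) → _) (𝓝[≠] 0 ×ˢ 𝓝 y) (𝓝 y) := tendsto_snd
  have h1 := h.tendsto ht (tendsto_rescaled hF ht hξ)
  have h2 : Tendsto (fun q : ℂ × (Fin n → ℂ) => (q.1 ^ d)⁻¹ * V (wscale ω q.1 q.2))
      (𝓝[≠] 0 ×ˢ 𝓝 y) (𝓝 (MvPolynomial.eval y (scaleVars μ P))) := by
    rw [eval_scaleVars]
    simp only [map_mul, MvPolynomial.eval_C, MvPolynomial.eval_X] at h1
    refine h1.congr' ?_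
    filter_upwards [ht self_mem_nhdsWithin, (tendsto_wscale hω ht0 hξ).eventually hVF] with q hq hv
    rw [wscale_rescaled ω hq, hv]
  exact tendsto_nhds_unique h2 (h y)

theorem monomialAt_eq_one_of_scaleVars {n : ℕ} {μ : Fin n → ℂ} {P : MvPolynomial (Fin n) ℂ}
    (h : scaleVars μ P = P) (m : Fin n →₀ ℕ) (hm : P.coeff m ≠ 0) : monomialAt μ m = 1 := by
  have h1 := coeff_scaleVars μ P m
  rw [h] at h1
  exact mul_right_cancel₀ hm (by rw [← h1, one_mul])

theorem log_norm_monomialAt {n : ℕ} {μ : Fin n → ℂ} (hμ : ∀ i, μ i ≠ 0) (m : Fin n →₀ ℕ) :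
    Real.log ‖monomialAt μ m‖ = ∑ i, (m i : ℝ) * Real.log ‖μ i‖ := by
  rw [monomialAt, norm_prod, Real.log_prod fun i _ => norm_ne_zero_iff.2 (pow_ne_zero _ (hμ i))]
  simp [Real.log_pow]

/-- Monomials are eigenvectors of a diagonal field, with eigenvalue ∑ a_i m_i. -/
theorem euler_pderiv_eq_zero {n : ℕ} {P : MvPolynomial (Fin n) ℂ} (a : Fin n → ℂ)
    (ha : ∀ m, P.coeff m ≠ 0 → ∑ i, a i * m i = 0) :
    ∑ i, MvPolynomial.C (a i) * MvPolynomial.X i * MvPolynomial.pderiv i P = 0 := by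
  ext m
  simp only [mul_assoc, MvPolynomial.coeff_sum, MvPolynomial.coeff_C_mul, coeff_X_mul_pderiv,
    MvPolynomial.coeff_zero]
  by_cases h : P.coeff m = 0
  · simp [h]
  · simp only [← mul_assoc, ← Finset.sum_mul, ha m h, zero_mul]

theorem ConsistsOfMonomials.const_mul {n : ℕ} {g : (Fin n → ℂ) → ℂ} {S : (Fin n →₀ ℕ) → Prop}
    (h : ConsistsOfMonomials g S) (a : ℂ) : ConsistsOfMonomials (fun x => a * g x) S := by
  obtain ⟨c, hc, hS⟩ := h
  refine ⟨MvPowerSeries.C a * c, ?_, fun m hm => hS m fun h0 => hm ?_⟩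
  · filter_upwards [hc] with x hx
    simpa [MvPowerSeries.coeff_C_mul, mul_assoc] using hx.mul_left a
  · rw [MvPowerSeries.coeff_C_mul, h0, mul_zero]

theorem ConsistsOfMonomials.sum {n : ℕ} {ι : Type*} (s : Finset ι) {g : ι → (Fin n → ℂ) → ℂ}
    {S : (Fin n →₀ ℕ) → Prop} (h : ∀ i ∈ s, ConsistsOfMonomials (g i) S) :
    ConsistsOfMonomials (fun x => ∑ i ∈ s, g i x) S := by
  classical
  induction s using Finset.induction_on with
  | empty =>
    refine ⟨0, Eventually.of_forall fun x => ?_, fun m hm => absurd (map_zero _) hm⟩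
    simp
  | insert a s ha ih =>
    obtain ⟨c, hc, hS⟩ := h a (Finset.mem_insert_self _ _)
    obtain ⟨c', hc', hS'⟩ := ih fun i hi => h i (Finset.mem_insert_of_mem hi)
    refine ⟨c + c', ?_, fun m hm => ?_⟩
    · filter_upwards [hc, hc'] with x hx hx'
      rw [Finset.sum_insert ha]
      simpa [add_mul] using hx.add hx'
    · by_contra hn
      refine hm ?_
      rw [map_add, not_not.1 fun h => hn (hS m h), not_not.1 fun h => hn (hS' m h), add_zero]

/-- If `V ∘ Φ` is invariant under `Φ⁻¹ ∘ (Φ ∘ G + E)`, where `G` preserves the splitting into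
monomials with equal `μ ^ m` and the lead `Ep` of `E` commutes with the diagonal matrix `μ`, then
`Ep` is tangent to the level sets of the lead of `V`. -/
theorem lead_error_tangent {n : ℕ} {ω : Fin n → ℕ} (hω : ∀ i, 1 ≤ ω i) {μ : Fin n → ℂ}
    {V : (Fin n → ℂ) → ℂ} (hV : AnalyticAt ℂ V 0) {d : ℕ}
    {P : MvPolynomial (Fin n) ℂ} (hP : HasLead ω V d P) (hPμ : scaleVars μ P = P)
    {Φ G E : (Fin n → ℂ) → (Fin n → ℂ)} (hΦ : AnalyticAt ℂ Φ 0) (hΦ0 : Φ 0 = 0)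
    (hΦl : ∀ i, HasLead ω (fun x => Φ x i) (ω i) (MvPolynomial.X i))
    (hGl : ∀ i, HasLead ω (fun x => G x i) (ω i) (MvPolynomial.C (μ i) * MvPolynomial.X i))
    (hGm : ∀ m, ConsistsOfMonomials (fun x => monomialAt x m - monomialAt (G x) m)
      fun m' => monomialAt μ m' ≠ 1)
    {δ : ℕ} (hδ : 1 ≤ δ) {Ep : Fin n → MvPolynomial (Fin n) ℂ}
    (hE : ∀ i, HasLead ω (fun x => E x i) (ω i + δ) (Ep i))
    (hEp : ∀ i m, (Ep i).coeff m ≠ 0 → monomialAt μ m = μ i)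
    (hVF : ∀ᶠ x in 𝓝 0, V (Φ (G x) + E x) = V (Φ x)) :
    ∑ i, MvPolynomial.C (μ i)⁻¹ * Ep i * MvPolynomial.pderiv i P = 0 := by
  have hP1 := monomialAt_eq_one_of_scaleVars hPμ
  -- This is the differential of `P` at the point μy, applied to `Ep`. Monomials of ∂_i P have
  -- character μ_i⁻¹ and those of `Ep i` have character μ_i, so `Q` contains only monomials with μ^m
  -- = 1.
  set Q : MvPolynomial (Fin n) ℂ := ∑ i, scaleVars μ (MvPolynomial.pderiv i P) * Ep i with hQ
  have hscale : ∀ i, scaleVars μ (MvPolynomial.pderiv i P) =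
      MvPolynomial.C (μ i)⁻¹ * MvPolynomial.pderiv i P := by
    intro i
    ext m
    rw [coeff_scaleVars, MvPolynomial.coeff_C_mul]
    by_cases h : (MvPolynomial.pderiv i P).coeff m = 0
    · rw [h, mul_zero, mul_zero]
    · congr 1
      rw [MvPolynomial.coeff_pderiv] at h
      have := hP1 _ (left_ne_zero_of_mul h)
      rw [monomialAt_add, monomialAt_single, pow_one] at this
      exact eq_inv_of_mul_eq_one_left this
  have hQ' : Q = ∑ i, MvPolynomial.C (μ i)⁻¹ * Ep i * MvPolynomial.pderiv i P := by
    rw [hQ]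
    refine Finset.sum_congr rfl fun i _ => ?_
    rw [hscale]; ring
  rw [← hQ']
  have hW : AnalyticAt ℂ (fun x => V (Φ x)) 0 := by
    have : AnalyticAt ℂ V (Φ 0) := by rwa [hΦ0]
    exact this.comp hΦ
  obtain ⟨c, hc⟩ := exists_hasTaylorSeries hW
  set N := d + δ + 1 with hN
  -- With W = V ∘ Φ, the hypothesis reads V(Φ∘G + E) - V(Φ∘G) = W - W∘G. The function `S` is the
  -- right side with W replaced by a Taylor polynomial; the left side has lead `Q`.
  set S : (Fin n → ℂ) → ℂ := fun x => ∑ m ∈ degLT n N,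
    MvPowerSeries.coeff m c * (monomialAt x m - monomialAt (G x) m) with hS
  have hSmon : ConsistsOfMonomials S fun m' => monomialAt μ m' ≠ 1 :=
    ConsistsOfMonomials.sum _ fun m _ => (hGm m).const_mul _
  have hSlead : HasLead ω S (d + δ) Q := by
    intro y
    have ht : Tendsto (Prod.fst : ℂ × (Fin n → ℂ) → ℂ) (𝓝[≠] 0 ×ˢ 𝓝 y) (𝓝[≠] 0) := tendsto_fst
    have ht0 := tendsto_nhds_of_tendsto_nhdsWithin ht
    have hξ : Tendsto (Prod.snd : ℂ × (Fin n → ℂ) → _) (𝓝[≠] 0 ×ˢ 𝓝 y) (𝓝 y) := tendsto_snd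
    have hG1 := tendsto_rescaled hGl ht hξ
    have hΦ1 := tendsto_rescaled hΦl ht hG1
    have hE1 := tendsto_rescaled hE ht hξ
    have h1 := hP.tendsto_sub hω hV hδ ht hΦ1 hE1
    have hR := hc.isBigO_sub_truncDeg N
    have hr1 := tendsto_remainder ht (isBigO_wscale hω ht0 hξ) (Nat.lt_succ_self (d + δ)) hR
    have hr2 := tendsto_remainder ht (isBigO_wscale hω ht0 hG1) (Nat.lt_succ_self (d + δ)) hR
    have h2 := (h1.sub hr1).add hr2
    have h3 : polyFDeriv P (fun i => MvPolynomial.eval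
        (fun i => MvPolynomial.eval y (MvPolynomial.C (μ i) * MvPolynomial.X i))
        (MvPolynomial.X i)) (fun i => MvPolynomial.eval y (Ep i)) - 0 + 0 =
        MvPolynomial.eval y Q := by
      rw [polyFDeriv_apply, hQ, map_sum, sub_zero, add_zero]
      refine Finset.sum_congr rfl fun i _ => ?_
      rw [map_mul, eval_scaleVars]
      simp
    rw [h3] at h2
    refine h2.congr' ?_
    filter_upwards [ht self_mem_nhdsWithin, (tendsto_wscale hω ht0 hξ).eventually hVF] with q hq hv
    have hq : q.1 ≠ 0 := hq
    have e1 : wscale ω q.1 (fun i => (q.1 ^ ω i)⁻¹ * G (wscale ω q.1 q.2) i) =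
        G (wscale ω q.1 q.2) := wscale_rescaled ω hq _
    have e2 : wscale ω q.1 (fun i => (q.1 ^ ω i)⁻¹ * Φ (G (wscale ω q.1 q.2)) i) =
        Φ (G (wscale ω q.1 q.2)) := wscale_rescaled ω hq _
    have e3 : wscale ω q.1 ((fun i => (q.1 ^ ω i)⁻¹ * Φ (G (wscale ω q.1 q.2)) i) +
        q.1 ^ δ • fun i => (q.1 ^ (ω i + δ))⁻¹ * E (wscale ω q.1 q.2) i) =
        Φ (G (wscale ω q.1 q.2)) + E (wscale ω q.1 q.2) := by
      funext i
      simp only [wscale, Pi.add_apply, Pi.smul_apply, smul_eq_mul, pow_add]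
      field_simp
    simp only [e1]
    rw [e2, e3, hv]
    simp only [eval_truncDeg, hS, mul_sub, Finset.sum_sub_distrib, Finset.mul_sum]
    ring
  -- As a component of `S`, `Q` contains only monomials with μ^m ≠ 1; both constraints together
  -- leave nothing.
  obtain ⟨c', hc', hS'⟩ := hSmon
  have hQw := hSlead.eq_wcomp hω hc'
  ext m
  rw [MvPolynomial.coeff_zero]
  by_contra hne
  have h1 : monomialAt μ m ≠ 1 := by
    refine hS' m fun h0 => hne ?_
    rw [hQw, coeff_wcomp hω, h0, ite_self]
  refine h1 ?_
  rw [hQ, MvPolynomial.coeff_sum] at hne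
  obtain ⟨i, -, hi⟩ := Finset.exists_ne_zero_of_sum_ne_zero hne
  rw [hscale, mul_assoc, MvPolynomial.coeff_C_mul] at hi
  have hi := right_ne_zero_of_mul hi
  classical
  rw [MvPolynomial.coeff_mul] at hi
  obtain ⟨⟨a, b⟩, hab, hi⟩ := Finset.exists_ne_zero_of_sum_ne_zero hi
  rw [Finset.HasAntidiagonal.mem_antidiagonal] at hab
  rw [← hab, monomialAt_add, hEp i b (right_ne_zero_of_mul hi)]
  have h2 := left_ne_zero_of_mul hi
  rw [MvPolynomial.coeff_pderiv] at h2
  have := hP1 _ (left_ne_zero_of_mul h2)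
  rwa [monomialAt_add, monomialAt_single, pow_one] at this


/-! ### The rank of the resonant set. -/

theorem sum_mul_log_eq_zero {n : ℕ} {μ : Fin n → ℂ} (hμ : ∀ i, μ i ≠ 0) {m : Fin n →₀ ℕ}
    (hm : monomialAt μ m = 1) : ∑ i, (m i : ℝ) * Real.log ‖μ i‖ = 0 := by
  rw [← log_norm_monomialAt hμ, hm, norm_one, Real.log_one]

/-- The exponents of resonances lie in the kernel of the linear form with coefficients log |μ_i|,
which is nonzero. -/
theorem resonantRank_lt {n : ℕ} {μ : Fin n → ℂ} (hμ : ∀ i, μ i ≠ 0) {i₀ : Fin n}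
    (hi₀ : Real.log ‖μ i₀‖ ≠ 0) : resonantRank μ < n := by
  let L : (Fin n → ℚ) →ₗ[ℚ] ℝ :=
    { toFun := fun v => ∑ i, (v i : ℝ) * Real.log ‖μ i‖
      map_add' := fun v w => by simp [add_mul, Finset.sum_add_distrib]
      map_smul' := fun a v => by
        simp only [Pi.smul_apply, smul_eq_mul, Rat.cast_mul, RingHom.id_apply, Rat.smul_def,
          Finset.mul_sum, mul_assoc] }
  have hle : Submodule.span ℚ (ratVec '' resonantSet μ) ≤ LinearMap.ker L := by
    refine Submodule.span_le.2 ?_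
    rintro _ ⟨m, hm, rfl⟩
    change ∑ i, ((ratVec m i : ℚ) : ℝ) * Real.log ‖μ i‖ = 0
    simpa [ratVec] using sum_mul_log_eq_zero hμ hm.1
  have hlt : LinearMap.ker L < ⊤ := by
    refine lt_top_iff_ne_top.2 fun h => hi₀ ?_
    have h1 : (Pi.single i₀ 1 : Fin n → ℚ) ∈ LinearMap.ker L := by rw [h]; trivial
    have h2 : ∑ i, (((Pi.single i₀ 1 : Fin n → ℚ) i : ℚ) : ℝ) * Real.log ‖μ i‖ = 0 := h1
    rw [Finset.sum_eq_single i₀ (fun j _ hj => by simp [hj]) (by simp)] at h2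
    simpa using h2
  calc resonantRank μ ≤ Module.finrank ℚ (LinearMap.ker L) := Submodule.finrank_mono hle
    _ < Module.finrank ℚ (Fin n → ℚ) := Submodule.finrank_lt hlt.ne
    _ = n := by simp

/-- If the rank were smaller, two independent linear forms would vanish on all resonances. They
define two diagonal vector fields that kill every `P k`, hence are proportional, against
independence. -/
theorem le_resonantRank {n r : ℕ} (hn : r + 1 = n) {μ : Fin n → ℂ}
    {P : Fin r → MvPolynomial (Fin n) ℂ} (hP : AlgebraicIndependent ℂ P)
    (hPμ : ∀ k m, (P k).coeff m ≠ 0 → monomialAt μ m = 1) : r ≤ resonantRank μ := by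
  by_contra! hlt
  set W := Submodule.span ℚ (ratVec '' resonantSet μ) with hW
  have hfr := Subspace.finrank_add_finrank_dualAnnihilator_eq W
  rw [Module.finrank_fintype_fun_eq_card, Fintype.card_fin] at hfr
  have hone : 1 < Module.finrank ℚ W.dualAnnihilator := by
    have : Module.finrank ℚ W = resonantRank μ := rfl
    omega
  have : Nontrivial W.dualAnnihilator := Module.nontrivial_of_finrank_pos (R := ℚ) (by omega)
  obtain ⟨f, hf⟩ := exists_ne (0 : W.dualAnnihilator)
  obtain ⟨g, hg⟩ := exists_linearIndependent_pair_of_one_lt_finrank hone hf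
  have hvan : ∀ (f : W.dualAnnihilator) k m, (P k).coeff m ≠ 0 →
      ∑ i, ((f.1 (Pi.single i 1) : ℚ) : ℂ) * m i = 0 := by
    intro f k m hm
    have h1 : f.1 (ratVec m) = 0 := by
      by_cases hm0 : m = 0
      · have : ratVec m = 0 := by subst hm0; funext i; simp [ratVec]
        rw [this, map_zero]
      -- Doubling ensures total degree at least two, as membership in the resonant set requires.
      have h2 : ratVec (m + m) ∈ W := by
        refine Submodule.subset_span ⟨_, ⟨?_, ?_⟩, rfl⟩
        · rw [monomialAt_add, hPμ k m hm, one_mul]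
        · obtain ⟨i, hi⟩ : ∃ i, m i ≠ 0 := by
            by_contra! H; exact hm0 (Finsupp.ext H)
          have : m i ≤ totalDeg m := Finset.single_le_sum (f := fun i => m i)
            (fun _ _ => Nat.zero_le _) (Finset.mem_univ i)
          rw [totalDeg_add]; omega
      have h3 := (Submodule.mem_dualAnnihilator _).1 f.2 _ h2
      have h4 : ratVec (m + m) = (2 : ℚ) • ratVec m := by
        funext i; simp [ratVec]; ring
      rw [h4, map_smul, smul_eq_mul] at h3
      exact (mul_eq_zero.1 h3).resolve_left two_ne_zero
    have h5 : ratVec m = ∑ i, (m i : ℚ) • (Pi.single i 1 : Fin n → ℚ) := by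
      funext j; simp [ratVec, Finset.sum_apply, Pi.single_apply]
    rw [h5, map_sum] at h1
    simp only [map_smul, smul_eq_mul] at h1
    have := congrArg (fun q : ℚ => (q : ℂ)) h1
    push_cast at this
    rw [← this]
    exact Finset.sum_congr rfl fun i _ => mul_comm _ _
  have hkill : ∀ (f : W.dualAnnihilator) k, ∑ i, MvPolynomial.C ((f.1 (Pi.single i 1) : ℚ) : ℂ) *
      MvPolynomial.X i * MvPolynomial.pderiv i (P k) = 0 :=
    fun f k => euler_pderiv_eq_zero _ (hvan f k)
  -- Evaluating the polynomial identity at (1, …, 1) leaves the coefficients of the two linear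
  -- forms.
  have hprop : ∀ i j, f.1 (Pi.single i 1) * g.1 (Pi.single j 1) =
      f.1 (Pi.single j 1) * g.1 (Pi.single i 1) := by
    intro i j
    have h1 := vectorField_proportional (by simpa using hn) hP (hkill f) (hkill g) i j
    have h2 := congrArg (MvPolynomial.eval fun _ => (1 : ℂ)) h1
    simp only [map_mul, MvPolynomial.eval_C, MvPolynomial.eval_X, mul_one] at h2
    exact_mod_cast h2
  rw [LinearIndependent.pair_iff] at hg
  have hext : ∀ a : W.dualAnnihilator, (∀ i, a.1 (Pi.single i 1) = 0) → a = 0 := by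
    intro a ha
    refine Subtype.ext (LinearMap.pi_ext' fun i => ?_)
    ext
    simpa using ha i
  refine hf (hext f fun j => ?_)
  have h1 := (hg (g.1 (Pi.single j 1)) (-f.1 (Pi.single j 1)) (hext _ fun i => ?_)).2
  · simpa using h1
  · simp only [Submodule.coe_add, Submodule.coe_smul, LinearMap.add_apply, LinearMap.smul_apply,
      smul_eq_mul]
    linear_combination hprop i j

theorem exists_simple_divisor {n : ℕ} {μ : Fin n → ℂ} (m : Fin n →₀ ℕ) (hm : m ∈ resonantSet μ) :
    ∃ m', IsSimpleResonant μ m' ∧ ∃ q : ℕ, 1 ≤ q ∧ m = q • m' := by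
  induction hd : totalDeg m using Nat.strong_induction_on generalizing m with
  | _ N ih =>
    by_cases hs : IsSimpleResonant μ m
    · exact ⟨m, hs, 1, le_rfl, by simp⟩
    · rw [IsSimpleResonant, not_and] at hs
      have := hs hm
      push Not at this
      obtain ⟨q, hq, m', hm', rfl⟩ := this
      have hdeg : totalDeg (q • m') = q * totalDeg m' := by simp [totalDeg, Finset.mul_sum]
      have h2 := hm'.2
      obtain ⟨m'', hs'', q', hq', rfl⟩ := ih (totalDeg m') (by rw [← hd, hdeg]; nlinarith) m' hm' rfl
      exact ⟨m'', hs'', q * q', by nlinarith, by rw [mul_smul]⟩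

/-- Replacing the members of a basis of resonances by simple divisors only rescales them. -/
theorem exists_simple_independent {n r : ℕ} {μ : Fin n → ℂ} (hr : resonantRank μ = r) :
    ∃ m : Fin r → (Fin n →₀ ℕ), (∀ k, IsSimpleResonant μ (m k)) ∧
      LinearIndependent ℚ fun k => ratVec (m k) := by
  obtain ⟨f, hf, -, hli⟩ := Submodule.exists_fun_fin_finrank_span_eq ℚ (ratVec '' resonantSet μ)
  have hli' : LinearIndependent ℚ (f ∘ Fin.cast hr.symm) := hli.comp _ (Fin.cast_injective _)
  choose m hm hmf using hf
  choose m' hs q hq hqm using fun k => exists_simple_divisor (m k) (hm k)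
  refine ⟨fun k => m' (Fin.cast hr.symm k), fun k => hs _, ?_⟩
  have hq0 : ∀ k, (q k : ℚ) ≠ 0 := fun k => by have := hq k; positivity
  have h1 := hli'.units_smul fun k => Units.mk0 _ (inv_ne_zero (hq0 (Fin.cast hr.symm k)))
  convert h1 using 1
  funext k
  have h2 : ratVec (m (Fin.cast hr.symm k)) =
      (q (Fin.cast hr.symm k) : ℚ) • ratVec (m' (Fin.cast hr.symm k)) := by
    funext i
    conv_lhs => rw [hqm]
    simp [ratVec]
  change _ = (q (Fin.cast hr.symm k) : ℚ)⁻¹ • f (Fin.cast hr.symm k)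
  rw [← hmf, h2, smul_smul, inv_mul_cancel₀ (hq0 _), one_smul]

/-! ### Perturbations proportional to the logarithmic diagonal field. -/

theorem IsWeightedHomogeneous.hasLead {n : ℕ} {ω : Fin n → ℕ} (hω : ∀ i, 1 ≤ ω i)
    {p : MvPolynomial (Fin n) ℂ} {d : ℕ} (hp : MvPolynomial.IsWeightedHomogeneous ω p d) :
    HasLead ω (fun x => MvPolynomial.eval x p) d p := by
  have h1 := (hasTaylorSeries_eval p).hasLead hω (d := d) fun m hm => by
    rw [MvPolynomial.coeff_coe]
    by_contra h
    exact hm.ne (hp h)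
  convert h1 using 1
  ext m
  rw [coeff_wcomp hω, MvPolynomial.coeff_coe]
  split_ifs with h
  · rfl
  · by_contra h2
    exact h (hp h2)

theorem mul_totalDeg_le_weight {n : ℕ} {ω : Fin n → ℕ} {a : ℕ} (hω : ∀ i, a ≤ ω i)
    (m : Fin n →₀ ℕ) : a * totalDeg m ≤ Finsupp.weight ω m := by
  rw [Finsupp.weight_apply, Finsupp.sum_fintype _ _ (by simp), totalDeg, Finset.mul_sum]
  refine Finset.sum_le_sum fun i _ => ?_
  rw [smul_eq_mul, mul_comm]
  exact Nat.mul_le_mul_left _ (hω i)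

theorem ConsistsOfMonomials.hasLead_zero {n : ℕ} {ω : Fin n → ℕ} {a : ℕ} (ha : 1 ≤ a)
    (hω : ∀ i, a ≤ ω i) {f : (Fin n → ℂ) → ℂ}
    (hf : ConsistsOfMonomials f fun m => 2 ≤ totalDeg m) {K : ℕ} (hK : K < 2 * a) :
    HasLead ω f K 0 := by
  have hω1 : ∀ i, 1 ≤ ω i := fun i => ha.trans (hω i)
  obtain ⟨c, hc, hS⟩ := hf
  have hz : ∀ m, Finsupp.weight ω m ≤ K → MvPowerSeries.coeff m c = 0 := by
    intro m hm
    by_contra h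
    have h1 := hS m h
    have h2 := mul_totalDeg_le_weight hω m
    nlinarith
  have h1 := hc.hasLead hω1 (d := K) fun m hm => hz m hm.le
  convert h1 using 1
  ext m
  rw [coeff_wcomp hω1, MvPolynomial.coeff_zero]
  split_ifs with h
  · rw [hz m h.le]
  · rfl

theorem C_mul_X_proportional {n : ℕ} {X : Fin n → MvPolynomial (Fin n) ℂ} {a : Fin n → ℂ}
    (h : ∀ i j, X i * (MvPolynomial.C (a j) * MvPolynomial.X j) =
      X j * (MvPolynomial.C (a i) * MvPolynomial.X i)) {i₀ : Fin n} (hi₀ : a i₀ ≠ 0)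
    (h0 : X i₀ = 0) : X = 0 := by
  funext i
  have h1 := h i i₀
  rw [h0, zero_mul, mul_eq_zero] at h1
  refine h1.resolve_right (mul_ne_zero ?_ (MvPolynomial.X_ne_zero _))
  rwa [Ne, MvPolynomial.C_eq_zero]

/-- A nilpotent Jordan block is not tangent to the orbits of the diagonal vector field. -/
theorem isDiag_of_proportional {n : ℕ} {J : Matrix (Fin n) (Fin n) ℂ} (hJ : IsLowerJordan J)
    {a b : Fin n → ℂ} (hb : ∀ i, b i ≠ 0) {i₀ : Fin n} (hi₀ : a i₀ ≠ 0)
    (ha : ∀ i j, J i i = J j j → a i = a j)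
    {N : Fin n → MvPolynomial (Fin n) ℂ}
    (hN : ∀ i, N i = ∑ j ∈ Finset.univ.erase i, MvPolynomial.C (J i j) * MvPolynomial.X j)
    (h : ∀ i j, MvPolynomial.C (b i) * N i * (MvPolynomial.C (a j) * MvPolynomial.X j) =
      MvPolynomial.C (b j) * N j * (MvPolynomial.C (a i) * MvPolynomial.X i)) (i j : Fin n)
    (hij : i ≠ j) : J i j = 0 := by
  by_contra hne
  obtain ⟨-, -, hJij⟩ := (hJ i j hij).resolve_left hne
  have heval : ∀ k l, MvPolynomial.eval (Pi.single l 1 : Fin n → ℂ) (N k) =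
      if k = l then 0 else J k l := by
    intro k l
    rw [hN, map_sum]
    simp only [map_mul, MvPolynomial.eval_C, MvPolynomial.eval_X]
    split_ifs with hkl
    · subst hkl
      refine Finset.sum_eq_zero fun j hj => ?_
      simp [Finset.ne_of_mem_erase hj]
    · rw [Finset.sum_eq_single l]
      · simp
      · intro j _ hj; simp [hj]
      · intro hl
        exact absurd (Finset.mem_erase.2 ⟨Ne.symm hkl, Finset.mem_univ _⟩) hl
  -- The entry `J i j` links equal eigenvalues, so `a i = a j`. If both vanish, comparison with the
  -- component `i₀` gives `N i = 0`; otherwise evaluation at the basis vector `j` isolates `J i j`.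
  by_cases haj : a j = 0
  · have h1 := h i i₀
    have hai : a i = 0 := by rw [ha i j hJij, haj]
    rw [hai, map_zero, zero_mul, mul_zero, mul_eq_zero] at h1
    have h2 : N i = 0 := by
      refine (mul_eq_zero.1 (h1.resolve_right (mul_ne_zero ?_ (MvPolynomial.X_ne_zero _)))).resolve_left ?_
      · rwa [Ne, MvPolynomial.C_eq_zero]
      · rw [MvPolynomial.C_eq_zero]; exact hb i
    have h3 := heval i j
    rw [h2, map_zero, if_neg hij] at h3
    exact hne h3.symm
  · have h1 := congrArg (MvPolynomial.eval (Pi.single j 1 : Fin n → ℂ)) (h i j)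
    simp only [map_mul, heval, if_neg hij, MvPolynomial.eval_C, MvPolynomial.eval_X,
      Pi.single_eq_same, Pi.single_eq_of_ne hij, if_true, mul_zero, mul_one] at h1
    exact mul_ne_zero (mul_ne_zero (hb i) hne) haj h1

/-- A resonant error term that is tangent to the orbits of the diagonal vector field, and one
component of which is not divisible by its variable, vanishes. -/
theorem error_eq_zero_of_proportional {n : ℕ} {μ : Fin n → ℂ} (hμ : ∀ i, μ i ≠ 0) {i₀ : Fin n}
    (hi₀ : Real.log ‖μ i₀‖ ≠ 0) {E : Fin n → MvPolynomial (Fin n) ℂ}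
    (hE : ∀ i m, (E i).coeff m ≠ 0 → monomialAt μ m = μ i)
    (hE₀ : ∀ m, (E i₀).coeff m ≠ 0 → m i₀ = 0)
    (h : ∀ i j, MvPolynomial.C (μ i)⁻¹ * E i *
        (MvPolynomial.C ((Real.log ‖μ j‖ : ℝ) : ℂ) * MvPolynomial.X j) =
      MvPolynomial.C (μ j)⁻¹ * E j *
        (MvPolynomial.C ((Real.log ‖μ i‖ : ℝ) : ℂ) * MvPolynomial.X i)) : ∀ i, E i = 0 := by
  have hlog : ((Real.log ‖μ i₀‖ : ℝ) : ℂ) ≠ 0 := by exact_mod_cast hi₀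
  have hC : ∀ i, MvPolynomial.C (σ := Fin n) (μ i)⁻¹ ≠ 0 := fun i => by
    rw [Ne, MvPolynomial.C_eq_zero]; exact inv_ne_zero (hμ i)
  have hE₀0 : E i₀ = 0 := by
    ext m
    rw [MvPolynomial.coeff_zero]
    by_contra hm
    have hm0 := hE₀ m hm
    -- Multiplying a monomial free of y_{i₀} by y_j with `j ≠ i₀` keeps it free of y_{i₀}, while the
    -- other side of the proportionality is divisible by y_{i₀}.
    by_cases hex : ∃ j, j ≠ i₀ ∧ Real.log ‖μ j‖ ≠ 0
    · obtain ⟨j, hj, hlj⟩ := hex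
      have h1 := congrArg (MvPolynomial.coeff (m + Finsupp.single j 1)) (h i₀ j)
      have e1 : MvPolynomial.C (μ i₀)⁻¹ * E i₀ *
          (MvPolynomial.C ((Real.log ‖μ j‖ : ℝ) : ℂ) * MvPolynomial.X j) =
          MvPolynomial.C ((μ i₀)⁻¹ * ((Real.log ‖μ j‖ : ℝ) : ℂ)) * (E i₀ * MvPolynomial.X j) := by
        rw [MvPolynomial.C_mul]; ring
      have e2 : MvPolynomial.C (μ j)⁻¹ * E j *
          (MvPolynomial.C ((Real.log ‖μ i₀‖ : ℝ) : ℂ) * MvPolynomial.X i₀) =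
          MvPolynomial.C ((μ j)⁻¹ * ((Real.log ‖μ i₀‖ : ℝ) : ℂ)) * (E j * MvPolynomial.X i₀) := by
        rw [MvPolynomial.C_mul]; ring
      rw [e1, e2, MvPolynomial.coeff_C_mul, MvPolynomial.coeff_C_mul, MvPolynomial.coeff_mul_X,
        MvPolynomial.coeff_mul_X', if_neg, mul_zero] at h1
      · refine mul_ne_zero (mul_ne_zero (inv_ne_zero (hμ i₀)) ?_) hm h1
        exact_mod_cast hlj
      · rw [Finsupp.mem_support_iff, not_not, Finsupp.add_apply, hm0, Finsupp.single_apply,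
          if_neg hj, add_zero]
    -- All other eigenvalues are on the unit circle, so a monomial free of y_{i₀} has |μ^m| = 1 and
    -- cannot satisfy μ^m = μ_{i₀}.
    · push Not at hex
      have h1 := log_norm_monomialAt hμ m
      rw [hE i₀ m hm, Finset.sum_eq_single i₀ (fun j _ hj => by rw [hex j hj, mul_zero]) (by simp),
        hm0] at h1
      simp at h1
      exact hi₀ (by simpa using h1)
  have h2 := C_mul_X_proportional (X := fun i => MvPolynomial.C (μ i)⁻¹ * E i) h hlog
    (by simp [hE₀0])
  intro i
  exact (mul_eq_zero.1 (congrFun h2 i)).resolve_left (hC i)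


/-! ### No small divisors when the rank is n - 1. -/

/-- The integer exponent vectors `x` with `μ ^ x = 1`. -/
def unitLattice {n : ℕ} {μ : Fin n → ℂ} (hμ : ∀ i, μ i ≠ 0) : AddSubgroup (Fin n → ℤ) where
  carrier := {x | ∏ i, μ i ^ x i = 1}
  zero_mem' := by simp
  add_mem' := by
    intro a b ha hb
    simp only [Set.mem_ofPred_eq] at ha hb ⊢
    simp only [Pi.add_apply, zpow_add₀ (hμ _), Finset.prod_mul_distrib, ha, hb, mul_one]
  neg_mem' := by
    intro a ha
    simp only [Set.mem_ofPred_eq] at ha ⊢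
    simp only [Pi.neg_apply, zpow_neg, Finset.prod_inv_distrib, ha, inv_one]

theorem exists_nsmul_mem_unitLattice {n : ℕ} {μ : Fin n → ℂ} (hμ : ∀ i, μ i ≠ 0)
    {v : Fin n → ℚ} (hv : v ∈ Submodule.span ℚ (ratVec '' resonantSet μ)) :
    ∃ q : ℕ, 0 < q ∧ ∃ x ∈ unitLattice hμ, ∀ i, (q : ℚ) * v i = x i := by
  induction hv using Submodule.span_induction with
  | mem v hv =>
    obtain ⟨m, hm, rfl⟩ := hv
    refine ⟨1, one_pos, fun i => (m i : ℤ), ?_, fun i => by simp [ratVec]⟩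
    change ∏ i, μ i ^ (m i : ℤ) = 1
    simpa [monomialAt] using hm.1
  | zero => exact ⟨1, one_pos, 0, zero_mem _, fun i => by simp⟩
  | add u v _ _ hu hv =>
    obtain ⟨q, hq, x, hx, hxu⟩ := hu
    obtain ⟨r, hr, y, hy, hyv⟩ := hv
    refine ⟨q * r, Nat.mul_pos hq hr, r • x + q • y,
      add_mem (nsmul_mem hx r) (nsmul_mem hy q), fun i => ?_⟩
    simp only [Pi.add_apply, nsmul_eq_mul, Nat.cast_mul, Int.cast_add, Int.cast_mul,
      Int.cast_natCast, Pi.mul_apply, Pi.natCast_apply, ← hxu, ← hyv]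
    ring
  | smul a u _ hu =>
    obtain ⟨q, hq, x, hx, hxu⟩ := hu
    refine ⟨q * a.den, Nat.mul_pos hq a.den_pos, a.num • x, zsmul_mem hx _, fun i => ?_⟩
    simp only [Pi.smul_apply, smul_eq_mul]
    push_cast
    rw [← hxu]
    have := a.mul_den_eq_num
    calc (q : ℚ) * a.den * (a * u i) = (a * a.den) * (q * u i) := by ring
      _ = _ := by rw [this]

/-- The logarithmic form vanishes on the span of the resonances but not on the basis vector `i₀`;
for rank n - 1 that vector and the span therefore generate ℚⁿ. Writing the basis vector `i`
accordingly and clearing denominators gives the relation. -/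
theorem exists_pow_eq_zpow {n : ℕ} {μ : Fin n → ℂ} (hμ : ∀ i, μ i ≠ 0) {i₀ : Fin n}
    (hi₀ : Real.log ‖μ i₀‖ ≠ 0) (hr : resonantRank μ = n - 1) (i : Fin n) :
    ∃ q : ℕ, 0 < q ∧ ∃ b : ℤ, μ i ^ q = μ i₀ ^ b := by
  set V := Submodule.span ℚ (ratVec '' resonantSet μ) with hV
  have hL : ∀ v ∈ V, ∑ i, (v i : ℝ) * Real.log ‖μ i‖ = 0 := by
    intro v hv
    induction hv using Submodule.span_induction with
    | mem v hv =>
      obtain ⟨m, hm, rfl⟩ := hv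
      simpa [ratVec] using sum_mul_log_eq_zero hμ hm.1
    | zero => simp
    | add u v _ _ hu hv => simp [add_mul, Finset.sum_add_distrib, hu, hv]
    | smul a u _ hu => simp [mul_assoc, ← Finset.mul_sum, hu]
  have hnot : (Pi.single i₀ 1 : Fin n → ℚ) ∉ V := by
    intro h
    have h2 := hL _ h
    rw [Finset.sum_eq_single i₀ (fun j _ hj => by simp [hj]) (by simp)] at h2
    exact hi₀ (by simpa using h2)
  have htop : V ⊔ Submodule.span ℚ {(Pi.single i₀ 1 : Fin n → ℚ)} = ⊤ := by
    apply Submodule.eq_top_of_finrank_eq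
    have hlt : V < V ⊔ Submodule.span ℚ {(Pi.single i₀ 1 : Fin n → ℚ)} := by
      refine lt_of_le_of_ne le_sup_left fun h => hnot ?_
      rw [h]
      exact Submodule.mem_sup_right (Submodule.mem_span_singleton_self _)
    have h1 := Submodule.finrank_lt_finrank_of_lt hlt
    have h2 := Submodule.finrank_le (V ⊔ Submodule.span ℚ {(Pi.single i₀ 1 : Fin n → ℚ)})
    have h3 : Module.finrank ℚ V = n - 1 := hr
    have h4 : 0 < n := i₀.pos
    rw [Module.finrank_fin_fun] at h2 ⊢
    omega
  have hmem : (Pi.single i 1 : Fin n → ℚ) ∈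
      V ⊔ Submodule.span ℚ {(Pi.single i₀ 1 : Fin n → ℚ)} := by rw [htop]; trivial
  obtain ⟨v, hv, w, hw, hvw⟩ := Submodule.mem_sup.1 hmem
  obtain ⟨a, rfl⟩ := Submodule.mem_span_singleton.1 hw
  obtain ⟨q, hq, x, hx, hxv⟩ := exists_nsmul_mem_unitLattice hμ hv
  have hx' : ((a.den : ℤ) • x) ∈ unitLattice hμ := zsmul_mem hx _
  have hQ : ∀ j, ((a.den : ℤ) • x) j =
      Pi.single (M := fun _ => ℤ) i (q * a.den : ℤ) j -
        Pi.single (M := fun _ => ℤ) i₀ (q * a.num : ℤ) j := by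
    intro j
    have h1 := congrFun hvw j
    simp only [Pi.add_apply, Pi.smul_apply, smul_eq_mul] at h1
    have h2 : v j = Pi.single (M := fun _ => ℚ) i 1 j - a * Pi.single (M := fun _ => ℚ) i₀ 1 j := by
      rw [← h1]; ring
    have h3 := hxv j
    have h4 := a.mul_den_eq_num
    have : (((((a.den : ℤ) • x) j : ℤ)) : ℚ) = ((Pi.single (M := fun _ => ℤ) i (q * a.den : ℤ) j -
        Pi.single (M := fun _ => ℤ) i₀ (q * a.num : ℤ) j : ℤ) : ℚ) := by
      simp only [Pi.smul_apply, smul_eq_mul]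
      push_cast
      rw [← h3, h2]
      simp only [Pi.single_apply]
      split_ifs <;> push_cast <;> first | ring1 | (rw [← h4]; ring1)
    exact_mod_cast this
  have hprod : ∏ j, μ j ^ (((a.den : ℤ) • x) j) = 1 := hx'
  simp only [hQ, zpow_sub₀ (hμ _), Finset.prod_div_distrib] at hprod
  rw [Finset.prod_eq_single i (fun j _ hj => by simp [hj]) (by simp),
    Finset.prod_eq_single i₀ (fun j _ hj => by simp [hj]) (by simp),
    Pi.single_eq_same, Pi.single_eq_same, div_eq_one_iff_eq (zpow_ne_zero _ (hμ _))] at hprod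
  exact ⟨q * a.den, Nat.mul_pos hq a.den_pos, q * a.num, by rw [← hprod]; norm_cast⟩

theorem exists_monomialAt_pow_eq_zpow {n : ℕ} {μ : Fin n → ℂ} (hμ : ∀ i, μ i ≠ 0) {i₀ : Fin n}
    (hi₀ : Real.log ‖μ i₀‖ ≠ 0) (hr : resonantRank μ = n - 1) :
    ∃ q : ℕ, 0 < q ∧ ∀ m, ∃ b : ℤ, monomialAt μ m ^ q = μ i₀ ^ b := by
  choose q hq b hb using exists_pow_eq_zpow hμ hi₀ hr
  refine ⟨∏ i, q i, Finset.prod_pos fun i _ => hq i, fun m => ?_⟩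
  refine ⟨∑ i, b i * (∏ j ∈ Finset.univ.erase i, q j : ℕ) * m i, ?_⟩
  have hz : ∀ (s : Finset (Fin n)) (f : Fin n → ℤ), μ i₀ ^ (∑ i ∈ s, f i) = ∏ i ∈ s, μ i₀ ^ f i := by
    intro s f
    induction s using Finset.cons_induction with
    | empty => simp
    | cons i s hi ih => rw [Finset.sum_cons, Finset.prod_cons, zpow_add₀ (hμ _), ih]
  rw [hz, monomialAt, ← Finset.prod_pow]
  refine Finset.prod_congr rfl fun i _ => ?_
  rw [zpow_mul, zpow_mul, ← hb, ← Finset.mul_prod_erase Finset.univ q (Finset.mem_univ i),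
    zpow_natCast, zpow_natCast, ← pow_mul, ← pow_mul, ← pow_mul]
  congr 1
  ring

theorem finite_zpow_mem_Icc {ρ a b : ℝ} (hρ : 0 < ρ) (hρ1 : Real.log ρ ≠ 0) (ha : 0 < a) :
    {N : ℤ | a ≤ ρ ^ N ∧ ρ ^ N ≤ b}.Finite := by
  set C := max |Real.log a| |Real.log b| with hC
  refine (Set.finite_Icc (-⌈C / |Real.log ρ|⌉) ⌈C / |Real.log ρ|⌉).subset ?_
  rintro N ⟨h1, h2⟩
  have h3 := Real.log_le_log ha h1
  have h4 := Real.log_le_log (zpow_pos hρ N) h2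
  rw [Real.log_zpow] at h3 h4
  have h5 : |(N : ℝ) * Real.log ρ| ≤ C := by
    rw [abs_le]
    have e1 := le_max_left |Real.log a| |Real.log b|
    have e2 := le_max_right |Real.log a| |Real.log b|
    have e3 := neg_abs_le (Real.log a)
    have e4 := le_abs_self (Real.log b)
    constructor <;> linarith
  rw [abs_mul, ← le_div_iff₀ (abs_pos.2 hρ1)] at h5
  have h6 := h5.trans (Int.le_ceil _)
  rw [abs_le] at h6
  constructor
  · exact_mod_cast h6.1
  · exact_mod_cast h6.2

/-- The absence of small divisors. -/
theorem exists_le_norm_monomialAt_sub {n : ℕ} {μ : Fin n → ℂ} (hμ : ∀ i, μ i ≠ 0) {i₀ : Fin n}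
    (hi₀ : Real.log ‖μ i₀‖ ≠ 0) (hr : resonantRank μ = n - 1) :
    ∃ c : ℝ, 0 < c ∧ ∀ m j, monomialAt μ m ≠ μ j → c ≤ ‖monomialAt μ m - μ j‖ := by
  obtain ⟨q, hq, hb⟩ := exists_monomialAt_pow_eq_zpow hμ hi₀ hr
  have key : ∀ j, ∃ c : ℝ, 0 < c ∧ ∀ m, monomialAt μ m ≠ μ j → c ≤ ‖monomialAt μ m - μ j‖ := by
    intro j
    have hj : 0 < ‖μ j‖ := norm_pos_iff.2 (hμ j)
    -- Only values of μ^m with modulus between half and twice |μ_j| can come close to μ_j. Their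
    -- `q`-th powers are among finitely many powers of μ_{i₀}, so these values form a finite set.
    set S := {N : ℤ | (‖μ j‖ / 2) ^ q ≤ ‖μ i₀‖ ^ N ∧ ‖μ i₀‖ ^ N ≤ (2 * ‖μ j‖) ^ q} with hS
    have hSf : S.Finite :=
      finite_zpow_mem_Icc (norm_pos_iff.2 (hμ i₀)) hi₀ (pow_pos (half_pos hj) q)
    set X : Set ℂ := ⋃ N ∈ S, {z | z ^ q = μ i₀ ^ N} with hX
    have hXf : X.Finite := by
      refine hSf.biUnion fun N _ => ?_
      have : {z : ℂ | z ^ q = μ i₀ ^ N} ⊆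
          ((Polynomial.nthRoots q (μ i₀ ^ N)).toFinset : Set ℂ) := by
        intro z hz
        simpa [Polynomial.mem_nthRoots hq] using hz
      exact (Finset.finite_toSet _).subset this
    have hcl : IsClosed (X \ {μ j}) := (hXf.subset Set.sdiff_subset).isClosed
    have hnh : (X \ {μ j})ᶜ ∈ 𝓝 (μ j) := hcl.isOpen_compl.mem_nhds (by simp)
    obtain ⟨c, hc, hball⟩ := Metric.mem_nhds_iff.1 hnh
    refine ⟨min c (‖μ j‖ / 2), lt_min hc (half_pos hj), fun m hm => ?_⟩
    by_contra! hlt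
    have h1 := hlt.trans_le (min_le_left _ _)
    have h2 := hlt.trans_le (min_le_right _ _)
    have h3 : monomialAt μ m ∈ (X \ {μ j})ᶜ := hball (by rwa [mem_ball_iff_norm])
    apply h3
    refine ⟨?_, hm⟩
    obtain ⟨b, hb⟩ := hb m
    have h4 : ‖μ j‖ / 2 ≤ ‖monomialAt μ m‖ := by
      have := norm_sub_norm_le (μ j) (monomialAt μ m)
      rw [norm_sub_rev] at this
      linarith
    have h5 : ‖monomialAt μ m‖ ≤ 2 * ‖μ j‖ := by
      have := norm_sub_norm_le (monomialAt μ m) (μ j)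
      linarith
    rw [hX, Set.mem_iUnion₂]
    refine ⟨b, ?_, hb⟩
    have h6 : ‖μ i₀‖ ^ b = ‖monomialAt μ m‖ ^ q := by rw [← norm_zpow, ← hb, norm_pow]
    rw [hS, Set.mem_ofPred_eq, h6]
    exact ⟨pow_le_pow_left₀ (half_pos hj).le h4 q, pow_le_pow_left₀ (norm_nonneg _) h5 q⟩
  choose c hc hcm using key
  have hne : (Finset.univ : Finset (Fin n)).Nonempty := ⟨i₀, Finset.mem_univ _⟩
  refine ⟨Finset.univ.inf' hne c, (Finset.lt_inf'_iff hne).2 fun j _ => hc j, fun m j hm => ?_⟩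
  exact (Finset.inf'_le c (Finset.mem_univ j)).trans (hcm j m hm)


/-! ### The Banach algebra of absolutely summable power series. -/

section Antidiagonal

variable {A : Type*} [AddCommMonoid A] [Finset.HasAntidiagonal A] {f g : A → ℂ}

theorem summable_norm_sum_antidiagonal (hf : Summable fun m => ‖f m‖)
    (hg : Summable fun m => ‖g m‖) :
    Summable (fun m => ‖∑ kl ∈ Finset.HasAntidiagonal.antidiagonal m, f kl.1 * g kl.2‖) ∧
      ∑' m, ‖∑ kl ∈ Finset.HasAntidiagonal.antidiagonal m, f kl.1 * g kl.2‖ ≤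
        (∑' m, ‖f m‖) * ∑' m, ‖g m‖ := by
  have hfg : Summable fun x : A × A => ‖f x.1‖ * ‖g x.2‖ :=
    hf.mul_of_nonneg hg (fun _ => norm_nonneg _) fun _ => norm_nonneg _
  have hs := summable_sum_mul_antidiagonal_of_summable_mul (f := fun m => ‖f m‖)
    (g := fun m => ‖g m‖) hfg
  have hle : ∀ m, ‖∑ kl ∈ Finset.HasAntidiagonal.antidiagonal m, f kl.1 * g kl.2‖ ≤
      ∑ kl ∈ Finset.HasAntidiagonal.antidiagonal m, ‖f kl.1‖ * ‖g kl.2‖ := fun m =>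
    (norm_sum_le _ _).trans_eq (Finset.sum_congr rfl fun _ _ => norm_mul _ _)
  have h1 := Summable.of_nonneg_of_le (fun _ => norm_nonneg _) hle hs
  have h2 := hf.tsum_mul_tsum_eq_tsum_sum_antidiagonal hg hfg
  exact ⟨h1, (Summable.tsum_le_tsum hle h1 hs).trans_eq h2.symm⟩

theorem tsum_mul_tsum_eq_tsum_antidiagonal_of_norm (hf : Summable fun m => ‖f m‖)
    (hg : Summable fun m => ‖g m‖) :
    (∑' m, f m) * ∑' m, g m =
      ∑' m, ∑ kl ∈ Finset.HasAntidiagonal.antidiagonal m, f kl.1 * g kl.2 :=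
  hf.of_norm.tsum_mul_tsum_eq_tsum_sum_antidiagonal hg.of_norm (summable_mul_of_summable_norm hf hg)

end Antidiagonal

theorem MvPowerSeries.summable_norm_coeff_mul {σ : Type*} {f g : MvPowerSeries σ ℂ}
    (hf : Summable fun m => ‖MvPowerSeries.coeff m f‖)
    (hg : Summable fun m => ‖MvPowerSeries.coeff m g‖) :
    Summable (fun m => ‖MvPowerSeries.coeff m (f * g)‖) ∧
      ∑' m, ‖MvPowerSeries.coeff m (f * g)‖ ≤
        (∑' m, ‖MvPowerSeries.coeff m f‖) * ∑' m, ‖MvPowerSeries.coeff m g‖ := by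
  classical
  simp only [MvPowerSeries.coeff_mul]
  exact summable_norm_sum_antidiagonal hf hg

/-- The algebra of absolutely summable power series. -/
def ellOne (n : ℕ) : Subalgebra ℂ (MvPowerSeries (Fin n) ℂ) where
  carrier := {f | Summable fun m => ‖MvPowerSeries.coeff m f‖}
  mul_mem' hf hg := (MvPowerSeries.summable_norm_coeff_mul hf hg).1
  add_mem' {f g} hf hg := by
    simp only [Set.mem_ofPred_eq] at hf hg ⊢
    exact Summable.of_nonneg_of_le (fun _ => norm_nonneg _)
      (fun m => by rw [map_add]; exact norm_add_le _ _) (hf.add hg)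
  algebraMap_mem' r := by
    classical
    refine summable_of_ne_finset_zero (s := {0}) fun m hm => ?_
    rw [Finset.mem_singleton] at hm
    rw [MvPowerSeries.algebraMap_apply, MvPowerSeries.coeff_C, if_neg hm, norm_zero]

namespace ellOne

variable {n : ℕ}

/-- The coefficient of `y ^ m`. -/
noncomputable def coeff (m : Fin n →₀ ℕ) : ellOne n →ₗ[ℂ] ℂ :=
  (MvPowerSeries.coeff m).comp (ellOne n).val.toLinearMap

theorem summable_norm (f : ellOne n) : Summable fun m => ‖coeff m f‖ := f.2

/-- The element with given summable coefficients. -/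
def mk (f : (Fin n →₀ ℕ) → ℂ) (hf : Summable fun m => ‖f m‖) : ellOne n := ⟨f, hf⟩

@[simp] theorem coeff_mk (f : (Fin n →₀ ℕ) → ℂ) (hf) (m) : coeff m (mk f hf) = f m := rfl

theorem ext {f g : ellOne n} (h : ∀ m, coeff m f = coeff m g) : f = g :=
  Subtype.ext (MvPowerSeries.ext h)

theorem coeff_mul (f g : ellOne n) (m : Fin n →₀ ℕ) [DecidableEq (Fin n)] :
    coeff m (f * g) = ∑ kl ∈ Finset.HasAntidiagonal.antidiagonal m, coeff kl.1 f * coeff kl.2 g :=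
  MvPowerSeries.coeff_mul _ _ _

theorem coeff_algebraMap [DecidableEq (Fin n)] (r : ℂ) (m : Fin n →₀ ℕ) :
    coeff m (algebraMap ℂ (ellOne n) r) = if m = 0 then r else 0 := by
  change MvPowerSeries.coeff m (algebraMap ℂ (MvPowerSeries (Fin n) ℂ) r) = _
  rw [MvPowerSeries.algebraMap_apply, MvPowerSeries.coeff_C]
  rfl

noncomputable instance : NormedCommRing (ellOne n) :=
  let N : AddGroupNorm (ellOne n) :=
    { toFun := fun f => ∑' m, ‖coeff m f‖
      map_zero' := by simp
      add_le' := fun f g => by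
        rw [← (summable_norm f).tsum_add (summable_norm g)]
        refine (summable_norm (f + g)).tsum_le_tsum (fun m => ?_)
          ((summable_norm f).add (summable_norm g))
        rw [map_add]
        exact norm_add_le _ _
      neg' := fun f => by simp
      eq_zero_of_map_eq_zero' := fun f hf => by
        refine ext fun m => ?_
        have h := (summable_norm f).le_tsum m fun _ _ => norm_nonneg _
        rw [hf] at h
        rw [map_zero]
        exact norm_le_zero_iff.1 h }
  { N.toNormedAddCommGroup, (inferInstance : CommRing (ellOne n)) with
    norm_mul_le := fun f g => (MvPowerSeries.summable_norm_coeff_mul f.2 g.2).2 }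

theorem norm_def (f : ellOne n) : ‖f‖ = ∑' m, ‖coeff m f‖ := rfl

theorem hasSum_norm (f : ellOne n) : HasSum (fun m => ‖coeff m f‖) ‖f‖ := (summable_norm f).hasSum

theorem norm_coeff_le (m : Fin n →₀ ℕ) (f : ellOne n) : ‖coeff m f‖ ≤ ‖f‖ :=
  (summable_norm f).le_tsum m fun _ _ => norm_nonneg _

noncomputable instance : NormedAlgebra ℂ (ellOne n) where
  norm_smul_le r f := by
    rw [norm_def, norm_def, ← tsum_mul_left]
    refine le_of_eq (tsum_congr fun m => ?_)
    rw [map_smul, norm_smul]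

instance : NormOneClass (ellOne n) where
  norm_one := by
    classical
    rw [norm_def, tsum_eq_single 0]
    · rw [← map_one (algebraMap ℂ (ellOne n)), coeff_algebraMap]; simp
    · intro m hm
      rw [← map_one (algebraMap ℂ (ellOne n)), coeff_algebraMap, if_neg hm, norm_zero]

theorem mk_le {f : (Fin n →₀ ℕ) → ℂ} (hf) {b : (Fin n →₀ ℕ) → ℝ} {C : ℝ} (hb : HasSum b C)
    (h : ∀ m, ‖f m‖ ≤ b m) : ‖mk f hf‖ ≤ C := by
  rw [norm_def]
  exact (summable_norm (mk f hf)).tsum_le_of_sum_le fun s =>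
    (Finset.sum_le_sum fun m _ => h m).trans
      (sum_le_hasSum s (fun m _ => (norm_nonneg _).trans (h m)) hb)

/-- Absolutely summable power series are the space `ℓ¹`. -/
noncomputable def toLp : ellOne n ≃ᵢ lp (fun _ : Fin n →₀ ℕ => ℂ) 1 where
  toFun f := ⟨fun m => coeff m f, memℓp_gen (by simpa using summable_norm f)⟩
  invFun g := mk g (by simpa using (lp.memℓp g).summable (by simp))
  left_inv f := ext fun m => rfl
  right_inv g := rfl
  isometry_toFun := by
    refine Isometry.of_dist_eq fun f g => ?_
    rw [dist_eq_norm, dist_eq_norm, lp.norm_eq_tsum_rpow (by simp), norm_def]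
    simp only [ENNReal.toReal_one, Real.rpow_one, div_one, map_sub, lp.coeFn_sub, Pi.sub_apply]

instance : CompleteSpace (ellOne n) := (toLp (n := n)).completeSpace

/-- The coefficient functional. -/
noncomputable def coeffL (m : Fin n →₀ ℕ) : ellOne n →L[ℂ] ℂ :=
  (coeff m).mkContinuous 1 fun f => by rw [one_mul]; exact norm_coeff_le m f

@[simp] theorem coeffL_apply (m : Fin n →₀ ℕ) (f : ellOne n) : coeffL m f = coeff m f := rfl

/-- The coordinate functions. -/
noncomputable def var (i : Fin n) : ellOne n :=
  ⟨MvPowerSeries.X i, by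
    classical
    refine summable_of_ne_finset_zero (s := {Finsupp.single i 1}) fun m hm => ?_
    rw [Finset.mem_singleton] at hm
    rw [MvPowerSeries.coeff_X, if_neg hm, norm_zero]⟩

theorem coeff_var [DecidableEq (Fin n)] (i : Fin n) (m : Fin n →₀ ℕ) :
    coeff m (var i) = if m = Finsupp.single i 1 then 1 else 0 := by
  change MvPowerSeries.coeff m (MvPowerSeries.X i) = _
  rw [MvPowerSeries.coeff_X]

theorem norm_var (i : Fin n) : ‖var i‖ = 1 := by
  classical
  rw [norm_def, tsum_eq_single (Finsupp.single i 1)]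
  · simp [coeff_var]
  · intro m hm
    rw [coeff_var, if_neg hm, norm_zero]

theorem coeff_var_mul (i : Fin n) (f : ellOne n) (m : Fin n →₀ ℕ) :
    coeff (m + Finsupp.single i 1) (var i * f) = coeff m f := by
  have := MvPowerSeries.coeff_add_monomial_mul (Finsupp.single i 1) m f.1 (1 : ℂ)
  rw [one_mul, add_comm] at this
  exact this

/-- Evaluation at a point of the closed unit polydisc. -/
noncomputable def eval (y : Fin n → ℂ) (hy : ‖y‖ ≤ 1) : ellOne n →ₐ[ℂ] ℂ :=
  have hs : ∀ f : ellOne n, Summable fun m => ‖coeff m f * monomialAt y m‖ := fun f =>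
    Summable.of_nonneg_of_le (fun _ => norm_nonneg _) (fun m => by
      rw [norm_mul]
      exact mul_le_of_le_one_right (norm_nonneg _)
        ((norm_monomialAt_le hy m).trans_eq (one_pow _))) (summable_norm f)
  { toFun := fun f => ∑' m, coeff m f * monomialAt y m
    map_one' := by
      classical
      rw [← map_one (algebraMap ℂ (ellOne n)), tsum_eq_single 0]
      · rw [coeff_algebraMap]; simp [monomialAt_zero]
      · intro m hm
        rw [coeff_algebraMap, if_neg hm, zero_mul]
    map_zero' := by simp
    map_add' := fun f g => by
      rw [← (hs f).of_norm.tsum_add (hs g).of_norm]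
      refine tsum_congr fun m => ?_
      rw [map_add, add_mul]
    map_mul' := fun f g => by
      classical
      rw [tsum_mul_tsum_eq_tsum_antidiagonal_of_norm (hs f) (hs g)]
      refine tsum_congr fun m => ?_
      rw [coeff_mul, Finset.sum_mul]
      refine Finset.sum_congr rfl fun kl hkl => ?_
      rw [← Finset.HasAntidiagonal.mem_antidiagonal.1 hkl, monomialAt_add]
      ring
    commutes' := fun r => by
      classical
      rw [tsum_eq_single 0]
      · rw [coeff_algebraMap]; simp [monomialAt_zero]
      · intro m hm
        rw [coeff_algebraMap, if_neg hm, zero_mul] }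

theorem hasSum_eval (y : Fin n → ℂ) (hy : ‖y‖ ≤ 1) (f : ellOne n) :
    HasSum (fun m => coeff m f * monomialAt y m) (eval y hy f) := by
  have hs : Summable fun m => ‖coeff m f * monomialAt y m‖ :=
    Summable.of_nonneg_of_le (fun _ => norm_nonneg _) (fun m => by
      rw [norm_mul]
      exact mul_le_of_le_one_right (norm_nonneg _)
        ((norm_monomialAt_le hy m).trans_eq (one_pow _))) (summable_norm f)
  exact hs.of_norm.hasSum

theorem norm_eval_le (y : Fin n → ℂ) (hy : ‖y‖ ≤ 1) (f : ellOne n) : ‖eval y hy f‖ ≤ ‖f‖ := by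
  rw [← (hasSum_eval y hy f).tsum_eq]
  refine tsum_of_norm_bounded (hasSum_norm f) fun m => ?_
  rw [norm_mul]
  exact mul_le_of_le_one_right (norm_nonneg _)
    ((norm_monomialAt_le hy m).trans_eq (one_pow _))

theorem continuous_eval (y : Fin n → ℂ) (hy : ‖y‖ ≤ 1) : Continuous (eval y hy) :=
  AddMonoidHomClass.continuous_of_bound (eval y hy) 1 fun f => by
    rw [one_mul]; exact norm_eval_le y hy f

theorem eval_var (y : Fin n → ℂ) (hy : ‖y‖ ≤ 1) (i : Fin n) : eval y hy (var i) = y i := by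
  classical
  refine (hasSum_eval y hy (var i)).unique ?_
  convert hasSum_single (Finsupp.single i 1) fun m hm => ?_ using 1
  · rw [coeff_var, if_pos rfl, monomialAt_single]; simp
  · rw [coeff_var, if_neg hm, zero_mul]

/-- The power series whose monomials lie in `S`. -/
def supported (S : Set (Fin n →₀ ℕ)) : Submodule ℂ (ellOne n) where
  carrier := {f | ∀ m, m ∉ S → coeff m f = 0}
  zero_mem' := fun m _ => map_zero _
  add_mem' := fun hf hg m hm => by rw [map_add, hf m hm, hg m hm, add_zero]
  smul_mem' := fun c f hf m hm => by rw [map_smul, hf m hm, smul_zero]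

theorem mem_supported {S : Set (Fin n →₀ ℕ)} {f : ellOne n} :
    f ∈ supported S ↔ ∀ m, m ∉ S → coeff m f = 0 := Iff.rfl

/-- Closedness lets constraints on monomials pass to series, exponentials, inverses and fixed
points. -/
theorem isClosed_supported (S : Set (Fin n →₀ ℕ)) : IsClosed (supported S : Set (ellOne n)) := by
  have : (supported S : Set (ellOne n)) = ⋂ m, ⋂ _ : m ∉ S, {f | coeffL m f = 0} := by
    ext f
    simp [mem_supported]
  rw [this]
  exact isClosed_iInter fun m => isClosed_iInter fun _ =>
    isClosed_eq (coeffL m).continuous continuous_const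

theorem mul_mem_supported {S T U : Set (Fin n →₀ ℕ)} (h : ∀ a ∈ S, ∀ b ∈ T, a + b ∈ U)
    {f g : ellOne n} (hf : f ∈ supported S) (hg : g ∈ supported T) : f * g ∈ supported U := by
  classical
  intro m hm
  rw [coeff_mul]
  refine Finset.sum_eq_zero fun kl hkl => ?_
  by_cases h1 : kl.1 ∈ S
  · by_cases h2 : kl.2 ∈ T
    · exact absurd (Finset.HasAntidiagonal.mem_antidiagonal.1 hkl ▸ h _ h1 _ h2) hm
    · rw [hg _ h2, mul_zero]
  · rw [hf _ h1, zero_mul]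

theorem algebraMap_mem_supported {S : Set (Fin n →₀ ℕ)} (h : 0 ∈ S) (r : ℂ) :
    algebraMap ℂ (ellOne n) r ∈ supported S := by
  classical
  intro m hm
  rw [coeff_algebraMap, if_neg]
  rintro rfl
  exact hm h

theorem var_mem_supported {S : Set (Fin n →₀ ℕ)} {i : Fin n} (h : Finsupp.single i 1 ∈ S) :
    var i ∈ supported S := by
  classical
  intro m hm
  rw [coeff_var, if_neg]
  rintro rfl
  exact hm h

theorem supported_mono {S T : Set (Fin n →₀ ℕ)} (h : S ⊆ T) : supported S ≤ supported T :=
  fun _ hf m hm => hf m fun hS => hm (h hS)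

/-- The power series whose monomials lie in an additive submonoid. -/
def supportedAlg (S : AddSubmonoid (Fin n →₀ ℕ)) : Subalgebra ℂ (ellOne n) where
  carrier := supported (S : Set (Fin n →₀ ℕ))
  mul_mem' := mul_mem_supported fun _ ha _ hb => S.add_mem ha hb
  add_mem' := add_mem
  algebraMap_mem' := algebraMap_mem_supported S.zero_mem

theorem isClosed_supportedAlg (S : AddSubmonoid (Fin n →₀ ℕ)) :
    IsClosed (supportedAlg S : Set (ellOne n)) := isClosed_supported _

/-- The projection onto the monomials in `S`. -/
noncomputable def proj (S : Set (Fin n →₀ ℕ)) (f : ellOne n) : ellOne n :=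
  mk (S.indicator fun m => coeff m f) (Summable.of_nonneg_of_le (fun _ => norm_nonneg _)
    (fun _ => norm_indicator_le_norm_self _ _) (summable_norm f))

theorem coeff_proj (S : Set (Fin n →₀ ℕ)) (f : ellOne n) (m : Fin n →₀ ℕ) :
    coeff m (proj S f) = S.indicator (fun m => coeff m f) m := rfl

theorem tsum_mem_supported {S : Set (Fin n →₀ ℕ)} {ι : Type*} {f : ι → ellOne n}
    (hf : ∀ i, f i ∈ supported S) : ∑' i, f i ∈ supported S := by
  by_cases h : Summable f
  · exact (isClosed_supported S).mem_of_tendsto h.hasSum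
      (Eventually.of_forall fun s => sum_mem fun i _ => hf i)
  · rw [tsum_eq_zero_of_not_summable h]
    exact zero_mem _

end ellOne


/-! ### Exponentials and resolvents in a commutative Banach algebra. -/

theorem inverse_eq_of_mul_eq_one {R : Type*} [CommRing R] {u w : R} (h : u * w = 1) : Ring.inverse u = w := by
  have hu : IsUnit u := IsUnit.of_mul_eq_one w h
  calc Ring.inverse u = Ring.inverse u * (u * w) := by rw [h, mul_one]
    _ = w := by rw [← mul_assoc, Ring.inverse_mul_cancel u hu, one_mul]

section BanachExp

variable {A : Type*} [NormedCommRing A] [NormedAlgebra ℂ A]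

theorem banachExp_mem {S : Subalgebra ℂ A} (hS : IsClosed (S : Set A)) {x : A} (hx : x ∈ S) :
    NormedSpace.exp x ∈ S := by
  rw [NormedSpace.exp_eq_tsum ℂ]
  exact tsum_mem hS fun k => S.smul_mem (pow_mem hx k) _

theorem norm_pow_div_factorial [NormOneClass A] (x : A) (k : ℕ) :
    ‖((k.factorial : ℂ)⁻¹) • x ^ k‖ ≤ ‖x‖ ^ k / k.factorial := by
  rw [norm_smul, norm_inv, Complex.norm_natCast, div_eq_inv_mul]
  gcongr
  exact norm_pow_le x k

theorem norm_smul_le_of_le {w ε : ℝ} {h : A} (hh : ‖h‖ ≤ ε) : ‖(w : ℂ) • h‖ ≤ |w| * ε := by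
  rw [norm_smul, Complex.norm_real, Real.norm_eq_abs]
  gcongr

theorem norm_banachExp_le [NormOneClass A] (x : A) : ‖NormedSpace.exp x‖ ≤ Real.exp ‖x‖ := by
  rw [NormedSpace.exp_eq_tsum ℂ]
  have h := NormedSpace.expSeries_div_hasSum_exp ‖x‖
  rw [← Real.exp_eq_exp_ℝ] at h
  exact tsum_of_norm_bounded h fun k => norm_pow_div_factorial x k

variable [CompleteSpace A]

theorem banachExp_add (x y : A) :
    NormedSpace.exp (x + y) = NormedSpace.exp x * NormedSpace.exp y := by
  let _ : NormedAlgebra ℚ A := NormedAlgebra.restrictScalars ℚ ℂ A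
  exact NormedSpace.exp_add

theorem banachExp_mul_neg (x : A) : NormedSpace.exp x * NormedSpace.exp (-x) = 1 := by
  rw [← banachExp_add, add_neg_cancel, NormedSpace.exp_zero]

theorem map_banachExp (f : A →ₐ[ℂ] ℂ) (hf : Continuous f) (x : A) :
    f (NormedSpace.exp x) = Complex.exp (f x) := by
  let _ : NormedAlgebra ℚ A := NormedAlgebra.restrictScalars ℚ ℂ A
  rw [NormedSpace.map_exp f hf, Complex.exp_eq_exp_ℂ]

theorem norm_banachExp_sub_one_le [NormOneClass A] (x : A) :
    ‖NormedSpace.exp x - 1‖ ≤ ‖x‖ * Real.exp ‖x‖ := by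
  have h := NormedSpace.expSeries_div_hasSum_exp ‖x‖
  rw [← Real.exp_eq_exp_ℝ] at h
  have h1 : HasSum (fun k : ℕ => ‖x‖ ^ (k + 1) / (k + 1).factorial) (Real.exp ‖x‖ - 1) := by
    have := (hasSum_nat_add_iff' 1).2 h
    simpa using this
  have h2 : HasSum (fun k : ℕ => (((k + 1).factorial : ℂ)⁻¹) • x ^ (k + 1))
      (NormedSpace.exp x - 1) := by
    have := (hasSum_nat_add_iff' 1).2 (NormedSpace.exp_series_hasSum_exp' (𝕂 := ℂ) x)
    simpa using this
  have h3 : ‖NormedSpace.exp x - 1‖ ≤ Real.exp ‖x‖ - 1 := by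
    rw [← h2.tsum_eq]
    exact tsum_of_norm_bounded h1 fun k => norm_pow_div_factorial x (k + 1)
  have h4 := Real.add_one_le_exp (-‖x‖)
  have h5 : Real.exp (-‖x‖) * Real.exp ‖x‖ = 1 := by rw [← Real.exp_add]; simp
  nlinarith [Real.exp_pos ‖x‖]

theorem norm_banachExp_sub_le [NormOneClass A] (x y : A) :
    ‖NormedSpace.exp x - NormedSpace.exp y‖ ≤ ‖x - y‖ * Real.exp (‖y‖ + ‖x - y‖) := by
  have h : NormedSpace.exp x - NormedSpace.exp y =
      NormedSpace.exp y * (NormedSpace.exp (x - y) - 1) := by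
    rw [mul_sub, ← banachExp_add, add_sub_cancel, mul_one]
  rw [h, Real.exp_add]
  calc _ ≤ ‖NormedSpace.exp y‖ * ‖NormedSpace.exp (x - y) - 1‖ := norm_mul_le _ _
    _ ≤ Real.exp ‖y‖ * (‖x - y‖ * Real.exp ‖x - y‖) := by
        gcongr
        · exact norm_banachExp_le y
        · exact norm_banachExp_sub_one_le _
    _ = _ := by ring

/-- Strict differentiability of the exponential at zero makes its nonlinear part Lipschitz with a
constant as small as desired near zero. -/
theorem exists_norm_banachExp_sub_sub_le (A : Type*) [NormedCommRing A] [NormedAlgebra ℂ A]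
    [CompleteSpace A] {δ : ℝ} (hδ : 0 < δ) :
    ∃ ε > 0, ∀ x y : A, ‖x‖ ≤ ε → ‖y‖ ≤ ε →
      ‖(NormedSpace.exp x - 1 - x) - (NormedSpace.exp y - 1 - y)‖ ≤ δ * ‖x - y‖ := by
  have h := (hasStrictFDerivAt_exp_zero (𝕂 := ℂ) (𝔸 := A)).isLittleO
  have h1 := h.def hδ
  obtain ⟨ε, hε, hball⟩ := Metric.eventually_nhds_iff.1 h1
  refine ⟨ε / 2, half_pos hε, fun x y hx hy => ?_⟩
  have h2 := hball (y := (x, y)) (by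
    rw [dist_eq_norm, Prod.norm_def]
    simp only [Prod.fst_sub, Prod.snd_sub, sub_zero]
    exact max_lt (by linarith) (by linarith))
  simp only [one_apply_eq_self] at h2
  rw [show (NormedSpace.exp x - 1 - x) - (NormedSpace.exp y - 1 - y) =
    NormedSpace.exp x - NormedSpace.exp y - (x - y) by abel]
  exact h2

/-- Neumann series. The clause on closed subalgebras is what later keeps the multipliers supported
on monomials with μ^m = 1. -/
theorem inverse_mul_one_sub [NormOneClass A] {v v' z : A} {β : ℝ} (hv : v * v' = 1)
    (hβ : ‖v'‖ ≤ β) (hz : ‖z‖ ≤ 1 / 2) :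
    IsUnit (v * (1 - z)) ∧ ‖Ring.inverse (v * (1 - z))‖ ≤ 2 * β ∧
      ∀ S : Subalgebra ℂ A, IsClosed (S : Set A) → v' ∈ S → z ∈ S →
        Ring.inverse (v * (1 - z)) ∈ S := by
  have hz1 : ‖z‖ < 1 := hz.trans_lt (by norm_num)
  have h1 : v * (1 - z) * (v' * ∑' k : ℕ, z ^ k) = 1 := by
    calc _ = (v * v') * ((1 - z) * ∑' k : ℕ, z ^ k) := by ring
      _ = 1 := by rw [hv, mul_neg_geom_series z hz1, one_mul]
  refine ⟨IsUnit.of_mul_eq_one _ h1, ?_, fun S hS hv' hzS => ?_⟩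
  · have hβ0 : 0 ≤ β := (norm_nonneg _).trans hβ
    rw [inverse_eq_of_mul_eq_one h1]
    have h2 := tsum_geometric_le_of_norm_lt_one z hz1
    have h3 : (1 - ‖z‖)⁻¹ ≤ 2 := by
      rw [inv_le_comm₀ (by linarith) (by norm_num)]
      linarith
    rw [norm_one] at h2
    calc _ ≤ ‖v'‖ * ‖∑' k : ℕ, z ^ k‖ := norm_mul_le _ _
      _ ≤ β * 2 := by gcongr; linarith
      _ = _ := mul_comm _ _
  · rw [inverse_eq_of_mul_eq_one h1]
    exact S.mul_mem hv' (tsum_mem hS fun k => pow_mem hzS k)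

/-- The inverse of `χ e ^ {w h} - μ`. -/
noncomputable def expResolvent (χ μ : ℂ) (w : ℝ) (h : A) : A :=
  Ring.inverse (algebraMap ℂ A χ * NormedSpace.exp ((w : ℂ) • h) - algebraMap ℂ A μ)

theorem mul_exp_neg_le {a t : ℝ} (ha : 0 < a) : t * Real.exp (-(a * t)) ≤ 1 / a := by
  have h1 := Real.add_one_le_exp (a * t)
  have h2 : Real.exp (-(a * t)) * Real.exp (a * t) = 1 := by rw [← Real.exp_add]; simp
  have h3 := Real.exp_pos (-(a * t))
  rw [le_div_iff₀ ha]
  nlinarith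

/-- Here χ e^{wh} dominates and is factored out: its inverse has norm at most e^{-w + w/12}. The
decay e^{-3w/4} is more than e^{-w/2} because the Lipschitz estimate multiplies the square of the
resolvent by e^w. -/
theorem expResolvent_large [NormOneClass A] {χ μ : ℂ} {w : ℝ} (hχ : ‖χ‖ = Real.exp w)
    (hw0 : 0 ≤ w) (hw : 2 * ‖μ‖ ≤ Real.exp (w / 2)) {h : A} (hh : ‖h‖ ≤ 1 / 12) :
    IsUnit (algebraMap ℂ A χ * NormedSpace.exp ((w : ℂ) • h) - algebraMap ℂ A μ) ∧
      ‖expResolvent χ μ w h‖ ≤ 2 * Real.exp (-(3 / 4 * w)) ∧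
      ∀ S : Subalgebra ℂ A, IsClosed (S : Set A) → h ∈ S → expResolvent χ μ w h ∈ S := by
  have hχ0 : χ ≠ 0 := by rw [← norm_pos_iff, hχ]; exact Real.exp_pos w
  set x : A := (w : ℂ) • h with hx
  have hxn : ‖x‖ ≤ w / 12 := by
    have := norm_smul_le_of_le (w := w) hh
    rw [abs_of_nonneg hw0] at this
    linarith
  have he : ‖NormedSpace.exp (-x)‖ ≤ Real.exp (w / 12) :=
    (norm_banachExp_le _).trans (by rw [norm_neg]; exact Real.exp_le_exp.2 hxn)
  set v : A := algebraMap ℂ A χ * NormedSpace.exp x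
  set v' : A := algebraMap ℂ A χ⁻¹ * NormedSpace.exp (-x)
  have hv : v * v' = 1 := by
    calc v * v' = algebraMap ℂ A (χ * χ⁻¹) * (NormedSpace.exp x * NormedSpace.exp (-x)) := by
          rw [map_mul]; ring
      _ = 1 := by rw [mul_inv_cancel₀ hχ0, banachExp_mul_neg, map_one, one_mul]
  have hv'n : ‖v'‖ ≤ Real.exp (-w) * Real.exp (w / 12) := by
    refine (norm_mul_le _ _).trans ?_
    rw [norm_algebraMap', norm_inv, hχ, ← Real.exp_neg]
    gcongr
  have hβ : ‖v'‖ ≤ Real.exp (-(3 / 4 * w)) := by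
    refine hv'n.trans ?_
    rw [← Real.exp_add]
    exact Real.exp_le_exp.2 (by linarith)
  have hz : ‖algebraMap ℂ A μ * v'‖ ≤ 1 / 2 := by
    have h1 : ‖v'‖ ≤ Real.exp (-(w / 2)) := by
      refine hv'n.trans ?_
      rw [← Real.exp_add]
      exact Real.exp_le_exp.2 (by linarith)
    have h2 : Real.exp (-(w / 2)) * Real.exp (w / 2) = 1 := by rw [← Real.exp_add]; simp
    calc _ ≤ ‖μ‖ * ‖v'‖ := by rw [← norm_algebraMap' A μ]; exact norm_mul_le _ _
      _ ≤ ‖μ‖ * Real.exp (-(w / 2)) := by gcongr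
      _ ≤ 1 / 2 := by nlinarith [Real.exp_pos (-(w / 2))]
  have hu : v - algebraMap ℂ A μ = v * (1 - algebraMap ℂ A μ * v') := by
    linear_combination algebraMap ℂ A μ * hv
  obtain ⟨h1, h2, h3⟩ := inverse_mul_one_sub hv hβ hz
  rw [← hu] at h1 h2 h3
  refine ⟨h1, h2, fun S hS hhS => ?_⟩
  have hv'S : v' ∈ S := S.mul_mem (S.algebraMap_mem _)
    (banachExp_mem hS (neg_mem (S.smul_mem hhS _)))
  exact h3 S hS hv'S (S.mul_mem (S.algebraMap_mem _) hv'S)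

/-- Here χ e^{wh} is small and the constant -μ is factored out. -/
theorem expResolvent_small [NormOneClass A] {χ μ : ℂ} (hμ : μ ≠ 0) {w : ℝ}
    (hχ : ‖χ‖ = Real.exp w) (hw0 : w ≤ 0) (hw : Real.exp (w / 2) ≤ ‖μ‖ / 2) {h : A}
    (hh : ‖h‖ ≤ 1 / 12) :
    IsUnit (algebraMap ℂ A χ * NormedSpace.exp ((w : ℂ) • h) - algebraMap ℂ A μ) ∧
      ‖expResolvent χ μ w h‖ ≤ 2 * ‖μ‖⁻¹ ∧
      ∀ S : Subalgebra ℂ A, IsClosed (S : Set A) → h ∈ S → expResolvent χ μ w h ∈ S := by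
  have hμ0 : 0 < ‖μ‖ := norm_pos_iff.2 hμ
  set x : A := (w : ℂ) • h with hx
  have hxn : ‖x‖ ≤ -w / 12 := by
    have := norm_smul_le_of_le (w := w) hh
    rw [abs_of_nonpos hw0] at this
    linarith
  set v : A := algebraMap ℂ A (-μ)
  set v' : A := algebraMap ℂ A (-μ)⁻¹
  set e : A := algebraMap ℂ A χ * NormedSpace.exp x with he
  have hv : v * v' = 1 := by
    rw [← map_mul, mul_inv_cancel₀ (neg_ne_zero.2 hμ), map_one]
  have hβ : ‖v'‖ ≤ ‖μ‖⁻¹ := by rw [norm_algebraMap', norm_inv, norm_neg]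
  have hen : ‖e‖ ≤ Real.exp (w / 2) := by
    have h1 : ‖NormedSpace.exp x‖ ≤ Real.exp (-w / 12) :=
      (norm_banachExp_le _).trans (Real.exp_le_exp.2 hxn)
    calc ‖e‖ ≤ Real.exp w * Real.exp (-w / 12) := by
          refine (norm_mul_le _ _).trans ?_
          rw [norm_algebraMap', hχ]
          gcongr
      _ ≤ _ := by
          rw [← Real.exp_add]
          exact Real.exp_le_exp.2 (by linarith)
  have hz : ‖-(v' * e)‖ ≤ 1 / 2 := by
    rw [norm_neg]
    calc _ ≤ ‖v'‖ * ‖e‖ := norm_mul_le _ _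
      _ ≤ ‖μ‖⁻¹ * (‖μ‖ / 2) := by gcongr; exact hen.trans hw
      _ = 1 / 2 := by field_simp
  have hu : e - algebraMap ℂ A μ = v * (1 - -(v' * e)) := by
    have : algebraMap ℂ A μ = -v := by rw [← map_neg, neg_neg]
    rw [this]
    linear_combination -e * hv
  obtain ⟨h1, h2, h3⟩ := inverse_mul_one_sub hv hβ hz
  rw [← hu] at h1 h2 h3
  exact ⟨h1, h2, fun S hS hhS => h3 S hS (S.algebraMap_mem _) (neg_mem
    (S.mul_mem (S.algebraMap_mem _) (S.mul_mem (S.algebraMap_mem _)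
      (banachExp_mem hS (S.smul_mem hhS _)))))⟩

/-- For bounded `w` the element is a small perturbation of the constant χ - μ, whose inverse is
bounded by `c⁻¹`. -/
theorem expResolvent_middle [NormOneClass A] {χ μ : ℂ} {c R ε w : ℝ} (hc : 0 < c)
    (hχμ : c ≤ ‖χ - μ‖) (hχ : ‖χ‖ = Real.exp w) (hw : |w| ≤ R) (hε : ε ≤ 1)
    (hε' : ε * (R * Real.exp (2 * R)) ≤ c / 2) {h : A} (hh : ‖h‖ ≤ ε) :
    IsUnit (algebraMap ℂ A χ * NormedSpace.exp ((w : ℂ) • h) - algebraMap ℂ A μ) ∧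
      ‖expResolvent χ μ w h‖ ≤ 2 * c⁻¹ ∧
      ∀ S : Subalgebra ℂ A, IsClosed (S : Set A) → h ∈ S → expResolvent χ μ w h ∈ S := by
  have hχμ0 : 0 < ‖χ - μ‖ := hc.trans_le hχμ
  have hR : 0 ≤ R := (abs_nonneg w).trans hw
  have hε0 : 0 ≤ ε := (norm_nonneg h).trans hh
  set x : A := (w : ℂ) • h with hx
  have hxn : ‖x‖ ≤ R * ε := (norm_smul_le_of_le hh).trans (by gcongr)
  set v : A := algebraMap ℂ A (χ - μ)
  set v' : A := algebraMap ℂ A (χ - μ)⁻¹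
  set e : A := algebraMap ℂ A χ * (NormedSpace.exp x - 1) with he
  have hv : v * v' = 1 := by
    rw [← map_mul, mul_inv_cancel₀ (norm_pos_iff.1 hχμ0), map_one]
  have hβ : ‖v'‖ ≤ c⁻¹ := by
    rw [norm_algebraMap', norm_inv]
    exact inv_anti₀ hc hχμ
  have hen : ‖e‖ ≤ c / 2 := by
    calc ‖e‖ ≤ Real.exp w * (‖x‖ * Real.exp ‖x‖) := by
          refine (norm_mul_le _ _).trans ?_
          rw [norm_algebraMap', hχ]
          gcongr
          exact norm_banachExp_sub_one_le x
      _ ≤ Real.exp R * (R * ε * Real.exp R) := by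
          gcongr
          · exact (le_abs_self w).trans hw
          · exact hxn.trans (mul_le_of_le_one_right hR hε)
      _ = ε * (R * Real.exp (2 * R)) := by rw [two_mul, Real.exp_add]; ring
      _ ≤ c / 2 := hε'
  have hz : ‖-(v' * e)‖ ≤ 1 / 2 := by
    rw [norm_neg]
    calc _ ≤ ‖v'‖ * ‖e‖ := norm_mul_le _ _
      _ ≤ c⁻¹ * (c / 2) := by gcongr
      _ = 1 / 2 := by field_simp
  have hu : algebraMap ℂ A χ * NormedSpace.exp x - algebraMap ℂ A μ = v * (1 - -(v' * e)) := by
    have : v = algebraMap ℂ A χ - algebraMap ℂ A μ := map_sub _ _ _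
    calc _ = v + e := by rw [this, he]; ring
      _ = _ := by linear_combination -e * hv
  obtain ⟨h1, h2, h3⟩ := inverse_mul_one_sub hv hβ hz
  rw [← hu] at h1 h2 h3
  exact ⟨h1, h2, fun S hS hhS => h3 S hS (S.algebraMap_mem _) (neg_mem
    (S.mul_mem (S.algebraMap_mem _) (S.mul_mem (S.algebraMap_mem _)
      (sub_mem (banachExp_mem hS (S.smul_mem hhS _)) S.one_mem))))⟩

/-- Resolvent identity u⁻¹ - v⁻¹ = u⁻¹ v⁻¹ (v - u), combined with the Lipschitz bound for the
exponential. -/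
theorem norm_expResolvent_sub_le [NormOneClass A] {χ μ : ℂ} {w β M : ℝ} (hχ : ‖χ‖ = Real.exp w)
    {h h' : A} (hh : ‖h‖ ≤ 1 / 12) (hh' : ‖h'‖ ≤ 1 / 12)
    (hu : IsUnit (algebraMap ℂ A χ * NormedSpace.exp ((w : ℂ) • h) - algebraMap ℂ A μ))
    (hu' : IsUnit (algebraMap ℂ A χ * NormedSpace.exp ((w : ℂ) • h') - algebraMap ℂ A μ))
    (hβ : ‖expResolvent χ μ w h‖ ≤ β) (hβ' : ‖expResolvent χ μ w h'‖ ≤ β)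
    (hM : β * β * (Real.exp w * (|w| * Real.exp (|w| / 4))) ≤ M) :
    ‖expResolvent χ μ w h - expResolvent χ μ w h'‖ ≤ M * ‖h - h'‖ := by
  have e1 := Ring.mul_inverse_cancel _ hu
  have e2 := Ring.mul_inverse_cancel _ hu'
  have key : expResolvent χ μ w h - expResolvent χ μ w h' =
      expResolvent χ μ w h * expResolvent χ μ w h' * (algebraMap ℂ A χ *
        (NormedSpace.exp ((w : ℂ) • h') - NormedSpace.exp ((w : ℂ) • h))) := by
    unfold expResolvent
    linear_combination
      Ring.inverse (algebraMap ℂ A χ * NormedSpace.exp ((w : ℂ) • h') - algebraMap ℂ A μ) * e1 -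
      Ring.inverse (algebraMap ℂ A χ * NormedSpace.exp ((w : ℂ) • h) - algebraMap ℂ A μ) * e2
  have hβ0 : 0 ≤ β := (norm_nonneg _).trans hβ
  have h1 : ‖NormedSpace.exp ((w : ℂ) • h') - NormedSpace.exp ((w : ℂ) • h)‖ ≤
      |w| * Real.exp (|w| / 4) * ‖h - h'‖ := by
    refine (norm_banachExp_sub_le _ _).trans ?_
    have h2 : ‖(w : ℂ) • h' - (w : ℂ) • h‖ = |w| * ‖h - h'‖ := by
      rw [← smul_sub, norm_smul, Complex.norm_real, Real.norm_eq_abs, norm_sub_rev]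
    have h3 : ‖h - h'‖ ≤ 1 / 6 := (norm_sub_le _ _).trans (by linarith)
    have h4 : ‖(w : ℂ) • h‖ + ‖(w : ℂ) • h' - (w : ℂ) • h‖ ≤ |w| / 4 := by
      have := norm_smul_le_of_le (w := w) hh
      have := mul_le_mul_of_nonneg_left h3 (abs_nonneg w)
      linarith
    have h5 := Real.exp_le_exp.2 h4
    calc _ ≤ |w| * ‖h - h'‖ * Real.exp (|w| / 4) := by
          rw [h2] at h5 ⊢
          gcongr
      _ = _ := by ring
  rw [key]
  calc _ ≤ ‖expResolvent χ μ w h‖ * ‖expResolvent χ μ w h'‖ * (‖algebraMap ℂ A χ‖ *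
        ‖NormedSpace.exp ((w : ℂ) • h') - NormedSpace.exp ((w : ℂ) • h)‖) :=
        (norm_mul_le _ _).trans (mul_le_mul (norm_mul_le _ _) (norm_mul_le _ _)
          (norm_nonneg _) (by positivity))
    _ ≤ β * β * (Real.exp w * (|w| * Real.exp (|w| / 4) * ‖h - h'‖)) := by
        rw [norm_algebraMap', hχ]
        gcongr
    _ = β * β * (Real.exp w * (|w| * Real.exp (|w| / 4))) * ‖h - h'‖ := by ring
    _ ≤ _ := by gcongr

/-- Uniform bounds for the inverses of `χ e ^ {w h} - μ` when `χ` stays away from `μ`. -/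
theorem exists_expResolvent_bound (A : Type*) [NormedCommRing A] [NormedAlgebra ℂ A]
    [CompleteSpace A] [NormOneClass A] {μ : ℂ} (hμ : μ ≠ 0) {c : ℝ} (hc : 0 < c) :
    ∃ ε > 0, ∃ M : ℝ, ∀ (χ : ℂ) (w : ℝ), ‖χ‖ = Real.exp w → c ≤ ‖χ - μ‖ →
      ∀ h : A, ‖h‖ ≤ ε →
        IsUnit (algebraMap ℂ A χ * NormedSpace.exp ((w : ℂ) • h) - algebraMap ℂ A μ) ∧
        ‖expResolvent χ μ w h‖ ≤ M ∧
        (∀ S : Subalgebra ℂ A, IsClosed (S : Set A) → h ∈ S → expResolvent χ μ w h ∈ S) ∧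
        ∀ h' : A, ‖h'‖ ≤ ε →
          ‖expResolvent χ μ w h - expResolvent χ μ w h'‖ ≤ M * ‖h - h'‖ := by
  have hμ0 : 0 < ‖μ‖ := norm_pos_iff.2 hμ
  -- Beyond `R` one has `2 * ‖μ‖ ≤ exp (w / 2)` for positive `w` and `exp (w / 2) ≤ ‖μ‖ / 2` for
  -- negative `w`, the conditions of the two extreme regimes. The bound `M` below adds up the
  -- constants of the three regimes.
  set R : ℝ := 2 * |Real.log (2 * ‖μ‖)| + 2 * |Real.log (‖μ‖ / 2)| with hR
  have hR0 : 0 ≤ R := by positivity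
  set K : ℝ := R * Real.exp (2 * R) with hK
  have hK0 : 0 ≤ K := by positivity
  set ε : ℝ := min (1 / 12) (c / 2 / (K + 1)) with hε
  have hε0 : 0 < ε := lt_min (by norm_num) (by positivity)
  have hε1 : ε ≤ 1 / 12 := min_le_left _ _
  have hε2 : ε * K ≤ c / 2 := by
    have h1 : ε ≤ c / 2 / (K + 1) := min_le_right _ _
    rw [le_div_iff₀ (by positivity)] at h1
    nlinarith
  set M₁ : ℝ := 4 * (c⁻¹ * c⁻¹ * (Real.exp R * (R * Real.exp (R / 4)))) with hM₁
  set M : ℝ := 16 + 2 * ‖μ‖⁻¹ + 8 * (‖μ‖⁻¹ * ‖μ‖⁻¹) + 2 * c⁻¹ + M₁ with hM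
  have p1 : 0 ≤ ‖μ‖⁻¹ := by positivity
  have p2 : 0 ≤ ‖μ‖⁻¹ * ‖μ‖⁻¹ := by positivity
  have p3 : 0 ≤ c⁻¹ := by positivity
  have p4 : 0 ≤ M₁ := by positivity
  refine ⟨ε, hε0, M, fun χ w hχ hχμ h hh => ?_⟩
  suffices H : ∃ β, β ≤ M ∧ β * β * (Real.exp w * (|w| * Real.exp (|w| / 4))) ≤ M ∧
      ∀ h : A, ‖h‖ ≤ ε →
        IsUnit (algebraMap ℂ A χ * NormedSpace.exp ((w : ℂ) • h) - algebraMap ℂ A μ) ∧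
        ‖expResolvent χ μ w h‖ ≤ β ∧
        ∀ S : Subalgebra ℂ A, IsClosed (S : Set A) → h ∈ S → expResolvent χ μ w h ∈ S by
    obtain ⟨β, hβ1, hβ2, hβ⟩ := H
    obtain ⟨h1, h2, h3⟩ := hβ h hh
    refine ⟨h1, h2.trans hβ1, h3, fun h' hh' => ?_⟩
    obtain ⟨h1', h2', -⟩ := hβ h' hh'
    exact norm_expResolvent_sub_le hχ (hh.trans hε1) (hh'.trans hε1) h1 h1' h2 h2' hβ2
  rcases le_or_gt |w| R with hw | hw
  · refine ⟨2 * c⁻¹, by linarith, ?_, fun h hh =>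
      expResolvent_middle hc hχμ hχ hw (hε1.trans (by norm_num)) hε2 hh⟩
    calc _ ≤ 2 * c⁻¹ * (2 * c⁻¹) * (Real.exp R * (R * Real.exp (R / 4))) := by
          gcongr
          exact (le_abs_self w).trans hw
      _ = M₁ := by rw [hM₁]; ring
      _ ≤ M := by linarith
  · have q1 := le_abs_self (Real.log (2 * ‖μ‖))
    have q2 := neg_abs_le (Real.log (‖μ‖ / 2))
    have q3 := abs_nonneg (Real.log (2 * ‖μ‖))
    have q4 := abs_nonneg (Real.log (‖μ‖ / 2))
    rcases le_total 0 w with hw0 | hw0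
    · rw [abs_of_nonneg hw0] at hw ⊢
      refine ⟨2 * Real.exp (-(3 / 4 * w)), ?_, ?_, fun h hh =>
        expResolvent_large hχ hw0 ?_ (hh.trans hε1)⟩
      · have : Real.exp (-(3 / 4 * w)) ≤ 1 := Real.exp_le_one_iff.2 (by linarith)
        linarith
      · have h1 := mul_exp_neg_le (a := 1 / 4) (t := w) (by norm_num)
        calc _ = 4 * (w * (Real.exp (-(3 / 4 * w)) * Real.exp (-(3 / 4 * w)) * Real.exp w *
              Real.exp (w / 4))) := by ring
          _ = 4 * (w * Real.exp (-(1 / 4 * w))) := by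
              rw [← Real.exp_add, ← Real.exp_add, ← Real.exp_add]
              ring_nf
          _ ≤ 4 * (1 / (1 / 4)) := by gcongr
          _ ≤ M := by norm_num; linarith
      · rw [← Real.log_le_iff_le_exp (by positivity)]
        linarith
    · rw [abs_of_nonpos hw0] at hw ⊢
      refine ⟨2 * ‖μ‖⁻¹, by linarith, ?_, fun h hh =>
        expResolvent_small hμ hχ hw0 ?_ (hh.trans hε1)⟩
      · have h1 := mul_exp_neg_le (a := 3 / 4) (t := -w) (by norm_num)
        calc _ = 4 * (‖μ‖⁻¹ * ‖μ‖⁻¹) * (-w * (Real.exp w * Real.exp (-w / 4))) := by ring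
          _ = 4 * (‖μ‖⁻¹ * ‖μ‖⁻¹) * (-w * Real.exp (-(3 / 4 * -w))) := by
              rw [← Real.exp_add]
              ring_nf
          _ ≤ 4 * (‖μ‖⁻¹ * ‖μ‖⁻¹) * 2 := by
              gcongr
              exact h1.trans (by norm_num)
          _ ≤ M := by linarith
      · rw [← Real.le_log_iff_exp_le (by positivity)]
        linarith

end BanachExp


/-! ### Substitution into power series and multiplier operators. -/

section ProdPow

variable {n : ℕ} {A : Type*} [NormedCommRing A]

/-- The monomial `z ^ m` in a commutative ring. -/
def prodPow (z : Fin n → A) (m : Fin n →₀ ℕ) : A := ∏ i, z i ^ m i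

theorem prodPow_zero (z : Fin n → A) : prodPow z 0 = 1 := by simp [prodPow]

theorem prodPow_add (z : Fin n → A) (a b : Fin n →₀ ℕ) :
    prodPow z (a + b) = prodPow z a * prodPow z b := by
  simp [prodPow, pow_add, Finset.prod_mul_distrib]

theorem prodPow_single_one (z : Fin n → A) (i : Fin n) :
    prodPow z (Finsupp.single i 1) = z i := by
  rw [prodPow, Finset.prod_eq_single i (fun j _ hj => by simp [hj.symm])
    (by simp)]
  simp

theorem exponent_induction {P : (Fin n →₀ ℕ) → Prop} (zero : P 0)
    (add : ∀ m i, P m → P (m + Finsupp.single i 1)) (m : Fin n →₀ ℕ) : P m := by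
  induction m using Finsupp.induction with
  | zero => exact zero
  | single_add i k f _ _ ih =>
    clear * - ih add
    induction k with
    | zero => simpa using ih
    | succ k ih' =>
      rw [Finsupp.single_add, add_right_comm]
      exact add _ _ ih'

theorem norm_prodPow_le [NormOneClass A] {r : ℝ} {z : Fin n → A} (hz : ‖z‖ ≤ r)
    (m : Fin n →₀ ℕ) : ‖prodPow z m‖ ≤ r ^ totalDeg m := by
  induction m using exponent_induction with
  | zero => simp [prodPow_zero, totalDeg_zero]
  | add m i ih =>
    rw [prodPow_add, totalDeg_add, pow_add, prodPow_single_one, totalDeg_single, pow_one]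
    have hr : 0 ≤ r := (norm_nonneg _).trans hz
    exact (norm_mul_le _ _).trans (mul_le_mul ih ((norm_le_pi_norm z i).trans hz)
      (norm_nonneg _) (pow_nonneg hr _))

/-- Telescoping on the ball of radius 2 gives the factor |m| 2^|m|, at most 4^|m|. This is why the
majorants of power series carry the weight 4^|m|. -/
theorem norm_prodPow_sub_le [NormOneClass A] {z z' : Fin n → A} (hz : ‖z‖ ≤ 2) (hz' : ‖z'‖ ≤ 2)
    (m : Fin n →₀ ℕ) : ‖prodPow z m - prodPow z' m‖ ≤ 4 ^ totalDeg m * ‖z - z'‖ := by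
  have key : ‖prodPow z m - prodPow z' m‖ ≤ totalDeg m * 2 ^ totalDeg m * ‖z - z'‖ := by
    induction m using exponent_induction with
    | zero => simp [prodPow_zero, totalDeg_zero]
    | add m i ih =>
      have h1 : prodPow z (m + Finsupp.single i 1) - prodPow z' (m + Finsupp.single i 1) =
          (prodPow z m - prodPow z' m) * z i + prodPow z' m * (z - z') i := by
        rw [prodPow_add, prodPow_add, prodPow_single_one, prodPow_single_one, Pi.sub_apply]
        ring
      have h2 : ‖z i‖ ≤ 2 := (norm_le_pi_norm z i).trans hz
      have h3 : ‖(z - z') i‖ ≤ ‖z - z'‖ := norm_le_pi_norm _ i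
      have h4 := norm_prodPow_le hz' m
      rw [h1, totalDeg_add, totalDeg_single]
      push_cast
      calc _ ≤ ‖prodPow z m - prodPow z' m‖ * ‖z i‖ + ‖prodPow z' m‖ * ‖(z - z') i‖ :=
            (norm_add_le _ _).trans (add_le_add (norm_mul_le _ _) (norm_mul_le _ _))
        _ ≤ totalDeg m * 2 ^ totalDeg m * ‖z - z'‖ * 2 + 2 ^ totalDeg m * ‖z - z'‖ := by gcongr
        _ ≤ _ := by
            have h5 : 0 ≤ (2 : ℝ) ^ totalDeg m * ‖z - z'‖ := by positivity
            rw [pow_succ]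
            nlinarith
  have h2 : (totalDeg m : ℝ) ≤ 2 ^ totalDeg m := by exact_mod_cast Nat.lt_two_pow_self.le
  calc _ ≤ _ := key
    _ ≤ 2 ^ totalDeg m * 2 ^ totalDeg m * ‖z - z'‖ := by gcongr
    _ = _ := by rw [← mul_pow]; norm_num

variable [NormedAlgebra ℂ A]

/-- The substitution of `z` into the power series with coefficients `c`. -/
noncomputable def substSeries (c : (Fin n →₀ ℕ) → ℂ) (z : Fin n → A) : A :=
  ∑' m, c m • prodPow z m

variable [NormOneClass A] {c : (Fin n →₀ ℕ) → ℂ} {κ : ℝ} {z z' : Fin n → A}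

theorem norm_smul_prodPow_le (c : (Fin n →₀ ℕ) → ℂ) (hz : ‖z‖ ≤ 2) (m : Fin n →₀ ℕ) :
    ‖c m • prodPow z m‖ ≤ ‖c m‖ * 4 ^ totalDeg m := by
  rw [norm_smul]
  gcongr
  exact (norm_prodPow_le hz m).trans (by gcongr; norm_num)

theorem norm_substSeries_le (hc : HasSum (fun m => ‖c m‖ * 4 ^ totalDeg m) κ) (hz : ‖z‖ ≤ 2) :
    ‖substSeries c z‖ ≤ κ :=
  tsum_of_norm_bounded hc (norm_smul_prodPow_le c hz)

variable [CompleteSpace A]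

theorem hasSum_substSeries (hc : HasSum (fun m => ‖c m‖ * 4 ^ totalDeg m) κ) (hz : ‖z‖ ≤ 2) :
    HasSum (fun m => c m • prodPow z m) (substSeries c z) :=
  (Summable.of_norm_bounded hc.summable (norm_smul_prodPow_le c hz)).hasSum

theorem norm_substSeries_sub_le (hc : HasSum (fun m => ‖c m‖ * 4 ^ totalDeg m) κ) (hz : ‖z‖ ≤ 2)
    (hz' : ‖z'‖ ≤ 2) : ‖substSeries c z - substSeries c z'‖ ≤ κ * ‖z - z'‖ := by
  have h := (hasSum_substSeries hc hz).sub (hasSum_substSeries hc hz')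
  rw [← h.tsum_eq]
  refine tsum_of_norm_bounded (hc.mul_right ‖z - z'‖) fun m => ?_
  rw [← smul_sub, norm_smul, mul_assoc]
  gcongr
  exact norm_prodPow_sub_le hz hz' m

end ProdPow

namespace ellOne

variable {n : ℕ}

theorem norm_var_fun_le : ‖(var : Fin n → ellOne n)‖ ≤ 1 :=
  (pi_norm_le_iff_of_nonneg zero_le_one).2 fun i => (norm_var i).le

theorem eval_prodPow (y : Fin n → ℂ) (hy : ‖y‖ ≤ 1) (z : Fin n → ellOne n) (m : Fin n →₀ ℕ) :
    eval y hy (prodPow z m) = monomialAt (fun i => eval y hy (z i)) m := by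
  simp [prodPow, monomialAt, map_prod]

theorem eval_prodPow_var (y : Fin n → ℂ) (hy : ‖y‖ ≤ 1) (m : Fin n →₀ ℕ) :
    eval y hy (prodPow var m) = monomialAt y m := by
  rw [eval_prodPow]
  congr 1
  ext i
  exact eval_var y hy i

theorem prodPow_var_mem_supported {S : Set (Fin n →₀ ℕ)} {m : Fin n →₀ ℕ} (hm : m ∈ S) :
    prodPow var m ∈ supported S := by
  suffices h : prodPow var m ∈ supported ({m} : Set (Fin n →₀ ℕ)) from
    supported_mono (Set.singleton_subset_iff.2 hm) h
  clear hm
  induction m using exponent_induction with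
  | zero =>
    rw [prodPow_zero, ← map_one (algebraMap ℂ (ellOne n))]
    exact algebraMap_mem_supported (Set.mem_singleton 0) _
  | add m i ih =>
    rw [prodPow_add, prodPow_single_one]
    refine mul_mem_supported (S := {m}) (T := {Finsupp.single i 1}) ?_ ih
      (var_mem_supported (Set.mem_singleton _))
    rintro a rfl b rfl
    rfl

/-- The operator that multiplies the monomial `y ^ m` by `b m`. -/
noncomputable def twist (b : (Fin n →₀ ℕ) → ellOne n) (s : ellOne n) : ellOne n :=
  ∑' m, coeff m s • (prodPow var m * b m)

section twist

variable {b b' : (Fin n →₀ ℕ) → ellOne n} {M : ℝ}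

theorem norm_twist_term_le (hb : ∀ m, ‖b m‖ ≤ M) (s : ellOne n) (m : Fin n →₀ ℕ) :
    ‖coeff m s • (prodPow var m * b m)‖ ≤ ‖coeff m s‖ * M := by
  rw [norm_smul]
  gcongr
  calc _ ≤ ‖prodPow (var : Fin n → ellOne n) m‖ * ‖b m‖ := norm_mul_le _ _
    _ ≤ 1 * M := by
        gcongr
        · exact (norm_prodPow_le norm_var_fun_le m).trans_eq (one_pow _)
        · exact hb m
    _ = M := one_mul M

theorem hasSum_twist (hb : ∀ m, ‖b m‖ ≤ M) (s : ellOne n) :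
    HasSum (fun m => coeff m s • (prodPow var m * b m)) (twist b s) :=
  (Summable.of_norm_bounded ((hasSum_norm s).mul_right M).summable
    (norm_twist_term_le hb s)).hasSum

theorem norm_twist_le (hb : ∀ m, ‖b m‖ ≤ M) (s : ellOne n) : ‖twist b s‖ ≤ ‖s‖ * M :=
  tsum_of_norm_bounded ((hasSum_norm s).mul_right M) (norm_twist_term_le hb s)

theorem norm_twist_sub_twist_le (hb : ∀ m, ‖b m‖ ≤ M) (hb' : ∀ m, ‖b' m‖ ≤ M) {D : ℝ}
    (hD : ∀ m, ‖b m - b' m‖ ≤ D) (s s' : ellOne n) :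
    ‖twist b s - twist b' s'‖ ≤ ‖s - s'‖ * M + ‖s'‖ * D := by
  have h1 : twist b s - twist b s' = twist b (s - s') := by
    rw [← ((hasSum_twist hb s).sub (hasSum_twist hb s')).tsum_eq, twist]
    simp only [map_sub, sub_smul]
  have h2 : twist b s' - twist b' s' = twist (fun m => b m - b' m) s' := by
    rw [← ((hasSum_twist hb s').sub (hasSum_twist hb' s')).tsum_eq, twist]
    simp only [mul_sub, smul_sub]
  calc _ = ‖(twist b s - twist b s') + (twist b s' - twist b' s')‖ := by
        rw [sub_add_sub_cancel]
    _ ≤ _ := by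
        rw [h1, h2]
        exact (norm_add_le _ _).trans (add_le_add (norm_twist_le hb _) (norm_twist_le hD _))

end twist

/-- The quotient by `y_i` of the monomials `y ^ (k + e_i)` with `k ∈ S`. -/
noncomputable def quot (i : Fin n) (S : Set (Fin n →₀ ℕ)) (s : ellOne n) : ellOne n :=
  mk (S.indicator fun k => coeff (k + Finsupp.single i 1) s)
    (Summable.of_nonneg_of_le (fun _ => norm_nonneg _) (fun _ => norm_indicator_le_norm_self _ _)
      ((summable_norm s).comp_injective (add_left_injective (Finsupp.single i 1))))

theorem coeff_quot (i : Fin n) (S : Set (Fin n →₀ ℕ)) (s : ellOne n) (k : Fin n →₀ ℕ) :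
    coeff k (quot i S s) = S.indicator (fun k => coeff (k + Finsupp.single i 1) s) k := rfl

theorem quot_mem_supported (i : Fin n) (S : Set (Fin n →₀ ℕ)) (s : ellOne n) :
    quot i S s ∈ supported S := fun m hm => by
  rw [coeff_quot, Set.indicator_of_notMem hm]

theorem norm_quot_le (i : Fin n) (S : Set (Fin n →₀ ℕ)) (s : ellOne n) : ‖quot i S s‖ ≤ ‖s‖ := by
  have h1 := (summable_norm s).comp_injective (add_left_injective (Finsupp.single i 1))
  refine (mk_le (f := S.indicator fun k => coeff (k + Finsupp.single i 1) s) _ h1.hasSum fun m =>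
    norm_indicator_le_norm_self (fun k => coeff (k + Finsupp.single i 1) s) m).trans ?_
  exact tsum_comp_le_tsum_of_inj (summable_norm s) (fun _ => norm_nonneg _)
    (add_left_injective (Finsupp.single i 1))

theorem quot_sub (i : Fin n) (S : Set (Fin n →₀ ℕ)) (s s' : ellOne n) :
    quot i S s - quot i S s' = quot i S (s - s') := by
  refine ext fun m => ?_
  rw [map_sub, coeff_quot, coeff_quot, coeff_quot]
  by_cases h : m ∈ S
  · simp [h]
  · simp [h]

theorem eval_zero_eq_coeff (f : ellOne n) : eval 0 (by simp) f = coeff 0 f := by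
  refine (hasSum_eval 0 (by simp) f).unique ?_
  have h : HasSum (fun m => coeff m f * monomialAt (0 : Fin n → ℂ) m)
      (coeff 0 f * monomialAt (0 : Fin n → ℂ) 0) := by
    refine hasSum_single (0 : Fin n →₀ ℕ) fun m hm => ?_
    obtain ⟨i, hi⟩ : ∃ i, m i ≠ 0 := by
      by_contra! h
      exact hm (Finsupp.ext h)
    rw [monomialAt, Finset.prod_eq_zero (Finset.mem_univ i) (by simp [hi]), mul_zero]
  rwa [monomialAt_zero, mul_one] at h

end ellOne

/-! ### The fixed point equation for the normalization. -/

/-- The exponents `m` with `μ ^ m = 1`. -/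
def trivialCharacter {n : ℕ} (μ : Fin n → ℂ) : AddSubmonoid (Fin n →₀ ℕ) where
  carrier := {m | monomialAt μ m = 1}
  zero_mem' := monomialAt_zero μ
  add_mem' := fun {a b} (ha : monomialAt μ a = 1) (hb : monomialAt μ b = 1) =>
    show monomialAt μ (a + b) = 1 by rw [monomialAt_add, ha, hb, one_mul]

/-- The exponents of the nonlinear nonresonant monomials in the component `j`. -/
def nonresonant {n : ℕ} (μ : Fin n → ℂ) (j : Fin n) : Set (Fin n →₀ ℕ) :=
  {m | 2 ≤ totalDeg m ∧ monomialAt μ m ≠ μ j}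

/-- The nonzero exponents with `μ ^ m = 1`. -/
def invariantExponents {n : ℕ} (μ : Fin n → ℂ) : Set (Fin n →₀ ℕ) :=
  {m | monomialAt μ m = 1 ∧ m ≠ 0}

open Classical in
/-- The multipliers that solve the homological equation in the component `j`. -/
noncomputable def homologicalMultiplier {n : ℕ} (μ : Fin n → ℂ) (j : Fin n) (h : ellOne n)
    (m : Fin n →₀ ℕ) : ellOne n :=
  if m ∈ nonresonant μ j then
    expResolvent (monomialAt μ m) (μ j) (Real.log ‖monomialAt μ m‖) h else 0

/-- The choice w = log |μ^m| makes the resolvent bounds applicable; the lower bound `c` on the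
divisors makes them uniform in the exponent, and finiteness makes them uniform in `j`. -/
theorem exists_homologicalMultiplier_bound {n : ℕ} {μ : Fin n → ℂ} (hμ : ∀ i, μ i ≠ 0) {c : ℝ}
    (hc : 0 < c) (hcμ : ∀ m j, monomialAt μ m ≠ μ j → c ≤ ‖monomialAt μ m - μ j‖) :
    ∃ ε > 0, ∃ M ≥ 0, ∀ (j : Fin n) (h : ellOne n), ‖h‖ ≤ ε →
      (∀ m ∈ nonresonant μ j, IsUnit (algebraMap ℂ (ellOne n) (monomialAt μ m) *
        NormedSpace.exp (((Real.log ‖monomialAt μ m‖ : ℝ) : ℂ) • h) -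
          algebraMap ℂ (ellOne n) (μ j))) ∧
      (∀ m, ‖homologicalMultiplier μ j h m‖ ≤ M) ∧
      (h ∈ ellOne.supported (trivialCharacter μ : Set (Fin n →₀ ℕ)) →
        ∀ m, homologicalMultiplier μ j h m ∈
          ellOne.supported (trivialCharacter μ : Set (Fin n →₀ ℕ))) ∧
      ∀ h' : ellOne n, ‖h'‖ ≤ ε → ∀ m,
        ‖homologicalMultiplier μ j h m - homologicalMultiplier μ j h' m‖ ≤ M * ‖h - h'‖ := by
  choose ε hε M hM using fun j => exists_expResolvent_bound (ellOne n) (hμ j) hc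
  have hM0 : ∀ j, 0 ≤ max (M j) 0 := fun j => le_max_right _ _
  have hMle : ∀ j, M j ≤ ∑ i, max (M i) 0 := fun j =>
    (le_max_left _ _).trans (Finset.single_le_sum (f := fun i => max (M i) 0)
      (fun i _ => hM0 i) (Finset.mem_univ j))
  have hS0 : 0 ≤ ∑ i, max (M i) 0 := Finset.sum_nonneg fun i _ => hM0 i
  obtain ⟨ε₀, hε₀, hε₀le⟩ : ∃ ε₀ > 0, ∀ j, ε₀ ≤ ε j := by
    have : ∀ᶠ e in 𝓝[>] (0 : ℝ), ∀ j, e ≤ ε j := eventually_all.2 fun j =>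
      eventually_nhdsWithin_of_eventually_nhds (Iic_mem_nhds (hε j))
    obtain ⟨e, he, he0⟩ := (this.and self_mem_nhdsWithin).exists
    exact ⟨e, he0, he⟩
  have hχ : ∀ m, ‖monomialAt μ m‖ = Real.exp (Real.log ‖monomialAt μ m‖) := fun m =>
    (Real.exp_log (norm_pos_iff.2 (Finset.prod_ne_zero_iff.2 fun i _ => pow_ne_zero _ (hμ i)))).symm
  refine ⟨ε₀, hε₀, ∑ i, max (M i) 0, hS0, fun j h hh => ⟨?_, ?_, ?_, ?_⟩⟩
  · intro m hm
    exact (hM j _ _ (hχ m) (hcμ m j hm.2) h (hh.trans (hε₀le j))).1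
  · intro m
    unfold homologicalMultiplier
    split_ifs with hm
    · exact ((hM j _ _ (hχ m) (hcμ m j hm.2) h (hh.trans (hε₀le j))).2.1).trans (hMle j)
    · rw [norm_zero]; exact hS0
  · intro hs m
    unfold homologicalMultiplier
    split_ifs with hm
    · exact (hM j _ _ (hχ m) (hcμ m j hm.2) h (hh.trans (hε₀le j))).2.2.1
        (ellOne.supportedAlg (trivialCharacter μ)) (ellOne.isClosed_supportedAlg _) hs
    · exact zero_mem _
  · intro h' hh' m
    unfold homologicalMultiplier
    split_ifs with hm
    · refine ((hM j _ _ (hχ m) (hcμ m j hm.2) h (hh.trans (hε₀le j))).2.2.2 h'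
        (hh'.trans (hε₀le j))).trans ?_
      gcongr
      exact hMle j
    · rw [sub_self, norm_zero]; positivity

theorem exists_fixedPoint_of_lipschitz_half {E : Type*} [NormedAddCommGroup E] [CompleteSpace E]
    {ε : ℝ} (hε : 0 ≤ ε) {T : E → E} {V : Set E} (hV : IsClosed V) (h0 : (0 : E) ∈ V)
    (hTV : ∀ z ∈ V, ‖z‖ ≤ ε → T z ∈ V) (hT0 : ‖T 0‖ ≤ ε / 2)
    (hT : ∀ z z', ‖z‖ ≤ ε → ‖z'‖ ≤ ε → ‖T z - T z'‖ ≤ 1 / 2 * ‖z - z'‖) :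
    ∃ z ∈ V, ‖z‖ ≤ ε ∧ T z = z := by
  set s : Set E := V ∩ Metric.closedBall 0 ε with hs
  have hsc : IsComplete s := (hV.inter Metric.isClosed_closedBall).isComplete
  have hmaps : Set.MapsTo T s s := by
    rintro z ⟨hz, hzε⟩
    rw [mem_closedBall_zero_iff] at hzε
    refine ⟨hTV z hz hzε, ?_⟩
    rw [mem_closedBall_zero_iff]
    have h1 := hT z 0 hzε (by simpa using hε)
    rw [sub_zero] at h1
    calc ‖T z‖ = ‖(T z - T 0) + T 0‖ := by rw [sub_add_cancel]
      _ ≤ ‖T z - T 0‖ + ‖T 0‖ := norm_add_le _ _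
      _ ≤ ε := by linarith
  have hcon : ContractingWith (1 / 2) (hmaps.restrict T s s) := by
    refine ⟨by rw [← NNReal.coe_lt_coe]; norm_num, LipschitzWith.of_dist_le_mul fun z z' => ?_⟩
    have h1 := hT z z' (mem_closedBall_zero_iff.1 z.2.2) (mem_closedBall_zero_iff.1 z'.2.2)
    rw [Subtype.dist_eq, Subtype.dist_eq, dist_eq_norm, dist_eq_norm]
    simpa using h1
  obtain ⟨z, hz, hfix, -⟩ := hcon.exists_fixedPoint' hsc hmaps (x := 0)
    ⟨h0, by simpa using hε⟩ (edist_ne_top _ _)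
  exact ⟨z, hz.1, mem_closedBall_zero_iff.1 hz.2, hfix⟩

/-- The functional equations of the partial normalization have a solution. -/
theorem exists_normalization_series {n : ℕ} {μ : Fin n → ℂ} (hμ : ∀ i, μ i ≠ 0) {i₀ : Fin n}
    (hi₀ : Real.log ‖μ i₀‖ ≠ 0) (hr : resonantRank μ = n - 1) :
    ∃ κ > 0, ∀ c : Fin n → (Fin n →₀ ℕ) → ℂ,
      (∀ j, ∃ K ≤ κ, HasSum (fun m => ‖c j m‖ * 4 ^ totalDeg m) K) →
      ∃ (φ : Fin n → ellOne n) (h : ellOne n), ‖φ‖ ≤ 1 ∧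
        (∀ j, φ j ∈ ellOne.supported (nonresonant μ j)) ∧
        h ∈ ellOne.supported (invariantExponents μ) ∧
        (∀ j, ∀ m ∈ nonresonant μ j, IsUnit (algebraMap ℂ (ellOne n) (monomialAt μ m) *
          NormedSpace.exp (((Real.log ‖monomialAt μ m‖ : ℝ) : ℂ) • h) -
            algebraMap ℂ (ellOne n) (μ j))) ∧
        (∃ M, ∀ j m, ‖homologicalMultiplier μ j h m‖ ≤ M) ∧
        (∀ j m, homologicalMultiplier μ j h m ∈
          ellOne.supported (trivialCharacter μ : Set (Fin n →₀ ℕ))) ∧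
        (∀ j, φ j = ellOne.twist (homologicalMultiplier μ j h)
          (substSeries (c j) (ellOne.var + φ))) ∧
        NormedSpace.exp (((Real.log ‖μ i₀‖ : ℝ) : ℂ) • h) - 1 = (μ i₀)⁻¹ •
          ellOne.quot i₀ (invariantExponents μ) (substSeries (c i₀) (ellOne.var + φ)) := by
  obtain ⟨c₀, hc₀, hcμ⟩ := exists_le_norm_monomialAt_sub hμ hi₀ hr
  obtain ⟨ε₁, hε₁, M, hM0, hM⟩ := exists_homologicalMultiplier_bound hμ hc₀ hcμ
  set l : ℝ := Real.log ‖μ i₀‖ with hl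
  have hl0 : 0 < |l| := abs_pos.2 hi₀
  have hlC : ((l : ℝ) : ℂ) ≠ 0 := by exact_mod_cast hi₀
  -- One quarter for the nonlinear part of the exponential leaves one quarter for the substitution
  -- term, out of a contraction constant of one half.
  obtain ⟨ε₂, hε₂, hexp⟩ := exists_norm_banachExp_sub_sub_le (ellOne n) (δ := 1 / 4) (by norm_num)
  set ε : ℝ := min (min ε₁ 1) (ε₂ / |l|) with hε
  have hε0 : 0 < ε := lt_min (lt_min hε₁ one_pos) (div_pos hε₂ hl0)
  have hεε₁ : ε ≤ ε₁ := (min_le_left _ _).trans (min_le_left _ _)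
  have hεone : ε ≤ 1 := (min_le_left _ _).trans (min_le_right _ _)
  have hεε₂ : |l| * ε ≤ ε₂ := by
    have : ε ≤ ε₂ / |l| := min_le_right _ _
    rw [le_div_iff₀ hl0] at this
    linarith
  set a : ℝ := |l|⁻¹ * ‖μ i₀‖⁻¹ with ha
  have ha0 : 0 ≤ a := by positivity
  -- Both `κ * M` and `κ * a` are at most 1/4, which gives the Lipschitz constants `2 * κ * M` and
  -- `κ * a + 1 / 4`, and at most `ε / 2`, which bounds `T 0`.
  set κ : ℝ := min (1 / 4) (ε / 2) / (M + a + 1) with hκ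
  have hκ0 : 0 < κ := div_pos (lt_min (by norm_num) (half_pos hε0)) (by positivity)
  have hκle : κ * (M + a + 1) ≤ min (1 / 4) (ε / 2) := by
    rw [hκ, div_mul_cancel₀ _ (by positivity)]
  have hκ1 := hκle.trans (min_le_left _ _)
  have hκ2 := hκle.trans (min_le_right _ _)
  have hκM : 0 ≤ κ * M := by positivity
  have hκa : 0 ≤ κ * a := by positivity
  refine ⟨κ, hκ0, fun c hc => ?_⟩
  choose K hK hcK using hc
  set Sf : (Fin n → ellOne n) → Fin n → ellOne n := fun φ j =>
    substSeries (c j) (ellOne.var + φ) with hSf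
  set Q : ellOne n → ellOne n := ellOne.quot i₀ (invariantExponents μ) with hQ
  -- The equation e^{lh} - 1 = μ_{i₀}⁻¹ Q is rewritten as h = l⁻¹ (μ_{i₀}⁻¹ Q - (e^{lh} - 1 - lh))
  -- to make it a contraction in `h`.
  set T : (Fin n → ellOne n) × ellOne n → (Fin n → ellOne n) × ellOne n := fun z =>
    (fun j => ellOne.twist (homologicalMultiplier μ j z.2) (Sf z.1 j),
      ((l : ℝ) : ℂ)⁻¹ • ((μ i₀)⁻¹ • Q (Sf z.1 i₀) -
        (NormedSpace.exp (((l : ℝ) : ℂ) • z.2) - 1 - ((l : ℝ) : ℂ) • z.2))) with hT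
  have hz2 : ∀ φ : Fin n → ellOne n, ‖φ‖ ≤ ε → ‖(ellOne.var + φ : Fin n → ellOne n)‖ ≤ 2 :=
    fun φ hφ => (norm_add_le _ _).trans (by linarith [ellOne.norm_var_fun_le (n := n)])
  have hS1 : ∀ φ : Fin n → ellOne n, ‖φ‖ ≤ ε → ∀ j, ‖Sf φ j‖ ≤ κ := fun φ hφ j =>
    (norm_substSeries_le (hcK j) (hz2 φ hφ)).trans (hK j)
  have hS2 : ∀ φ φ' : Fin n → ellOne n, ‖φ‖ ≤ ε → ‖φ'‖ ≤ ε → ∀ j,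
      ‖Sf φ j - Sf φ' j‖ ≤ κ * ‖φ - φ'‖ := fun φ φ' hφ hφ' j => by
    have h1 := norm_substSeries_sub_le (hcK j) (hz2 φ hφ) (hz2 φ' hφ')
    rw [add_sub_add_left_eq_sub] at h1
    exact h1.trans (by gcongr; exact hK j)
  have hQn : ∀ s, ‖((l : ℝ) : ℂ)⁻¹ • ((μ i₀)⁻¹ • Q s)‖ ≤ a * ‖s‖ := fun s => by
    rw [norm_smul, norm_smul, norm_inv, norm_inv, Complex.norm_real, Real.norm_eq_abs, ha,
      mul_assoc]
    gcongr
    exact ellOne.norm_quot_le _ _ s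
  have hfst : ∀ z : (Fin n → ellOne n) × ellOne n, ‖z‖ ≤ ε → ‖z.1‖ ≤ ε :=
    fun z hz => (norm_fst_le z).trans hz
  have hsnd : ∀ z : (Fin n → ellOne n) × ellOne n, ‖z‖ ≤ ε → ‖z.2‖ ≤ ε :=
    fun z hz => (norm_snd_le z).trans hz
  set V : Set ((Fin n → ellOne n) × ellOne n) :=
    {z | (∀ j, z.1 j ∈ ellOne.supported (nonresonant μ j)) ∧
      z.2 ∈ ellOne.supported (invariantExponents μ)} with hV
  have hinv : ellOne.supported (invariantExponents μ) ≤
      ellOne.supported (trivialCharacter μ : Set (Fin n →₀ ℕ)) :=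
    ellOne.supported_mono fun m hm => hm.1
  have hVc : IsClosed V := by
    have h1 : V = (⋂ j, (fun z : (Fin n → ellOne n) × ellOne n => z.1 j) ⁻¹'
        (ellOne.supported (nonresonant μ j) : Set (ellOne n))) ∩
        (fun z : (Fin n → ellOne n) × ellOne n => z.2) ⁻¹'
          (ellOne.supported (invariantExponents μ) : Set (ellOne n)) := by
      ext z
      simp [hV]
    rw [h1]
    exact (isClosed_iInter fun j => (ellOne.isClosed_supported _).preimage (by fun_prop)).inter
      ((ellOne.isClosed_supported _).preimage continuous_snd)
  have hTV : ∀ z ∈ V, ‖z‖ ≤ ε → T z ∈ V := by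
    rintro z ⟨hz1, hz2⟩ hzε
    have hbm := fun j => (hM j z.2 ((hsnd z hzε).trans hεε₁)).2.2.1 (hinv hz2)
    refine ⟨fun j => ellOne.tsum_mem_supported fun m => Submodule.smul_mem _ _ ?_,
      Submodule.smul_mem _ _ (sub_mem (Submodule.smul_mem _ _ (ellOne.quot_mem_supported _ _ _))
        ?_)⟩
    · by_cases hm : m ∈ nonresonant μ j
      · refine ellOne.mul_mem_supported ?_ (ellOne.prodPow_var_mem_supported hm) (hbm j m)
        -- Adding an exponent with μ^q = 1 changes neither the character nor the lower bound on the
        -- degree, so the monomial stays nonresonant.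
        rintro p ⟨hp1, hp2⟩ q (hq : monomialAt μ q = 1)
        refine ⟨?_, ?_⟩
        · rw [totalDeg_add]; omega
        · rwa [monomialAt_add, hq, mul_one]
      · rw [homologicalMultiplier, if_neg hm, mul_zero]
        exact zero_mem _
    · have h1 : NormedSpace.exp (((l : ℝ) : ℂ) • z.2) - 1 - ((l : ℝ) : ℂ) • z.2 ∈
          ellOne.supportedAlg (trivialCharacter μ) := by
        have h2 : ((l : ℝ) : ℂ) • z.2 ∈ ellOne.supportedAlg (trivialCharacter μ) :=
          Subalgebra.smul_mem _ (hinv hz2) _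
        exact sub_mem (sub_mem (banachExp_mem (ellOne.isClosed_supportedAlg _) h2) (one_mem _)) h2
      have h3 : ellOne.coeff 0 z.2 = 0 := hz2 0 fun h => h.2 rfl
      intro m hm
      by_cases hm0 : m = 0
      · subst hm0
        rw [← ellOne.eval_zero_eq_coeff, map_sub, map_sub, map_one,
          map_banachExp _ (ellOne.continuous_eval _ _), map_smul, ellOne.eval_zero_eq_coeff, h3]
        simp
      · exact h1 m fun h => hm ⟨h, hm0⟩
  have hT0 : ‖T 0‖ ≤ ε / 2 := by
    have h00 : ‖(0 : Fin n → ellOne n)‖ ≤ ε := by simpa using hε0.le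
    rw [Prod.norm_def, max_le_iff]
    refine ⟨(pi_norm_le_iff_of_nonneg (half_pos hε0).le).2 fun j => ?_, ?_⟩
    · have h1 := ellOne.norm_twist_le (hM j 0 (by simpa using hε₁.le)).2.1 (Sf 0 j)
      calc _ ≤ _ := h1
        _ ≤ κ * M := by gcongr; exact hS1 0 h00 j
        _ ≤ ε / 2 := by nlinarith
    · have h1 : (T 0).2 = ((l : ℝ) : ℂ)⁻¹ • ((μ i₀)⁻¹ • Q (Sf 0 i₀)) := by
        simp [hT, NormedSpace.exp_zero]
      rw [h1]
      calc _ ≤ _ := hQn _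
        _ ≤ a * κ := by gcongr; exact hS1 0 h00 _
        _ ≤ ε / 2 := by nlinarith
  have hTL : ∀ z z', ‖z‖ ≤ ε → ‖z'‖ ≤ ε → ‖T z - T z'‖ ≤ 1 / 2 * ‖z - z'‖ := by
    intro z z' hz hz'
    have hd1 : ‖z.1 - z'.1‖ ≤ ‖z - z'‖ := norm_fst_le (z - z')
    have hd2 : ‖z.2 - z'.2‖ ≤ ‖z - z'‖ := norm_snd_le (z - z')
    have hd0 : 0 ≤ ‖z - z'‖ := norm_nonneg _
    rw [Prod.norm_def, max_le_iff]
    refine ⟨(pi_norm_le_iff_of_nonneg (by positivity)).2 fun j => ?_, ?_⟩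
    · obtain ⟨-, hb, -, hbL⟩ := hM j z.2 ((hsnd z hz).trans hεε₁)
      obtain ⟨-, hb', -, -⟩ := hM j z'.2 ((hsnd z' hz').trans hεε₁)
      have h1 := ellOne.norm_twist_sub_twist_le hb hb' (hbL z'.2 ((hsnd z' hz').trans hεε₁))
        (Sf z.1 j) (Sf z'.1 j)
      calc _ ≤ _ := h1
        _ ≤ κ * ‖z - z'‖ * M + κ * (M * ‖z - z'‖) := by
            gcongr
            · exact (hS2 _ _ (hfst z hz) (hfst z' hz') j).trans (by gcongr)
            · exact hS1 _ (hfst z' hz') j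
        _ = 2 * (κ * M) * ‖z - z'‖ := by ring
        _ ≤ _ := by gcongr; linarith
    · set d := (NormedSpace.exp (((l : ℝ) : ℂ) • z.2) - 1 - ((l : ℝ) : ℂ) • z.2) -
        (NormedSpace.exp (((l : ℝ) : ℂ) • z'.2) - 1 - ((l : ℝ) : ℂ) • z'.2) with hd
      have h1 : (T z - T z').2 = ((l : ℝ) : ℂ)⁻¹ • ((μ i₀)⁻¹ • Q (Sf z.1 i₀ - Sf z'.1 i₀)) -
          ((l : ℝ) : ℂ)⁻¹ • d := by
        rw [hQ, ← ellOne.quot_sub]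
        simp only [hT, Prod.snd_sub, hd, smul_sub]
        abel
      have hln : ∀ w : ellOne n, ‖w‖ ≤ ε → ‖((l : ℝ) : ℂ) • w‖ ≤ ε₂ := fun w hw =>
        (norm_smul_le_of_le hw).trans hεε₂
      have h2 := hexp _ _ (hln z.2 (hsnd z hz)) (hln z'.2 (hsnd z' hz'))
      rw [← smul_sub, norm_smul, Complex.norm_real, Real.norm_eq_abs] at h2
      have h3 : ‖((l : ℝ) : ℂ)⁻¹ • d‖ ≤ 1 / 4 * ‖z - z'‖ := by
        rw [norm_smul, norm_inv, Complex.norm_real, Real.norm_eq_abs, inv_mul_le_iff₀ hl0]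
        calc _ ≤ _ := h2
          _ ≤ 1 / 4 * (|l| * ‖z - z'‖) := by gcongr
          _ = _ := by ring
      rw [h1]
      calc _ ≤ _ := norm_sub_le _ _
        _ ≤ a * (κ * ‖z - z'‖) + 1 / 4 * ‖z - z'‖ := by
            gcongr
            refine (hQn _).trans ?_
            gcongr
            exact (hS2 _ _ (hfst z hz) (hfst z' hz') _).trans (by gcongr)
        _ = (κ * a + 1 / 4) * ‖z - z'‖ := by ring
        _ ≤ _ := by gcongr; linarith
  obtain ⟨z, hzV, hzε, hfix⟩ := exists_fixedPoint_of_lipschitz_half hε0.le hVc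
    ⟨fun j => zero_mem _, zero_mem _⟩ hTV hT0 hTL
  have hMz := fun j => hM j z.2 ((hsnd z hzε).trans hεε₁)
  refine ⟨z.1, z.2, (hfst z hzε).trans hεone, hzV.1, hzV.2, fun j => (hMz j).1,
    ⟨M, fun j => (hMz j).2.1⟩, fun j => (hMz j).2.2.1 (hinv hzV.2), fun j => ?_, ?_⟩
  · exact (congrFun (congrArg Prod.fst hfix) j).symm
  · have h1 : ((l : ℝ) : ℂ)⁻¹ • ((μ i₀)⁻¹ • Q (Sf z.1 i₀) -
        (NormedSpace.exp (((l : ℝ) : ℂ) • z.2) - 1 - ((l : ℝ) : ℂ) • z.2)) = z.2 :=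
      congrArg Prod.snd hfix
    rw [inv_smul_eq_iff₀ hlC] at h1
    rw [← sub_eq_zero] at h1 ⊢
    rw [← neg_eq_zero, ← h1]
    abel


/-! ### From summable series to germs; the exponential scaling map. -/

theorem ConsistsOfMonomials.congr {n : ℕ} {g g' : (Fin n → ℂ) → ℂ} {S : (Fin n →₀ ℕ) → Prop}
    (h : ConsistsOfMonomials g S) (h' : ∀ᶠ x in 𝓝 0, g x = g' x) : ConsistsOfMonomials g' S := by
  obtain ⟨c, hc, hS⟩ := h
  refine ⟨c, ?_, hS⟩
  filter_upwards [hc, h'] with x hx hx'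
  rwa [← hx']

theorem ConsistsOfMonomials.mono {n : ℕ} {g : (Fin n → ℂ) → ℂ} {S S' : (Fin n →₀ ℕ) → Prop}
    (h : ConsistsOfMonomials g S) (hS : ∀ m, S m → S' m) : ConsistsOfMonomials g S' := by
  obtain ⟨c, hc, hcS⟩ := h
  exact ⟨c, hc, fun m hm => hS m (hcS m hm)⟩

theorem ConsistsOfMonomials.analyticAt {n : ℕ} {g : (Fin n → ℂ) → ℂ} {S : (Fin n →₀ ℕ) → Prop}
    (h : ConsistsOfMonomials g S) : AnalyticAt ℂ g 0 := by
  obtain ⟨c, hc, -⟩ := h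
  exact hc.analyticAt

theorem monomialAt_zero_vec {n : ℕ} {m : Fin n →₀ ℕ} (hm : m ≠ 0) :
    monomialAt (0 : Fin n → ℂ) m = 0 := by
  obtain ⟨i, hi⟩ : ∃ i, m i ≠ 0 := by
    by_contra! h
    exact hm (Finsupp.ext h)
  rw [monomialAt, Finset.prod_eq_zero (Finset.mem_univ i) (by simp [hi])]

theorem ConsistsOfMonomials.apply_zero {n : ℕ} {g : (Fin n → ℂ) → ℂ} {S : (Fin n →₀ ℕ) → Prop}
    (h : ConsistsOfMonomials g S) (hS : ¬ S 0) : g 0 = 0 := by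
  obtain ⟨c, hc, hcS⟩ := h
  refine (hc.self_of_nhds).unique ?_
  convert hasSum_zero with m
  by_cases hm : m = 0
  · have h0 : MvPowerSeries.coeff m c = 0 := by
      by_contra h1
      exact hS (hm ▸ hcS m h1)
    rw [h0, zero_mul]
  · rw [monomialAt_zero_vec hm, mul_zero]

theorem tendsto_smul_vec_zero {n : ℕ} (r : ℂ) :
    Tendsto (fun x : Fin n → ℂ => r • x) (𝓝 0) (𝓝 0) := by
  have : Continuous fun x : Fin n → ℂ => r • x := by fun_prop
  simpa using this.tendsto 0

theorem ConsistsOfMonomials.comp_smul {n : ℕ} {g : (Fin n → ℂ) → ℂ} {S : (Fin n →₀ ℕ) → Prop}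
    (h : ConsistsOfMonomials g S) (r : ℂ) : ConsistsOfMonomials (fun x => g (r • x)) S := by
  obtain ⟨c, hc, hS⟩ := h
  refine ⟨(fun m => r ^ totalDeg m * MvPowerSeries.coeff m c : MvPowerSeries (Fin n) ℂ), ?_,
    fun m hm => hS m (right_ne_zero_of_mul hm)⟩
  filter_upwards [(tendsto_smul_vec_zero r).eventually hc] with x hx
  convert hx using 1
  funext m
  rw [monomialAt_smul_vec]
  change r ^ totalDeg m * MvPowerSeries.coeff m c * monomialAt x m = _
  ring

theorem one_le_totalDeg {n : ℕ} {m : Fin n →₀ ℕ} (hm : m ≠ 0) : 1 ≤ totalDeg m := by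
  by_contra! h
  refine hm (Finsupp.ext fun i => ?_)
  have h1 : totalDeg m = 0 := by omega
  exact Finset.sum_eq_zero_iff.1 h1 i (Finset.mem_univ i)

namespace ellOne

variable {n : ℕ}

/-- The sum of a power series, as a function. -/
noncomputable def toFun (a : ellOne n) (y : Fin n → ℂ) : ℂ := ∑' m, coeff m a * monomialAt y m

theorem toFun_eq_eval (a : ellOne n) {y : Fin n → ℂ} (hy : ‖y‖ ≤ 1) : toFun a y = eval y hy a :=
  (hasSum_eval y hy a).tsum_eq

theorem eventually_norm_le_one : ∀ᶠ y in 𝓝 (0 : Fin n → ℂ), ‖y‖ ≤ 1 := by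
  filter_upwards [Metric.closedBall_mem_nhds (0 : Fin n → ℂ) one_pos] with y hy
  exact mem_closedBall_zero_iff.1 hy

theorem hasTaylorSeries_toFun (a : ellOne n) : HasTaylorSeries (toFun a) a.1 := by
  filter_upwards [eventually_norm_le_one] with y hy
  rw [toFun_eq_eval a hy]
  exact hasSum_eval y hy a

theorem consistsOfMonomials_toFun {S : Set (Fin n →₀ ℕ)} {a : ellOne n} (ha : a ∈ supported S) :
    ConsistsOfMonomials (toFun a) (fun m => m ∈ S) :=
  ⟨a.1, hasTaylorSeries_toFun a, fun m hm => by
    by_contra h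
    exact hm (ha m h)⟩

theorem eval_eq_of_monomialAt_eq {S : Set (Fin n →₀ ℕ)} {a : ellOne n} (ha : a ∈ supported S)
    {y y' : Fin n → ℂ} (hy : ‖y‖ ≤ 1) (hy' : ‖y'‖ ≤ 1)
    (h : ∀ m ∈ S, monomialAt y m = monomialAt y' m) : eval y hy a = eval y' hy' a := by
  refine (hasSum_eval y hy a).unique ?_
  convert hasSum_eval y' hy' a using 2 with m
  by_cases hm : m ∈ S
  · rw [h m hm]
  · rw [ha m hm, zero_mul, zero_mul]

theorem exp_sub_one_mem_supported {S : AddSubmonoid (Fin n →₀ ℕ)} {a : ellOne n}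
    (ha : a ∈ supported {m | m ∈ S ∧ m ≠ 0}) :
    NormedSpace.exp a - 1 ∈ supported {m | m ∈ S ∧ m ≠ 0} := by
  have h1 : NormedSpace.exp a - 1 ∈ supportedAlg S :=
    sub_mem (banachExp_mem (isClosed_supportedAlg S)
      (supported_mono (fun m hm => hm.1) ha)) (one_mem _)
  have h3 : coeff 0 a = 0 := ha 0 fun h => h.2 rfl
  intro m hm
  by_cases hm0 : m = 0
  · subst hm0
    rw [← eval_zero_eq_coeff, map_sub, map_one, map_banachExp _ (continuous_eval _ _),
      eval_zero_eq_coeff, h3]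
    simp
  · exact h1 m fun h => hm ⟨h, hm0⟩

/-- A dilation brings any convergent Taylor series into the algebra of summable series. Facts about
monomial supports proved there thus hold for germs. -/
theorem exists_supported_of_consistsOfMonomials {S : (Fin n →₀ ℕ) → Prop} {g : (Fin n → ℂ) → ℂ}
    (h : ConsistsOfMonomials g S) : ∃ r : ℂ, r ≠ 0 ∧ ∃ a ∈ supported {m | S m},
      ∀ᶠ y in 𝓝 0, g (r • y) = toFun a y := by
  obtain ⟨c, hc, hS⟩ := h
  obtain ⟨ρ, hρ, hsum, -⟩ := hc.exists_summable
  have hs : Summable fun m => ‖((ρ : ℂ) ^ totalDeg m) * MvPowerSeries.coeff m c‖ := by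
    refine hsum.congr fun m => ?_
    rw [norm_mul, norm_pow, Complex.norm_real, Real.norm_eq_abs, abs_of_pos hρ, mul_comm]
  refine ⟨ρ, by exact_mod_cast hρ.ne', mk _ hs, fun m hm => ?_, ?_⟩
  · rw [coeff_mk]
    by_contra h1
    exact hm (hS m (right_ne_zero_of_mul h1))
  · filter_upwards [(tendsto_smul_vec_zero (ρ : ℂ)).eventually hc] with x hx
    rw [toFun, ← hx.tsum_eq]
    refine tsum_congr fun m => ?_
    rw [monomialAt_smul_vec, coeff_mk]
    ring

theorem substSeries_mem_supported {c : (Fin n →₀ ℕ) → ℂ} (hc : ∀ m, c m ≠ 0 → 2 ≤ totalDeg m)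
    {z : Fin n → ellOne n} (hz : ∀ i, z i ∈ supported {m | 1 ≤ totalDeg m}) :
    substSeries c z ∈ supported {m | 2 ≤ totalDeg m} := by
  have h1 : ∀ m, prodPow z m ∈ supported {k | totalDeg m ≤ totalDeg k} := by
    intro m
    induction m using exponent_induction with
    | zero =>
      rw [prodPow_zero, ← map_one (algebraMap ℂ (ellOne n))]
      exact algebraMap_mem_supported (S := {k | totalDeg (0 : Fin n →₀ ℕ) ≤ totalDeg k})
        (le_refl (totalDeg 0)) _
    | add m i ih =>
      rw [prodPow_add, prodPow_single_one]
      refine mul_mem_supported (fun a ha b hb => ?_) ih (hz i)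
      simp only [Set.mem_ofPred_eq, totalDeg_add, totalDeg_single] at ha hb ⊢
      omega
  refine tsum_mem_supported fun m => ?_
  by_cases h : c m = 0
  · rw [h, zero_smul]; exact zero_mem _
  · exact Submodule.smul_mem _ _ (supported_mono (fun k hk => (hc m h).trans hk) (h1 m))

end ellOne

/-- The map `y ↦ (μ_i y_i e ^ {λ_i h(y)})` with `λ_i = log |μ_i|`. -/
noncomputable def expScaling {n : ℕ} (μ : Fin n → ℂ) (h : (Fin n → ℂ) → ℂ) :
    (Fin n → ℂ) → (Fin n → ℂ) :=
  fun y i => μ i * y i * Complex.exp (((Real.log ‖μ i‖ : ℝ) : ℂ) * h y)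

/-- The exponents log |μ_i| are additive along monomials. In particular a monomial with μ^m = 1 is
unchanged by the scaling map. -/
theorem monomialAt_expScaling {n : ℕ} {μ : Fin n → ℂ} (hμ : ∀ i, μ i ≠ 0)
    (h : (Fin n → ℂ) → ℂ) (y : Fin n → ℂ) (m : Fin n →₀ ℕ) :
    monomialAt (expScaling μ h y) m = monomialAt μ m * monomialAt y m *
      Complex.exp (((Real.log ‖monomialAt μ m‖ : ℝ) : ℂ) * h y) := by
  have h1 : monomialAt (fun i => Complex.exp (((Real.log ‖μ i‖ : ℝ) : ℂ) * h y)) m =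
      Complex.exp (((Real.log ‖monomialAt μ m‖ : ℝ) : ℂ) * h y) := by
    rw [monomialAt, log_norm_monomialAt hμ]
    simp only [← Complex.exp_nat_mul]
    rw [← Complex.exp_sum]
    congr 1
    push_cast
    rw [Finset.sum_mul]
    exact Finset.sum_congr rfl fun i _ => by ring
  rw [← h1, ← monomialAt_mul, ← monomialAt_mul]
  rfl

theorem continuousAt_expScaling {n : ℕ} (μ : Fin n → ℂ) {h : (Fin n → ℂ) → ℂ}
    (hh : ContinuousAt h 0) : ContinuousAt (expScaling μ h) 0 := by
  exact continuousAt_pi.2 fun i => (continuousAt_const.mul (continuous_apply i).continuousAt).mul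
    (Complex.continuous_exp.continuousAt.comp (continuousAt_const.mul hh))

theorem expScaling_zero {n : ℕ} (μ : Fin n → ℂ) (h : (Fin n → ℂ) → ℂ) : expScaling μ h 0 = 0 := by
  funext i
  simp [expScaling]

theorem consistsOfMonomials_exp_sub_one {n : ℕ} {μ : Fin n → ℂ} {h : (Fin n → ℂ) → ℂ}
    (hh : ConsistsOfMonomials h (fun m => m ∈ invariantExponents μ)) (l : ℂ) :
    ConsistsOfMonomials (fun y => Complex.exp (l * h y) - 1)
      (fun m => m ∈ invariantExponents μ) := by
  obtain ⟨r, hr, a, ha, hae⟩ := ellOne.exists_supported_of_consistsOfMonomials hh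
  have h1 : NormedSpace.exp (l • a) - 1 ∈ ellOne.supported (invariantExponents μ) :=
    ellOne.exp_sub_one_mem_supported (S := trivialCharacter μ) (Submodule.smul_mem _ _ ha)
  refine ((ellOne.consistsOfMonomials_toFun h1).comp_smul r⁻¹).congr ?_
  filter_upwards [(tendsto_smul_vec_zero r⁻¹).eventually
    (hae.and ellOne.eventually_norm_le_one)] with y hy
  obtain ⟨hy1, hy2⟩ := hy
  rw [smul_smul, mul_inv_cancel₀ hr, one_smul, ellOne.toFun_eq_eval _ hy2] at hy1
  rw [ellOne.toFun_eq_eval _ hy2, map_sub, map_one, map_banachExp _ (ellOne.continuous_eval _ _),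
    map_smul, ← hy1, smul_eq_mul]

theorem ConsistsOfMonomials.monomial_mul {n : ℕ} {g : (Fin n → ℂ) → ℂ} {S : (Fin n →₀ ℕ) → Prop}
    (h : ConsistsOfMonomials g S) (m : Fin n →₀ ℕ) :
    ConsistsOfMonomials (fun y => monomialAt y m * g y) (fun k => ∃ b, S b ∧ k = m + b) := by
  obtain ⟨r, hr, a, ha, hae⟩ := ellOne.exists_supported_of_consistsOfMonomials h
  have h1 : prodPow ellOne.var m * a ∈ ellOne.supported {k | ∃ b, S b ∧ k = m + b} :=
    ellOne.mul_mem_supported (S := {m}) (T := {b | S b}) (U := {k | ∃ b, S b ∧ k = m + b})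
      (fun p (hp : p = m) b hb => ⟨b, hb, by rw [hp]⟩) (ellOne.prodPow_var_mem_supported rfl) ha
  refine (((ellOne.consistsOfMonomials_toFun h1).comp_smul r⁻¹).const_mul (r ^ totalDeg m)).congr ?_
  filter_upwards [(tendsto_smul_vec_zero r⁻¹).eventually
    (hae.and ellOne.eventually_norm_le_one)] with y hy
  obtain ⟨hy1, hy2⟩ := hy
  rw [smul_smul, mul_inv_cancel₀ hr, one_smul, ellOne.toFun_eq_eval _ hy2] at hy1
  rw [ellOne.toFun_eq_eval _ hy2, map_mul, ellOne.eval_prodPow_var, ← hy1, monomialAt_smul_vec,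
    inv_pow, ← mul_assoc, ← mul_assoc, mul_inv_cancel₀ (pow_ne_zero _ hr), one_mul]

theorem consistsOfMonomials_monomialAt {n : ℕ} (m : Fin n →₀ ℕ) :
    ConsistsOfMonomials (fun y => monomialAt y m) (fun k => k = m) := by
  refine (ellOne.consistsOfMonomials_toFun (S := {m})
    (ellOne.prodPow_var_mem_supported rfl)).congr ?_
  filter_upwards [ellOne.eventually_norm_le_one] with y hy
  rw [ellOne.toFun_eq_eval _ hy, ellOne.eval_prodPow_var]

theorem consistsOfMonomials_zero {n : ℕ} (S : (Fin n →₀ ℕ) → Prop) :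
    ConsistsOfMonomials (fun _ => 0) S :=
  ⟨0, Eventually.of_forall fun x => by simp,
    fun m hm => absurd (map_zero _) hm⟩

theorem ConsistsOfMonomials.sub {n : ℕ} {g g' : (Fin n → ℂ) → ℂ} {S : (Fin n →₀ ℕ) → Prop}
    (h : ConsistsOfMonomials g S) (h' : ConsistsOfMonomials g' S) :
    ConsistsOfMonomials (fun x => g x - g' x) S := by
  refine (ConsistsOfMonomials.sum (Finset.univ : Finset Bool)
    (g := fun b => if b then g else fun x => (-1) * g' x) fun b _ => ?_).congr
      (Eventually.of_forall fun x => ?_)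
  · cases b
    · exact h'.const_mul (-1)
    · exact h
  · simp [sub_eq_add_neg]

theorem consistsOfMonomials_expScaling_sub {n : ℕ} {μ : Fin n → ℂ} {h : (Fin n → ℂ) → ℂ}
    (hh : ConsistsOfMonomials h (fun m => m ∈ invariantExponents μ)) (i : Fin n) :
    ConsistsOfMonomials (fun y => expScaling μ h y i - μ i * y i)
      (fun m => 2 ≤ totalDeg m ∧ monomialAt μ m = μ i) := by
  have h1 := ((consistsOfMonomials_exp_sub_one hh ((Real.log ‖μ i‖ : ℝ) : ℂ)).monomial_mul
    (Finsupp.single i 1)).const_mul (μ i)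
  refine (h1.mono ?_).congr (Eventually.of_forall fun y => ?_)
  · rintro m ⟨b, ⟨hb1, hb0⟩, rfl⟩
    have := one_le_totalDeg hb0
    rw [totalDeg_add, totalDeg_single, monomialAt_add, monomialAt_single, hb1]
    exact ⟨by omega, by simp⟩
  · simp only [monomialAt_single, pow_one, expScaling]
    ring

/-- Scaling multiplies y^m by an invariant series, so the difference consists of monomials with the
character of `m`; it vanishes identically when that character is 1. This is the condition on the
model map in `lead_error_tangent`. -/
theorem consistsOfMonomials_sub_monomialAt_expScaling {n : ℕ} {μ : Fin n → ℂ}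
    (hμ : ∀ i, μ i ≠ 0) {h : (Fin n → ℂ) → ℂ}
    (hh : ConsistsOfMonomials h (fun m => m ∈ invariantExponents μ)) (m : Fin n →₀ ℕ) :
    ConsistsOfMonomials (fun y => monomialAt y m - monomialAt (expScaling μ h y) m)
      (fun m' => monomialAt μ m' ≠ 1) := by
  by_cases hm : monomialAt μ m = 1
  · refine (consistsOfMonomials_zero _).congr (Eventually.of_forall fun y => ?_)
    rw [monomialAt_expScaling hμ, hm]
    simp
  · set l : ℂ := ((Real.log ‖monomialAt μ m‖ : ℝ) : ℂ) with hl
    have h1 : ConsistsOfMonomials (fun y => monomialAt y m * (Complex.exp (l * h y) - 1))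
        (fun m' => monomialAt μ m' ≠ 1) := by
      refine ((consistsOfMonomials_exp_sub_one hh l).monomial_mul m).mono ?_
      rintro k ⟨b, ⟨hb, -⟩, rfl⟩
      rwa [monomialAt_add, hb, mul_one]
    have h2 : ConsistsOfMonomials (fun y => monomialAt y m) (fun m' => monomialAt μ m' ≠ 1) :=
      (consistsOfMonomials_monomialAt m).mono fun k hk => by rwa [hk]
    refine ((h2.const_mul (1 - monomialAt μ m)).sub (h1.const_mul (monomialAt μ m))).congr
      (Eventually.of_forall fun y => ?_)
    rw [monomialAt_expScaling hμ]
    ring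


/-! ### The homological equation and the partial normalization. -/

namespace ellOne

variable {n : ℕ}

theorem proj_mem_supported {S T U : Set (Fin n →₀ ℕ)} {s : ellOne n} (hs : s ∈ supported T)
    (h : ∀ m, m ∈ S → m ∈ T → m ∈ U) : proj S s ∈ supported U := by
  intro m hm
  rw [coeff_proj]
  by_cases h1 : m ∈ S
  · rw [Set.indicator_of_mem h1]
    exact hs m fun h2 => hm (h m h1 h2)
  · exact Set.indicator_of_notMem h1 _

theorem proj_add_proj_compl (S : Set (Fin n →₀ ℕ)) (s : ellOne n) :
    proj S s + proj Sᶜ s = s := by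
  refine ext fun m => ?_
  rw [map_add, coeff_proj, coeff_proj]
  exact congrFun (Set.indicator_self_add_compl S fun m => coeff m s) m

theorem eval_proj {y : Fin n → ℂ} (hy : ‖y‖ ≤ 1) (S : Set (Fin n →₀ ℕ)) (s : ellOne n) :
    HasSum (S.indicator fun m => coeff m s * monomialAt y m) (eval y hy (proj S s)) := by
  convert hasSum_eval y hy (proj S s) using 1
  funext m
  rw [coeff_proj]
  by_cases h : m ∈ S <;> simp [h]

/-- The homological equation. -/
theorem eval_twist_homologicalMultiplier {μ : Fin n → ℂ} (hμ : ∀ i, μ i ≠ 0) {h : ellOne n}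
    {j : Fin n}
    (hunit : ∀ m ∈ nonresonant μ j, IsUnit (algebraMap ℂ (ellOne n) (monomialAt μ m) *
      NormedSpace.exp (((Real.log ‖monomialAt μ m‖ : ℝ) : ℂ) • h) -
        algebraMap ℂ (ellOne n) (μ j))) {M : ℝ} (hM : ∀ m, ‖homologicalMultiplier μ j h m‖ ≤ M)
    (hinv : ∀ m, homologicalMultiplier μ j h m ∈
      supported (trivialCharacter μ : Set (Fin n →₀ ℕ))) (s : ellOne n)
    {y : Fin n → ℂ} (hy : ‖y‖ ≤ 1) (hGy : ‖expScaling μ (toFun h) y‖ ≤ 1) :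
    eval _ hGy (twist (homologicalMultiplier μ j h) s) =
      μ j * eval y hy (twist (homologicalMultiplier μ j h) s) +
        eval y hy (proj (nonresonant μ j) s) := by
  have hmap : ∀ z (hz : ‖z‖ ≤ 1), HasSum (fun m => coeff m s * (monomialAt z m *
      eval z hz (homologicalMultiplier μ j h m)))
      (eval z hz (twist (homologicalMultiplier μ j h) s)) := by
    intro z hz
    have h1 := (hasSum_twist hM s).map (eval z hz) (continuous_eval z hz)
    convert h1 using 1
    funext m
    simp only [Function.comp_apply, map_smul, map_mul, eval_prodPow_var, smul_eq_mul]
  refine (hmap _ hGy).unique ?_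
  have h0 := ((hmap y hy).mul_left (μ j)).add (eval_proj hy (nonresonant μ j) s)
  refine Eq.mp (congrArg (fun f => HasSum f _) (funext fun m => ?_)) h0
  symm
  -- The multiplier is a series in monomials with μ^k = 1, hence invariant under the scaling map.
  -- The homological equation therefore becomes multiplicative, one monomial at a time.
  have hev : eval _ hGy (homologicalMultiplier μ j h m) =
      eval y hy (homologicalMultiplier μ j h m) := by
    refine eval_eq_of_monomialAt_eq (hinv m) _ _ fun k (hk : monomialAt μ k = 1) => ?_
    rw [monomialAt_expScaling hμ, hk]
    simp
  rw [hev, monomialAt_expScaling hμ, toFun_eq_eval h hy]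
  by_cases hm : m ∈ nonresonant μ j
  · rw [Set.indicator_of_mem hm]
    have h1 := Ring.inverse_mul_cancel _ (hunit m hm)
    have h2 := congrArg (eval y hy) h1
    have h3 : homologicalMultiplier μ j h m =
        expResolvent (monomialAt μ m) (μ j) (Real.log ‖monomialAt μ m‖) h := if_pos hm
    rw [← expResolvent, ← h3, map_mul, map_sub, map_mul, map_banachExp _ (continuous_eval _ _),
      map_smul, map_one, AlgHom.commutes, AlgHom.commutes] at h2
    simp only [Algebra.algebraMap_self, RingHom.id_apply, smul_eq_mul] at h2
    linear_combination (coeff m s * monomialAt y m) * h2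
  · rw [Set.indicator_of_notMem hm, homologicalMultiplier, if_neg hm]
    simp

/-- The resonant part of the component `j` of the conjugacy equation. -/
noncomputable def resonantError (μ : Fin n → ℂ) (j : Fin n) (h s : ellOne n) : ellOne n :=
  proj (nonresonant μ j)ᶜ s -
    μ j • (var j * (NormedSpace.exp (((Real.log ‖μ j‖ : ℝ) : ℂ) • h) - 1))

theorem resonantError_mem_supported {μ : Fin n → ℂ} {h s : ellOne n}
    (hh : h ∈ supported (invariantExponents μ)) (hs : s ∈ supported {m | 2 ≤ totalDeg m})
    (j : Fin n) :
    resonantError μ j h s ∈ supported {m | 2 ≤ totalDeg m ∧ monomialAt μ m = μ j} := by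
  refine sub_mem (proj_mem_supported hs fun m hm hm2 => ⟨hm2, ?_⟩) (Submodule.smul_mem _ _
    (mul_mem_supported (S := {Finsupp.single j 1}) (T := invariantExponents μ) ?_
      (var_mem_supported rfl) (exp_sub_one_mem_supported (S := trivialCharacter μ)
        (Submodule.smul_mem _ _ hh))))
  · by_contra h1
    exact hm ⟨hm2, h1⟩
  · rintro a rfl b ⟨hb1, hb0⟩
    have := one_le_totalDeg hb0
    refine ⟨?_, ?_⟩
    · rw [totalDeg_add, totalDeg_single]; omega
    · rw [monomialAt_add, hb1, monomialAt_single, pow_one, mul_one]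

/-- Resonant nonlinear monomials divisible by y_j are y_j y^k with k ≠ 0 and μ^k = 1, exactly those
collected by `quot`; the equation for `h` cancels them. -/
theorem coeff_resonantError_eq_zero {μ : Fin n → ℂ} (hμ : ∀ i, μ i ≠ 0) {h s : ellOne n}
    (hs : s ∈ supported {m | 2 ≤ totalDeg m}) {j : Fin n}
    (hj : NormedSpace.exp (((Real.log ‖μ j‖ : ℝ) : ℂ) • h) - 1 =
      (μ j)⁻¹ • quot j (invariantExponents μ) s) {m : Fin n →₀ ℕ} (hm : m j ≠ 0) :
    coeff m (resonantError μ j h s) = 0 := by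
  obtain ⟨k, rfl⟩ : ∃ k, m = k + Finsupp.single j 1 := by
    refine ⟨m - Finsupp.single j 1, (tsub_add_cancel_of_le ?_).symm⟩
    rw [Finsupp.single_le_iff]
    omega
  rw [resonantError, hj, mul_smul_comm, smul_smul, mul_inv_cancel₀ (hμ j), one_smul, map_sub,
    coeff_var_mul, coeff_quot, coeff_proj]
  have hχ : monomialAt μ (k + Finsupp.single j 1) = monomialAt μ k * μ j := by
    rw [monomialAt_add, monomialAt_single, pow_one]
  by_cases h2 : 2 ≤ totalDeg (k + Finsupp.single j 1)
  · have hk0 : k ≠ 0 := by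
      rintro rfl
      rw [totalDeg_add, totalDeg_zero, totalDeg_single] at h2
      omega
    by_cases hk : monomialAt μ k = 1
    · rw [Set.indicator_of_mem, Set.indicator_of_mem, sub_self]
      · exact ⟨hk, hk0⟩
      · exact fun h3 => h3.2 (by rw [hχ, hk, one_mul])
    · rw [Set.indicator_of_notMem, Set.indicator_of_notMem, sub_self]
      · exact fun h3 => hk h3.1
      · refine fun h3 => h3 ⟨h2, fun h4 => hk ?_⟩
        rw [hχ] at h4
        exact mul_right_cancel₀ (hμ j) (by rw [h4, one_mul])
  · have h3 : coeff (k + Finsupp.single j 1) s = 0 := hs _ h2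
    by_cases h4 : k ∈ invariantExponents μ <;>
      by_cases h5 : k + Finsupp.single j 1 ∈ (nonresonant μ j)ᶜ <;> simp [h3, h4, h5]

end ellOne

/-- A map with diagonal linear part and small nonlinear part is conjugate to a map
`y ↦ (μ_i y_i e ^ {λ_i h(y)})`, up to a resonant error term whose component `i₀` does not
depend on `y_{i₀}`. -/
theorem exists_small_partial_normalization {n : ℕ} {μ : Fin n → ℂ} (hμ : ∀ i, μ i ≠ 0)
    {i₀ : Fin n} (hi₀ : Real.log ‖μ i₀‖ ≠ 0) (hr : resonantRank μ = n - 1) :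
    ∃ κ > 0, ∀ (f : (Fin n → ℂ) → (Fin n → ℂ)) (c : Fin n → MvPowerSeries (Fin n) ℂ),
      (∀ j, HasTaylorSeries (fun x => f x j) (c j)) →
      (∀ j m, MvPowerSeries.coeff m (c j) ≠ 0 → 2 ≤ totalDeg m) →
      (∀ j, ∃ K ≤ κ, HasSum (fun m => ‖MvPowerSeries.coeff m (c j)‖ * 4 ^ totalDeg m) K) →
      ∃ (φ E : (Fin n → ℂ) → (Fin n → ℂ)) (h : (Fin n → ℂ) → ℂ),
        (∀ j, ConsistsOfMonomials (fun y => φ y j) fun m => m ∈ nonresonant μ j) ∧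
        ConsistsOfMonomials h (fun m => m ∈ invariantExponents μ) ∧
        (∀ j, ConsistsOfMonomials (fun y => E y j) fun m =>
          2 ≤ totalDeg m ∧ monomialAt μ m = μ j ∧ (j = i₀ → m i₀ = 0)) ∧
        ∀ᶠ y in 𝓝 0, ∀ j, μ j * (y j + φ y j) + f (y + φ y) j =
          expScaling μ h y j + φ (expScaling μ h y) j + E y j := by
  obtain ⟨κ, hκ, H⟩ := exists_normalization_series hμ hi₀ hr
  refine ⟨κ, hκ, fun f c hf hc2 hcK => ?_⟩
  obtain ⟨φ, h, hφ1, hφ, hh, hunit, ⟨M, hM⟩, hinv, hφeq, hheq⟩ :=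
    H (fun j m => MvPowerSeries.coeff m (c j)) hcK
  choose K hK hcK using hcK
  set s : Fin n → ellOne n := fun j =>
    substSeries (fun m => MvPowerSeries.coeff m (c j)) (ellOne.var + φ) with hs_def
  have hz1 : ∀ i, (ellOne.var + φ : Fin n → ellOne n) i ∈
      ellOne.supported {m | 1 ≤ totalDeg m} := fun i => add_mem
    (ellOne.var_mem_supported (by simp [totalDeg_single]))
    (ellOne.supported_mono (fun m hm => le_trans one_le_two hm.1) (hφ i))
  have hs : ∀ j, s j ∈ ellOne.supported {m | 2 ≤ totalDeg m} := fun j =>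
    ellOne.substSeries_mem_supported (hc2 j) hz1
  have hz2 : ‖(ellOne.var + φ : Fin n → ellOne n)‖ ≤ 2 :=
    (norm_add_le _ _).trans (by linarith [ellOne.norm_var_fun_le (n := n)])
  set E : Fin n → ellOne n := fun j => ellOne.resonantError μ j h (s j) with hE
  set φf : (Fin n → ℂ) → (Fin n → ℂ) := fun y j => ellOne.toFun (φ j) y with hφf
  have hφc : ∀ j, ConsistsOfMonomials (fun y => φf y j) fun m => m ∈ nonresonant μ j := fun j =>
    ellOne.consistsOfMonomials_toFun (hφ j)
  have hhc := ellOne.consistsOfMonomials_toFun hh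
  refine ⟨φf, fun y j => ellOne.toFun (E j) y, ellOne.toFun h, hφc, hhc, fun j => ?_, ?_⟩
  · refine ellOne.consistsOfMonomials_toFun
      (S := {m | 2 ≤ totalDeg m ∧ monomialAt μ m = μ j ∧ (j = i₀ → m i₀ = 0)}) fun m hm => ?_
    by_cases h1 : 2 ≤ totalDeg m ∧ monomialAt μ m = μ j
    · have h2 : ¬ (j = i₀ → m i₀ = 0) := fun h2 => hm ⟨h1.1, h1.2, h2⟩
      push Not at h2
      obtain ⟨rfl, h2⟩ := h2
      exact ellOne.coeff_resonantError_eq_zero hμ (hs j) hheq h2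
    · exact ellOne.resonantError_mem_supported hh (hs j) j m h1
  have hΦ : Tendsto (fun y => y + φf y) (𝓝 0) (𝓝 0) := by
    have h1 : ContinuousAt φf 0 := continuousAt_pi.2 fun j => (hφc j).analyticAt.continuousAt
    have h2 : φf 0 = 0 := funext fun j => (hφc j).apply_zero fun h0 => by
      have := h0.1
      rw [totalDeg_zero] at this
      omega
    have h3 := continuousAt_id.add h1
    have h4 : Tendsto (fun y => y + φf y) (𝓝 0) (𝓝 (0 + φf 0)) := h3
    rwa [h2, add_zero] at h4
  have hG : Tendsto (expScaling μ (ellOne.toFun h)) (𝓝 0) (𝓝 0) := by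
    have h1 := continuousAt_expScaling μ hhc.analyticAt.continuousAt
    have h2 : Tendsto _ _ _ := h1
    rwa [expScaling_zero] at h2
  have hfΦ : ∀ᶠ y in 𝓝 (0 : Fin n → ℂ), ∀ j, HasSum
      (fun m => MvPowerSeries.coeff m (c j) * monomialAt (y + φf y) m) (f (y + φf y) j) :=
    hΦ.eventually (eventually_all.2 hf)
  filter_upwards [ellOne.eventually_norm_le_one, hG.eventually ellOne.eventually_norm_le_one, hfΦ]
    with y hy hGy hfy j
  -- Evaluation is a continuous algebra homomorphism, so substitution of series becomes composition
  -- of functions.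
  have hsj : f (y + φf y) j = ellOne.eval y hy (s j) := by
    refine (hfy j).unique ?_
    have h1 := (hasSum_substSeries (hcK j) hz2).map (ellOne.eval y hy)
      (ellOne.continuous_eval y hy)
    convert h1 using 1
    funext m
    rw [Function.comp_apply, map_smul, ellOne.eval_prodPow, smul_eq_mul]
    congr 2
    funext i
    rw [Pi.add_apply, Pi.add_apply, map_add, ellOne.eval_var]
    exact congrArg _ (ellOne.toFun_eq_eval _ hy)
  have hφG := ellOne.eval_twist_homologicalMultiplier hμ (hunit j) (hM j) (hinv j) (s j) hy hGy
  rw [← hφeq j] at hφG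
  have hsplit := congrArg (ellOne.eval y hy)
    (ellOne.proj_add_proj_compl (nonresonant μ j) (s j))
  rw [map_add] at hsplit
  have hEj : ellOne.toFun (E j) y = ellOne.eval y hy (ellOne.proj (nonresonant μ j)ᶜ (s j)) -
      μ j * (y j * (Complex.exp (((Real.log ‖μ j‖ : ℝ) : ℂ) * ellOne.toFun h y) - 1)) := by
    rw [ellOne.toFun_eq_eval _ hy, ellOne.toFun_eq_eval _ hy, hE]
    simp only [ellOne.resonantError]
    rw [map_sub, map_smul, map_mul, map_sub, map_one, ellOne.eval_var,
      map_banachExp _ (ellOne.continuous_eval _ _), map_smul, smul_eq_mul, smul_eq_mul]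
  have hφGj : φf (expScaling μ (ellOne.toFun h) y) j = ellOne.eval _ hGy (φ j) :=
    ellOne.toFun_eq_eval _ hGy
  have hφj : φf y j = ellOne.eval y hy (φ j) := ellOne.toFun_eq_eval _ hy
  rw [hEj, hφGj, hφG, hsj, ← hsplit, hφj, expScaling]
  ring

/-- A map with diagonal linear part is conjugate to a map `y ↦ (μ_i y_i e ^ {λ_i h(y)})`, up to a
resonant error term whose component `i₀` does not depend on `y_{i₀}`. -/
theorem exists_partial_normalization {n : ℕ} {μ : Fin n → ℂ} (hμ : ∀ i, μ i ≠ 0)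
    {i₀ : Fin n} (hi₀ : Real.log ‖μ i₀‖ ≠ 0) (hr : resonantRank μ = n - 1)
    {f : (Fin n → ℂ) → (Fin n → ℂ)}
    (hf : ∀ j, ConsistsOfMonomials (fun x => f x j) fun m => 2 ≤ totalDeg m) :
    ∃ (φ E : (Fin n → ℂ) → (Fin n → ℂ)) (h : (Fin n → ℂ) → ℂ),
      (∀ j, ConsistsOfMonomials (fun y => φ y j) fun m => m ∈ nonresonant μ j) ∧
      ConsistsOfMonomials h (fun m => m ∈ invariantExponents μ) ∧
      (∀ j, ConsistsOfMonomials (fun y => E y j) fun m =>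
        2 ≤ totalDeg m ∧ monomialAt μ m = μ j ∧ (j = i₀ → m i₀ = 0)) ∧
      ∀ᶠ y in 𝓝 0, ∀ j, μ j * (y j + φ y j) + f (y + φ y) j =
        expScaling μ h y j + φ (expScaling μ h y) j + E y j := by
  obtain ⟨κ, hκ, H⟩ := exists_small_partial_normalization hμ hi₀ hr
  choose c hc hc2 using hf
  choose ρ hρ hsum _ using fun j => (hc j).exists_summable
  -- Passing to r⁻¹ f(rx) multiplies the coefficient of degree |m| by r^{|m| - 1}. Since |m| ≥ 2, a
  -- factor r is gained for every monomial; the 16 is the part 4² of the weight 4^|m|.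
  have hev : ∀ᶠ r in 𝓝[>] (0 : ℝ), ∀ j, 4 * r ≤ ρ j ∧
      16 * r / ρ j ^ 2 * ∑' m, ‖MvPowerSeries.coeff m (c j)‖ * ρ j ^ totalDeg m ≤ κ := by
    refine eventually_all.2 fun j => eventually_nhdsWithin_of_eventually_nhds ?_
    have h1 : Tendsto (fun r : ℝ => 4 * r) (𝓝 0) (𝓝 0) := by
      have : Continuous fun r : ℝ => 4 * r := by fun_prop
      simpa using this.tendsto 0
    have h2 : Tendsto (fun r : ℝ => 16 * r / ρ j ^ 2 *
        ∑' m, ‖MvPowerSeries.coeff m (c j)‖ * ρ j ^ totalDeg m) (𝓝 0) (𝓝 0) := by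
      have : Continuous fun r : ℝ => 16 * r / ρ j ^ 2 *
        ∑' m, ‖MvPowerSeries.coeff m (c j)‖ * ρ j ^ totalDeg m := by fun_prop
      simpa using this.tendsto 0
    exact (h1.eventually (Iic_mem_nhds (hρ j))).and (h2.eventually (Iic_mem_nhds hκ))
  obtain ⟨r, hr1, hr0⟩ := (hev.and self_mem_nhdsWithin).exists
  replace hr0 : 0 < r := hr0
  have hrC : (r : ℂ) ≠ 0 := by exact_mod_cast hr0.ne'
  set c' : Fin n → MvPowerSeries (Fin n) ℂ := fun j =>
    (fun m => (r : ℂ)⁻¹ * ((r : ℂ) ^ totalDeg m * MvPowerSeries.coeff m (c j))) with hc'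
  have hcoeff : ∀ j m, MvPowerSeries.coeff m (c' j) =
      (r : ℂ)⁻¹ * ((r : ℂ) ^ totalDeg m * MvPowerSeries.coeff m (c j)) := fun j m => rfl
  have hA : ∀ j, HasTaylorSeries (fun x => ((r : ℂ)⁻¹ • f ((r : ℂ) • x)) j) (c' j) := by
    intro j
    filter_upwards [(tendsto_smul_vec_zero (r : ℂ)).eventually (hc j)] with x hx
    refine Eq.mp (congrArg (fun f => HasSum f _) (funext fun m => ?_)) (hx.mul_left (r : ℂ)⁻¹)
    rw [hcoeff, monomialAt_smul_vec]
    ring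
  have hB : ∀ j m, MvPowerSeries.coeff m (c' j) ≠ 0 → 2 ≤ totalDeg m := by
    intro j m hm
    rw [hcoeff] at hm
    exact hc2 j m (right_ne_zero_of_mul (right_ne_zero_of_mul hm))
  have hC : ∀ j, ∃ K ≤ κ, HasSum (fun m => ‖MvPowerSeries.coeff m (c' j)‖ * 4 ^ totalDeg m) K := by
    intro j
    obtain ⟨hr4, hrκ⟩ := hr1 j
    have hρ0 := hρ j
    have hb : ∀ m, ‖MvPowerSeries.coeff m (c' j)‖ * 4 ^ totalDeg m ≤
        16 * r / ρ j ^ 2 * (‖MvPowerSeries.coeff m (c j)‖ * ρ j ^ totalDeg m) := by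
      intro m
      by_cases h0 : MvPowerSeries.coeff m (c j) = 0
      · rw [hcoeff, h0]; simp
      obtain ⟨k, hk⟩ := Nat.exists_eq_add_of_le (hc2 j m h0)
      rw [hcoeff, norm_mul, norm_mul, norm_inv, norm_pow, Complex.norm_real, Real.norm_eq_abs,
        abs_of_pos hr0, hk]
      have h1 : (4 * r) ^ k ≤ ρ j ^ k := by gcongr
      calc _ = 16 * r * ‖MvPowerSeries.coeff m (c j)‖ * (4 * r) ^ k := by
            rw [mul_pow]; field_simp; ring
        _ ≤ 16 * r * ‖MvPowerSeries.coeff m (c j)‖ * ρ j ^ k := by gcongr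
        _ = _ := by rw [pow_add]; field_simp
    have hs' := (hsum j).mul_left (16 * r / ρ j ^ 2)
    have hs := Summable.of_nonneg_of_le (fun m => by positivity) hb hs'
    refine ⟨_, ?_, hs.hasSum⟩
    calc _ ≤ _ := Summable.tsum_le_tsum hb hs hs'
      _ = _ := tsum_mul_left
      _ ≤ κ := hrκ
  obtain ⟨φ, E, h, hφ, hh, hE, heq⟩ := H (fun x => (r : ℂ)⁻¹ • f ((r : ℂ) • x)) c' hA hB hC
  set R : ℂ := (r : ℂ) with hR
  have hGR : ∀ y, expScaling μ (fun y => h (R⁻¹ • y)) y = R • expScaling μ h (R⁻¹ • y) := by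
    intro y
    funext i
    simp only [expScaling, Pi.smul_apply, smul_eq_mul]
    field_simp
  refine ⟨fun y j => R * φ (R⁻¹ • y) j, fun y j => R * E (R⁻¹ • y) j, fun y => h (R⁻¹ • y),
    fun j => ((hφ j).comp_smul R⁻¹).const_mul R, hh.comp_smul R⁻¹,
    fun j => ((hE j).comp_smul R⁻¹).const_mul R, ?_⟩
  filter_upwards [(tendsto_smul_vec_zero R⁻¹).eventually heq] with y hy j
  have h1 := hy j
  have h2 : R • (R⁻¹ • y + φ (R⁻¹ • y)) = y + fun j => R * φ (R⁻¹ • y) j := by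
    funext i
    simp only [Pi.add_apply, Pi.smul_apply, smul_eq_mul]
    field_simp
  rw [h2] at h1
  rw [hGR, smul_smul, inv_mul_cancel₀ hrC, one_smul]
  simp only [Pi.smul_apply, smul_eq_mul] at h1 ⊢
  linear_combination R * h1 - (μ j * y j + f (y + fun j => R * φ (R⁻¹ • y) j) j) *
    mul_inv_cancel₀ hrC


/-! ### Necessity: integrals of a map with Jordan linear part. -/

theorem weight_one_eq_totalDeg {n : ℕ} (m : Fin n →₀ ℕ) :
    Finsupp.weight (fun _ : Fin n => 1) m = totalDeg m := by
  rw [Finsupp.weight_apply, Finsupp.sum_fintype _ _ (by simp), totalDeg]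
  simp

/-- With all weights equal to one, the growth bound says that the lead in degree one is zero, which
kills the coefficients of degrees zero and one. -/
theorem consistsOfMonomials_of_isBigO_sq {n : ℕ} {g : (Fin n → ℂ) → ℂ} (hg : AnalyticAt ℂ g 0)
    (hO : g =O[𝓝 0] fun x : Fin n → ℂ => ‖x‖ ^ 2) :
    ConsistsOfMonomials g fun m => 2 ≤ totalDeg m := by
  obtain ⟨c, hc⟩ := exists_hasTaylorSeries hg
  have hω : ∀ i : Fin n, 1 ≤ (fun _ : Fin n => 1) i := fun _ => le_rfl
  have hlead : HasLead (fun _ => 1) g 1 0 := by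
    intro y
    have ht : Tendsto (Prod.fst : ℂ × (Fin n → ℂ) → ℂ) (𝓝[≠] 0 ×ˢ 𝓝 y) (𝓝[≠] 0) := tendsto_fst
    have ht0 := tendsto_nhds_of_tendsto_nhdsWithin ht
    have hξ : Tendsto (Prod.snd : ℂ × (Fin n → ℂ) → _) (𝓝[≠] 0 ×ˢ 𝓝 y) (𝓝 y) := tendsto_snd
    have h1 := hO.comp_tendsto (tendsto_wscale hω ht0 hξ)
    obtain ⟨C, hC⟩ := h1.bound
    rw [map_zero]
    refine squeeze_zero_norm' (a := fun q : ℂ × (Fin n → ℂ) => C * (‖q.1‖ * ‖q.2‖ ^ 2)) ?_ ?_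
    · filter_upwards [hC, ht self_mem_nhdsWithin] with q hq hq0
      have hw : wscale (fun _ => 1) q.1 q.2 = q.1 • q.2 := by
        funext i
        simp [wscale]
      have hq0' : ‖q.1‖ ≠ 0 := norm_ne_zero_iff.2 hq0
      simp only [Function.comp_apply, hw, norm_smul, norm_pow, norm_mul, norm_norm] at hq
      rw [hw, norm_mul, norm_inv, norm_pow, pow_one]
      calc _ ≤ ‖q.1‖⁻¹ * (C * (‖q.1‖ * ‖q.2‖) ^ 2) := by gcongr
        _ = _ := by field_simp
    · have h2 : Tendsto (fun q : ℂ × (Fin n → ℂ) => C * (‖q.1‖ * ‖q.2‖ ^ 2)) (𝓝[≠] 0 ×ˢ 𝓝 y)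
          (𝓝 (C * (‖(0 : ℂ)‖ * ‖y‖ ^ 2))) := (ht0.norm.mul (hξ.norm.pow 2)).const_mul C
      simpa using h2
  refine ⟨c, hc, fun m hm => ?_⟩
  by_contra! hlt
  rcases Nat.lt_or_ge (totalDeg m) 1 with h | h
  · exact hm (hlead.coeff_eq_zero hω hc m (by rwa [weight_one_eq_totalDeg]))
  · have h1 := congrArg (MvPolynomial.coeff m) (hlead.eq_wcomp hω hc)
    rw [coeff_wcomp hω, if_pos (by rw [weight_one_eq_totalDeg]; omega), MvPolynomial.coeff_zero]
      at h1
    exact hm h1.symm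

theorem IsAnalyticFirstIntegral.eval {n r : ℕ} {F : (Fin n → ℂ) → (Fin n → ℂ)}
    {V : Fin r → (Fin n → ℂ) → ℂ} (hV : ∀ k, IsAnalyticFirstIntegral F (V k))
    (Q : MvPolynomial (Fin r) ℂ) :
    IsAnalyticFirstIntegral F fun x => MvPolynomial.eval (fun k => V k x) Q := by
  refine ⟨AnalyticAt.aeval_mvPolynomial (A := ℂ) (f := fun x k => V k x) (fun k => (hV k).1) Q, ?_⟩
  filter_upwards [eventually_all.2 fun k => (hV k).2] with x hx
  simp only [hx]

theorem hasLead_coord {n : ℕ} {ω : Fin n → ℕ} (hω : ∀ i, 1 ≤ ω i) (i : Fin n) :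
    HasLead ω (fun x => x i) (ω i) (MvPolynomial.X i) := by
  have := IsWeightedHomogeneous.hasLead hω (MvPolynomial.isWeightedHomogeneous_X ℂ ω i)
  simpa using this

/-- The weights for which a lower triangular Jordan block is a perturbation of order one of its
diagonal, and quadratic terms are perturbations of order two. -/
def jordanWeight (n : ℕ) (i : Fin n) : ℕ := 2 * n - i

/-- Indices start at 0, so the weights run from n + 1 to 2n and a product of two coordinates has
weight at least 2n + 2, two more than the weight of any component. -/
theorem le_jordanWeight {n : ℕ} (i : Fin n) : n + 1 ≤ jordanWeight n i := by
  unfold jordanWeight; omega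

theorem jordanWeight_le {n : ℕ} (i : Fin n) : jordanWeight n i ≤ 2 * n := by
  unfold jordanWeight; omega

theorem one_le_jordanWeight {n : ℕ} (i : Fin n) : 1 ≤ jordanWeight n i :=
  le_trans (by omega) (le_jordanWeight i)

theorem hasLead_offDiag {n : ℕ} {J : Matrix (Fin n) (Fin n) ℂ} (hJ : IsLowerJordan J) (i : Fin n) :
    HasLead (jordanWeight n) (fun x => ∑ j ∈ Finset.univ.erase i, J i j * x j)
      (jordanWeight n i + 1)
      (∑ j ∈ Finset.univ.erase i, MvPolynomial.C (J i j) * MvPolynomial.X j) := by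
  refine HasLead.sum _ fun j hj => ?_
  rcases hJ i j (Finset.ne_of_mem_erase hj).symm with h | ⟨-, h, -⟩
  · intro y
    simp [h]
  · have h1 : jordanWeight n i + 1 = jordanWeight n j := by
      unfold jordanWeight; omega
    rw [h1]
    exact (hasLead_coord one_le_jordanWeight j).const_mul (J i j)

theorem mulVec_eq_add_offDiag {n : ℕ} (J : Matrix (Fin n) (Fin n) ℂ) (x : Fin n → ℂ) (i : Fin n) :
    J.mulVec x i = J i i * x i + ∑ j ∈ Finset.univ.erase i, J i j * x j := by
  rw [Matrix.mulVec, dotProduct, Finset.add_sum_erase _ (fun j => J i j * x j) (Finset.mem_univ i)]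

section Integrable

variable {n : ℕ} {F : (Fin n → ℂ) → (Fin n → ℂ)} {J : Matrix (Fin n) (Fin n) ℂ}

theorem hasLead_sub_diag (hJ : IsLowerJordan J)
    (hf : ∀ i, ConsistsOfMonomials (fun x => F x i - J.mulVec x i) fun m => 2 ≤ totalDeg m)
    (i : Fin n) :
    HasLead (jordanWeight n) (fun x => F x i - J i i * x i) (jordanWeight n i + 1)
      (∑ j ∈ Finset.univ.erase i, MvPolynomial.C (J i j) * MvPolynomial.X j) := by
  have h1 := (hf i).hasLead_zero (ω := jordanWeight n) (a := n + 1) (by omega) le_jordanWeight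
    (K := jordanWeight n i + 1) (by have := jordanWeight_le i; omega)
  have h2 := (hasLead_offDiag hJ i).add h1
  rw [add_zero] at h2
  refine h2.congr one_le_jordanWeight (Eventually.of_forall fun x => ?_)
  rw [mulVec_eq_add_offDiag]
  ring

theorem hasLead_jordan (hJ : IsLowerJordan J)
    (hf : ∀ i, ConsistsOfMonomials (fun x => F x i - J.mulVec x i) fun m => 2 ≤ totalDeg m)
    (i : Fin n) :
    HasLead (jordanWeight n) (fun x => F x i) (jordanWeight n i)
      (MvPolynomial.C (J i i) * MvPolynomial.X i) := by
  have h1 := (hasLead_sub_diag hJ hf i).lower (Nat.lt_succ_self _)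
  have h2 := ((hasLead_coord one_le_jordanWeight i).const_mul (J i i)).add h1
  rw [add_zero] at h2
  exact h2.congr one_le_jordanWeight (Eventually.of_forall fun x => by ring)

/-- The leads of a maximal system of integrals. -/
theorem exists_integral_leads (hJ : IsLowerJordan J)
    (hf : ∀ i, ConsistsOfMonomials (fun x => F x i - J.mulVec x i) fun m => 2 ≤ totalDeg m)
    (hint : IsAnalyticallyIntegrable F) :
    ∃ (V : Fin (n - 1) → (Fin n → ℂ) → ℂ) (d : Fin (n - 1) → ℕ)
      (P : Fin (n - 1) → MvPolynomial (Fin n) ℂ),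
      (∀ k, IsAnalyticFirstIntegral F (V k)) ∧
      (∀ k, HasLead (jordanWeight n) (V k) (d k) (P k)) ∧ AlgebraicIndependent ℂ P ∧
      ∀ k, scaleVars J.diag (P k) = P k := by
  obtain ⟨V, hV, hVi⟩ := hint
  obtain ⟨c, hc⟩ := hVi.exists_eulerMinor
  obtain ⟨V', d, P, hV', hP, hPi⟩ := exists_algebraicIndependent_lead one_le_jordanWeight
    (IsAnalyticFirstIntegral F) (fun V hV => hV.1)
    (fun V Q hV => IsAnalyticFirstIntegral.eval hV Q) V hV c hc
  exact ⟨V', d, P, hV', hP, hPi, fun k =>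
    HasLead.eval_scale_eq one_le_jordanWeight (hasLead_jordan hJ hf) (hP k) (hV' k).2⟩

variable {d : Fin (n - 1) → ℕ} {P : Fin (n - 1) → MvPolynomial (Fin n) ℂ} {i₀ : Fin n}

theorem resonantRank_eq_of_leads (hμ : ∀ i, J.diag i ≠ 0) (hi₀ : Real.log ‖J.diag i₀‖ ≠ 0)
    (hPi : AlgebraicIndependent ℂ P) (hPμ : ∀ k, scaleVars J.diag (P k) = P k) :
    resonantRank J.diag = n - 1 := by
  have hn := i₀.pos
  have h1 := resonantRank_lt hμ hi₀
  have h2 := le_resonantRank (r := n - 1) (by omega) hPi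
    fun k => monomialAt_eq_one_of_scaleVars (hPμ k)
  omega

/-- A vector field which is tangent to the level sets of the leads of the integrals is
proportional to the diagonal vector field. -/
theorem proportional_of_leads {μ : Fin n → ℂ} (hμ : ∀ i, μ i ≠ 0) (hn : 0 < n)
    (hPi : AlgebraicIndependent ℂ P) (hPμ : ∀ k, scaleVars μ (P k) = P k)
    {X : Fin n → MvPolynomial (Fin n) ℂ} (hX : ∀ k, ∑ i, X i * MvPolynomial.pderiv i (P k) = 0)
    (i j : Fin n) :
    X i * (MvPolynomial.C ((Real.log ‖μ j‖ : ℝ) : ℂ) * MvPolynomial.X j) =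
      X j * (MvPolynomial.C ((Real.log ‖μ i‖ : ℝ) : ℂ) * MvPolynomial.X i) := by
  refine vectorField_proportional (ι := Fin (n - 1)) (by rw [Fintype.card_fin]; omega) hPi hX
    (fun k => euler_pderiv_eq_zero (fun i => ((Real.log ‖μ i‖ : ℝ) : ℂ)) fun m hm => ?_) i j
  have h1 := log_norm_monomialAt hμ m
  rw [monomialAt_eq_one_of_scaleVars (hPμ k) m hm, norm_one, Real.log_one] at h1
  have h2 : ((∑ i, (m i : ℝ) * Real.log ‖μ i‖ : ℝ) : ℂ) = 0 := by rw [← h1]; simp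
  push_cast at h2
  rw [← h2]
  exact Finset.sum_congr rfl fun i _ => mul_comm _ _

theorem analyticAt_of_coord {f : (Fin n → ℂ) → (Fin n → ℂ)}
    (h : ∀ i, AnalyticAt ℂ (fun x => f x i) 0) : AnalyticAt ℂ f 0 := analyticAt_pi_iff.2 h

/-- The map is compared with its diagonal part: Φ is the identity, G is diag(μ), and the error has
the off-diagonal part of `J` as its lead, of relative weight one. Tangency to the leads makes it
proportional to the logarithmic field, which no nonzero nilpotent part is. -/
theorem isDiag_of_integral_leads (hJ : IsLowerJordan J)
    (hf : ∀ i, ConsistsOfMonomials (fun x => F x i - J.mulVec x i) fun m => 2 ≤ totalDeg m)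
    (hμ : ∀ i, J.diag i ≠ 0) (hi₀ : Real.log ‖J.diag i₀‖ ≠ 0)
    {V : Fin (n - 1) → (Fin n → ℂ) → ℂ} (hV : ∀ k, IsAnalyticFirstIntegral F (V k))
    (hP : ∀ k, HasLead (jordanWeight n) (V k) (d k) (P k)) (hPi : AlgebraicIndependent ℂ P)
    (hPμ : ∀ k, scaleVars J.diag (P k) = P k) (i j : Fin n) (hij : i ≠ j) : J i j = 0 := by
  set N : Fin n → MvPolynomial (Fin n) ℂ := fun i =>
    ∑ j ∈ Finset.univ.erase i, MvPolynomial.C (J i j) * MvPolynomial.X j with hN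
  have htan : ∀ k, ∑ i, MvPolynomial.C (J.diag i)⁻¹ * N i * MvPolynomial.pderiv i (P k) = 0 := by
    intro k
    refine lead_error_tangent one_le_jordanWeight (hV k).1 (hP k) (hPμ k)
      (Φ := fun x => x) (G := fun x i => J.diag i * x i)
      (E := fun x i => F x i - J i i * x i) analyticAt_id rfl (hasLead_coord one_le_jordanWeight)
      (fun i => (hasLead_coord one_le_jordanWeight i).const_mul _) (fun m => ?_) le_rfl
      (hasLead_sub_diag hJ hf) (fun i m hm => ?_) ?_
    · by_cases hm : monomialAt J.diag m = 1
      · refine (consistsOfMonomials_zero _).congr (Eventually.of_forall fun y => ?_)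
        rw [monomialAt_mul, hm, one_mul, sub_self]
      · refine (((consistsOfMonomials_monomialAt m).mono fun k hk => by rwa [hk]).const_mul
          (1 - monomialAt J.diag m)).congr (Eventually.of_forall fun y => ?_)
        rw [monomialAt_mul]
        ring
    · rw [MvPolynomial.coeff_sum] at hm
      obtain ⟨j, hj, hjm⟩ := Finset.exists_ne_zero_of_sum_ne_zero hm
      rw [MvPolynomial.coeff_C_mul] at hjm
      have h1 := right_ne_zero_of_mul hjm
      rw [MvPolynomial.coeff_X, ite_ne_right_iff] at h1
      rw [← h1.1, monomialAt_single, pow_one]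
      rcases hJ i j (Finset.ne_of_mem_erase hj).symm with h | ⟨-, -, h⟩
      · exact absurd h (left_ne_zero_of_mul hjm)
      · exact h.symm
    · filter_upwards [(hV k).2] with x hx
      rw [← hx]
      congr 1
      funext i
      simp
  refine isDiag_of_proportional hJ (a := fun i => ((Real.log ‖J.diag i‖ : ℝ) : ℂ))
    (b := fun i => (J.diag i)⁻¹) (fun i => inv_ne_zero (hμ i)) (i₀ := i₀)
    (by exact_mod_cast hi₀) (fun i j h => by simp [Matrix.diag_apply, h]) (N := N) (fun i => rfl)
    (fun i j => proportional_of_leads hμ i₀.pos hPi hPμ htan i j) i j hij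

/-- A nonzero error has a nonzero lead of some least relative weight. That lead is resonant and
tangent to the leads of the integrals, hence proportional to the logarithmic field, and its
component `i₀` is free of y_{i₀}; such a field vanishes. -/
theorem error_eventually_zero {μ : Fin n → ℂ} (hμ : ∀ i, μ i ≠ 0) (hi₀ : Real.log ‖μ i₀‖ ≠ 0)
    {V : Fin (n - 1) → (Fin n → ℂ) → ℂ} (hV : ∀ k, AnalyticAt ℂ (V k) 0)
    (hP : ∀ k, HasLead (jordanWeight n) (V k) (d k) (P k)) (hPi : AlgebraicIndependent ℂ P)
    (hPμ : ∀ k, scaleVars μ (P k) = P k) {φ E : (Fin n → ℂ) → (Fin n → ℂ)} {h : (Fin n → ℂ) → ℂ}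
    (hφ : ∀ j, ConsistsOfMonomials (fun y => φ y j) fun m => m ∈ nonresonant μ j)
    (hh : ConsistsOfMonomials h (fun m => m ∈ invariantExponents μ))
    (hE : ∀ j, ConsistsOfMonomials (fun y => E y j) fun m =>
      2 ≤ totalDeg m ∧ monomialAt μ m = μ j ∧ (j = i₀ → m i₀ = 0))
    (hVF : ∀ k, ∀ᶠ y in 𝓝 0, V k (expScaling μ h y + φ (expScaling μ h y) + E y) =
      V k (y + φ y)) :
    ∀ᶠ y in 𝓝 0, ∀ j, E y j = 0 := by
  choose c hc hcS using hE
  by_cases hzero : ∀ j m, MvPowerSeries.coeff m (c j) = 0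
  · filter_upwards [eventually_all.2 hc] with y hy j
    refine (hy j).unique ?_
    simp only [hzero, zero_mul]
    exact hasSum_zero
  exfalso
  push Not at hzero
  obtain ⟨j₁, m₁, hm₁⟩ := hzero
  have hwt : ∀ j m, MvPowerSeries.coeff m (c j) ≠ 0 →
      jordanWeight n j + 1 ≤ Finsupp.weight (jordanWeight n) m := by
    intro j m hm
    have h1 := (hcS j m hm).1
    have h2 := mul_totalDeg_le_weight le_jordanWeight m
    have h3 := jordanWeight_le j
    nlinarith
  classical
  have hex : ∃ δ, ∃ j m, MvPowerSeries.coeff m (c j) ≠ 0 ∧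
      Finsupp.weight (jordanWeight n) m = jordanWeight n j + δ := by
    obtain ⟨δ, hδ⟩ := Nat.exists_eq_add_of_le ((Nat.le_succ _).trans (hwt j₁ m₁ hm₁))
    exact ⟨δ, j₁, m₁, hm₁, hδ⟩
  -- The least relative weight over all components at once. It is at least one because the error
  -- starts in degree two.
  set δ := Nat.find hex with hδ_def
  obtain ⟨j₂, m₂, hm₂, hδ⟩ := Nat.find_spec hex
  rw [← hδ_def] at hδ
  have hδ1 : 1 ≤ δ := by
    have := hwt j₂ m₂ hm₂
    omega
  have hEl : ∀ i, HasLead (jordanWeight n) (fun x => E x i) (jordanWeight n i + δ)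
      (wcomp (jordanWeight n) (c i) (jordanWeight n i + δ)) := by
    intro i
    refine (hc i).hasLead one_le_jordanWeight fun m hm => ?_
    by_contra hne
    obtain ⟨e, he⟩ := Nat.exists_eq_add_of_le ((Nat.le_succ _).trans (hwt i m hne))
    exact Nat.find_min hex (m := e) (by omega) ⟨i, m, hne, he⟩
  have hwc : ∀ i m, (wcomp (jordanWeight n) (c i) (jordanWeight n i + δ)).coeff m ≠ 0 →
      MvPowerSeries.coeff m (c i) ≠ 0 := by
    intro i m hm
    rw [coeff_wcomp one_le_jordanWeight, ite_ne_right_iff] at hm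
    exact hm.2
  have hφ2 : ∀ i, ConsistsOfMonomials (fun y => φ y i) fun m => 2 ≤ totalDeg m := fun i =>
    (hφ i).mono fun m hm => hm.1
  have hG2 : ∀ i, ConsistsOfMonomials (fun y => expScaling μ h y i - μ i * y i)
      fun m => 2 ≤ totalDeg m := fun i =>
    (consistsOfMonomials_expScaling_sub hh i).mono fun m hm => hm.1
  have hlz : ∀ (g : (Fin n → ℂ) → ℂ) (i : Fin n),
      ConsistsOfMonomials g (fun m => 2 ≤ totalDeg m) →
      HasLead (jordanWeight n) g (jordanWeight n i) 0 := fun g i hg =>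
    hg.hasLead_zero (a := n + 1) (by omega) le_jordanWeight
      (by have := jordanWeight_le i; omega)
  have htan : ∀ k, ∑ i, MvPolynomial.C (μ i)⁻¹ *
      wcomp (jordanWeight n) (c i) (jordanWeight n i + δ) *
        MvPolynomial.pderiv i (P k) = 0 := by
    intro k
    refine lead_error_tangent one_le_jordanWeight (hV k) (hP k) (hPμ k)
      (Φ := fun y => y + φ y) (G := expScaling μ h) (E := E)
      (analyticAt_id.add (analyticAt_of_coord fun i => (hφ i).analyticAt)) ?_ (fun i => ?_)
      (fun i => ?_) (consistsOfMonomials_sub_monomialAt_expScaling hμ hh) hδ1 hEl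
      (fun i m hm => (hcS i m (hwc i m hm)).2.1) (hVF k)
    · funext i
      have := (hφ2 i).apply_zero (by rw [totalDeg_zero]; omega)
      simpa using this
    · have h1 := (hasLead_coord one_le_jordanWeight i).add (hlz _ i (hφ2 i))
      rwa [add_zero] at h1
    · have h1 := ((hasLead_coord one_le_jordanWeight i).const_mul (μ i)).add (hlz _ i (hG2 i))
      rw [add_zero] at h1
      exact h1.congr one_le_jordanWeight (Eventually.of_forall fun x => by ring)
  have hzero := error_eq_zero_of_proportional hμ hi₀
    (E := fun i => wcomp (jordanWeight n) (c i) (jordanWeight n i + δ))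
    (fun i m hm => (hcS i m (hwc i m hm)).2.1) (fun m hm => (hcS i₀ m (hwc i₀ m hm)).2.2 rfl)
    (fun i j => proportional_of_leads hμ i₀.pos hPi hPμ htan i j) j₂
  have h1 := congrArg (MvPolynomial.coeff m₂) hzero
  rw [coeff_wcomp one_le_jordanWeight, if_pos hδ, MvPolynomial.coeff_zero] at h1
  exact hm₂ h1

/-- An integrable map is conjugate to a map that scales the coordinates. -/
theorem exists_normalization_of_integrable (hJ : IsLowerJordan J)
    (hf : ∀ i, ConsistsOfMonomials (fun x => F x i - J.mulVec x i) fun m => 2 ≤ totalDeg m)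
    (hμ : ∀ i, J.diag i ≠ 0) (hi₀ : Real.log ‖J.diag i₀‖ ≠ 0)
    (hint : IsAnalyticallyIntegrable F) :
    resonantRank J.diag = n - 1 ∧
      ∃ (Φ : (Fin n → ℂ) → (Fin n → ℂ)) (p : Fin n → (Fin n → ℂ) → ℂ)
        (m : Fin (n - 1) → (Fin n →₀ ℕ)),
        (∀ i, AnalyticAt ℂ (p i) 0) ∧
        IsNormalForm J (scalingMap J.diag p) ∧
        IsDistinguishedAnalyticNormalization J.diag F (scalingMap J.diag p) Φ ∧
        (∀ k, IsSimpleResonant J.diag (m k)) ∧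
        LinearIndependent ℚ (fun k => ratVec (m k)) ∧
        ∀ k, ∀ᶠ y in 𝓝 (0 : Fin n → ℂ), ∏ i, (1 + p i y) ^ (m k i) = 1 := by
  obtain ⟨V, d, P, hV, hP, hPi, hPμ⟩ := exists_integral_leads hJ hf hint
  have hr := resonantRank_eq_of_leads hμ hi₀ hPi hPμ
  have hdiag := isDiag_of_integral_leads hJ hf hμ hi₀ hV hP hPi hPμ
  have hmul : ∀ x i, J.mulVec x i = J.diag i * x i := by
    intro x i
    rw [mulVec_eq_add_offDiag, Finset.sum_eq_zero, add_zero, Matrix.diag_apply]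
    intro j hj
    rw [hdiag i j (Finset.ne_of_mem_erase hj).symm, zero_mul]
  set μ := J.diag with hμ_def
  obtain ⟨φ, E, h, hφ, hh, hE, heq⟩ := exists_partial_normalization hμ hi₀ hr
    (f := fun x i => F x i - J.mulVec x i) hf
  have hFΦ : ∀ᶠ y in 𝓝 0, F (y + φ y) = expScaling μ h y + φ (expScaling μ h y) + E y := by
    filter_upwards [heq] with y hy
    funext j
    have h1 := hy j
    rw [hmul] at h1
    simp only [Pi.add_apply] at h1 ⊢
    linear_combination h1
  have hφan : AnalyticAt ℂ φ 0 := analyticAt_of_coord fun i => (hφ i).analyticAt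
  have hφ0 : φ 0 = 0 := funext fun j => (hφ j).apply_zero fun h0 => by
    have := h0.1
    rw [totalDeg_zero] at this
    omega
  have hΦ : Tendsto (fun y => y + φ y) (𝓝 0) (𝓝 0) := by
    have h4 : Tendsto (fun y => y + φ y) (𝓝 0) (𝓝 (0 + φ 0)) :=
      (continuousAt_id.add hφan.continuousAt : _)
    rwa [hφ0, add_zero] at h4
  -- Invariance of the integrals under `F`, read at the points Φ(y), is the hypothesis that removes
  -- the error.
  have hE0 := error_eventually_zero hμ hi₀ (fun k => (hV k).1) hP hPi hPμ hφ hh hE fun k => by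
    filter_upwards [hFΦ, hΦ.eventually (hV k).2] with y hy1 hy2
    rw [← hy1, hy2]
  obtain ⟨m, hm, hmi⟩ := exists_simple_independent hr
  have hexp : ∀ i, ConsistsOfMonomials
      (fun y => Complex.exp (((Real.log ‖μ i‖ : ℝ) : ℂ) * h y) - 1)
      (fun m => m ∈ invariantExponents μ) := fun i => consistsOfMonomials_exp_sub_one hh _
  have hscal : scalingMap μ (fun i y => Complex.exp (((Real.log ‖μ i‖ : ℝ) : ℂ) * h y) - 1) =
      expScaling μ h := by
    funext y i
    simp [scalingMap, expScaling]
  refine ⟨hr, fun y => y + φ y, fun i y => Complex.exp (((Real.log ‖μ i‖ : ℝ) : ℂ) * h y) - 1, m,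
    fun i => (hexp i).analyticAt, ?_, ?_, hm, hmi, fun k => Eventually.of_forall fun y => ?_⟩
  · rw [hscal]
    refine ⟨hJ, fun j => ?_⟩
    simp only [hmul]
    exact consistsOfMonomials_expScaling_sub hh j
  · rw [hscal]
    refine ⟨analyticAt_id.add hφan, fun j => ?_, ?_⟩
    · exact (hφ j).congr (Eventually.of_forall fun y => by simp)
    · filter_upwards [hFΦ, hE0] with y hy1 hy2
      rw [hy1, show E y = 0 from funext hy2, add_zero]
  · have h1 := (hm k).1.1
    simp only [add_sub_cancel]
    -- The product of the scaling factors is the exponential of h ∑ m_i log |μ_i|, and this sum is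
    -- the logarithm of |μ^m| = 1.
    have h3 := log_norm_monomialAt hμ (m k)
    rw [h1, norm_one, Real.log_one] at h3
    simp only [← Complex.exp_nat_mul]
    rw [← Complex.exp_sum]
    have h4 : ∑ i, ((m k i : ℕ) : ℂ) * (((Real.log ‖μ i‖ : ℝ) : ℂ) * h y) =
        ((∑ i, (m k i : ℝ) * Real.log ‖μ i‖ : ℝ) : ℂ) * h y := by
      push_cast
      rw [Finset.sum_mul]
      exact Finset.sum_congr rfl fun i _ => by ring
    rw [h4, ← h3]
    simp

end Integrable


/-! ### Changes of variables and the spectrum of the linear part. -/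

section ChangeOfVariables

variable {n : ℕ}

/-- An analytic change of variables is locally invertible at all points close to the origin. -/
theorem eventually_hasStrictFDerivAt_equiv {Ψ : (Fin n → ℂ) → (Fin n → ℂ)}
    (hΨ : AnalyticAt ℂ Ψ 0) {e : (Fin n → ℂ) ≃L[ℂ] (Fin n → ℂ)}
    (he : HasFDerivAt Ψ (e : (Fin n → ℂ) →L[ℂ] (Fin n → ℂ)) 0) :
    ∀ᶠ x in 𝓝 0, ∃ e' : (Fin n → ℂ) ≃L[ℂ] (Fin n → ℂ),
      HasStrictFDerivAt Ψ (e' : (Fin n → ℂ) →L[ℂ] (Fin n → ℂ)) x := by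
  have h1 : ContinuousAt (fderiv ℂ Ψ) 0 := hΨ.fderiv.continuousAt
  have h2 : Set.range ((↑) : ((Fin n → ℂ) ≃L[ℂ] (Fin n → ℂ)) → _) ∈ 𝓝 (fderiv ℂ Ψ 0) := by
    rw [he.fderiv]
    exact ContinuousLinearEquiv.nhds e
  filter_upwards [h1 h2, hΨ.eventually_analyticAt] with x hx hx'
  obtain ⟨e', he'⟩ := hx
  exact ⟨e', he' ▸ hx'.hasStrictFDerivAt⟩

/-- A local diffeomorphism maps neighbourhoods to neighbourhoods, so the preimage of a dense open
set remains dense; composing differentials with an isomorphism preserves independence. -/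
theorem FunctionallyIndependent.comp {r : ℕ} {V : Fin r → (Fin n → ℂ) → ℂ}
    (hV : FunctionallyIndependent V) (hVa : ∀ k, AnalyticAt ℂ (V k) 0)
    {Ψ : (Fin n → ℂ) → (Fin n → ℂ)} (hΨ : AnalyticAt ℂ Ψ 0) (hΨ0 : Ψ 0 = 0)
    {e : (Fin n → ℂ) ≃L[ℂ] (Fin n → ℂ)}
    (he : HasFDerivAt Ψ (e : (Fin n → ℂ) →L[ℂ] (Fin n → ℂ)) 0) :
    FunctionallyIndependent fun k x => V k (Ψ x) := by
  obtain ⟨U, W, hU, hU0, hW, hWU, hUW, hli⟩ := hV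
  have hΨt : Tendsto Ψ (𝓝 0) (𝓝 0) := by simpa only [hΨ0] using hΨ.continuousAt.tendsto
  have hev : ∀ᶠ x in 𝓝 (0 : Fin n → ℂ), (∃ e' : (Fin n → ℂ) ≃L[ℂ] (Fin n → ℂ),
      HasStrictFDerivAt Ψ (e' : (Fin n → ℂ) →L[ℂ] (Fin n → ℂ)) x) ∧ Ψ x ∈ U ∧
      ∀ k, AnalyticAt ℂ (V k) (Ψ x) :=
    (eventually_hasStrictFDerivAt_equiv hΨ he).and ((hΨt.eventually (hU.mem_nhds hU0)).and
      (hΨt.eventually (eventually_all.2 fun k => (hVa k).eventually_analyticAt)))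
  obtain ⟨U', hU'sub, hU', hU'0⟩ := eventually_nhds_iff.1 hev
  have hcont : ContinuousOn Ψ U' := fun x hx =>
    (hU'sub x hx).1.choose_spec.continuousAt.continuousWithinAt
  refine ⟨U', U' ∩ Ψ ⁻¹' W, hU', hU'0, hcont.isOpen_inter_preimage hU' hW,
    Set.inter_subset_left, fun x hx => ?_, fun x hx => ?_⟩
  · rw [mem_closure_iff_nhds]
    intro N hN
    obtain ⟨⟨e', he'⟩, hxU, -⟩ := hU'sub x hx
    have h1 : Ψ '' (N ∩ U') ∈ 𝓝 (Ψ x) := by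
      rw [← he'.map_nhds_eq_of_equiv]
      exact image_mem_map (inter_mem hN (hU'.mem_nhds hx))
    obtain ⟨z, ⟨y, hy, rfl⟩, hzW⟩ := mem_closure_iff_nhds.1 (hUW hxU) _ h1
    exact ⟨y, hy.1, hy.2, hzW⟩
  · obtain ⟨⟨e', he'⟩, -, hA⟩ := hU'sub x hx.1
    have h1 : (fun k => fderiv ℂ (fun x => V k (Ψ x)) x) = fun k =>
        ((fderiv ℂ (V k) (Ψ x)).comp (e' : (Fin n → ℂ) →L[ℂ] (Fin n → ℂ))) := by
      funext k
      exact ((hA k).differentiableAt.hasFDerivAt.comp x he'.hasFDerivAt).fderiv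
    rw [h1]
    refine (hli _ hx.2).map' ((ContinuousLinearMap.compL ℂ (Fin n → ℂ) (Fin n → ℂ) ℂ).flip
      (e' : (Fin n → ℂ) →L[ℂ] (Fin n → ℂ))).toLinearMap (LinearMap.ker_eq_bot.2 ?_)
    intro f g hfg
    ext1 z
    have := congrArg (fun L : (Fin n → ℂ) →L[ℂ] ℂ => L (e'.symm z)) hfg
    simpa using this

/-- Integrability is inherited by a map that is semiconjugate to an integrable one through an
analytic change of variables. -/
theorem IsAnalyticallyIntegrable.of_semiconj {F G Ψ : (Fin n → ℂ) → (Fin n → ℂ)}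
    (hG : IsAnalyticallyIntegrable G) (hΨ : AnalyticAt ℂ Ψ 0) (hΨ0 : Ψ 0 = 0)
    {e : (Fin n → ℂ) ≃L[ℂ] (Fin n → ℂ)}
    (he : HasFDerivAt Ψ (e : (Fin n → ℂ) →L[ℂ] (Fin n → ℂ)) 0)
    (hc : ∀ᶠ x in 𝓝 0, Ψ (F x) = G (Ψ x)) : IsAnalyticallyIntegrable F := by
  obtain ⟨V, hV, hVi⟩ := hG
  have hΨt : Tendsto Ψ (𝓝 0) (𝓝 0) := by simpa only [hΨ0] using hΨ.continuousAt.tendsto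
  refine ⟨fun k x => V k (Ψ x), fun k => ⟨?_, ?_⟩, hVi.comp (fun k => (hV k).1) hΨ hΨ0 he⟩
  · exact AnalyticAt.fun_comp (by rw [hΨ0]; exact (hV k).1) hΨ
  · filter_upwards [hc, hΨt.eventually (hV k).2] with x h1 h2
    rw [h1, h2]

/-- The linear change of variables given by an invertible matrix. -/
noncomputable def mulVecEquiv (P : Matrix (Fin n) (Fin n) ℂ) (hP : IsUnit P.det) :
    (Fin n → ℂ) ≃L[ℂ] (Fin n → ℂ) :=
  (Matrix.toLin'OfInv (Matrix.nonsing_inv_mul P hP)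
    (Matrix.mul_nonsing_inv P hP)).toContinuousLinearEquiv

theorem coe_mulVecEquiv (P : Matrix (Fin n) (Fin n) ℂ) (hP : IsUnit P.det) :
    ⇑(mulVecEquiv P hP) = P.mulVec := by
  ext x i
  simp [mulVecEquiv]

theorem IsAnalyticallyIntegrable.of_semiconj_mulVec {F G : (Fin n → ℂ) → (Fin n → ℂ)}
    (hG : IsAnalyticallyIntegrable G) {P : Matrix (Fin n) (Fin n) ℂ} (hP : IsUnit P.det)
    (hc : ∀ x, P.mulVec (F x) = G (P.mulVec x)) : IsAnalyticallyIntegrable F :=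
  hG.of_semiconj (Ψ := mulVecEquiv P hP) (e := mulVecEquiv P hP)
    ((mulVecEquiv P hP : (Fin n → ℂ) →L[ℂ] (Fin n → ℂ)).analyticAt 0) (map_zero _)
    (mulVecEquiv P hP).hasFDerivAt (Eventually.of_forall fun x => by
      rw [coe_mulVecEquiv]; exact hc x)

/-- Conjugation by a linear map: the nonlinear part starts in degree two. -/
theorem consistsOfMonomials_conj {F : (Fin n → ℂ) → (Fin n → ℂ)}
    {B P J : Matrix (Fin n) (Fin n) ℂ} (hF : AnalyticAt ℂ F 0)
    (hf : (fun x => F x - B.mulVec x) =O[𝓝 0] (fun x : Fin n → ℂ => ‖x‖ ^ 2))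
    (hP : IsUnit P.det) (hPBJ : P⁻¹ * B * P = J) (i : Fin n) :
    ConsistsOfMonomials (fun x => P⁻¹.mulVec (F (P.mulVec x)) i - J.mulVec x i)
      fun m => 2 ≤ totalDeg m := by
  have hP' : IsUnit P⁻¹.det := Matrix.isUnit_nonsing_inv_det P hP
  let L : Matrix (Fin n) (Fin n) ℂ → ((Fin n → ℂ) →L[ℂ] (Fin n → ℂ)) := fun A =>
    LinearMap.toContinuousLinearMap A.mulVecLin
  have hL : ∀ A x, L A x = A.mulVec x := fun _ _ => rfl
  have hPt : Tendsto (fun x => L P x) (𝓝 0) (𝓝 0) := by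
    simpa using (L P).continuous.tendsto 0
  have hJ : ∀ x, J.mulVec x = P⁻¹.mulVec (B.mulVec (P.mulVec x)) := fun x => by
    rw [← hPBJ, Matrix.mulVec_mulVec, Matrix.mulVec_mulVec]
  have h1 : (fun x => P⁻¹.mulVec (F (P.mulVec x)) i - J.mulVec x i) = fun x =>
      ((ContinuousLinearMap.proj i).comp (L P⁻¹))
        ((fun x => F x - B.mulVec x) (L P x)) := by
    funext x
    simp [hL, hJ, Matrix.mulVec_sub]
  rw [h1]
  refine consistsOfMonomials_of_isBigO_sq ?_ ?_
  · refine (ContinuousLinearMap.analyticAt _ _).fun_comp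
      (AnalyticAt.fun_comp (g := fun x => F x - B.mulVec x) (f := fun x => L P x) ?_ ((L P).analyticAt 0))
    rw [map_zero]
    exact hF.sub ((L B).analyticAt 0)
  · refine (ContinuousLinearMap.isBigO_comp _ _ _).trans ((hf.comp_tendsto hPt).trans ?_)
    exact ((L P).isBigO_id _).norm_norm.pow 2

theorem IsLowerJordan.det_eq_prod {J : Matrix (Fin n) (Fin n) ℂ} (hJ : IsLowerJordan J) (z : ℂ) :
    (algebraMap ℂ (Matrix (Fin n) (Fin n) ℂ) z - J).det = ∏ i, (z - J i i) := by
  rw [Matrix.det_of_isLowerTriangular]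
  · simp [Matrix.algebraMap_matrix_apply]
  · intro i j hij
    have hij' : i < j := hij
    rw [Matrix.sub_apply, Matrix.algebraMap_matrix_apply, if_neg hij'.ne]
    rcases hJ i j hij'.ne with h | ⟨-, h, -⟩
    · rw [h, sub_zero]
    · omega

theorem diag_ne_zero_of_conj {B P J : Matrix (Fin n) (Fin n) ℂ} (hB : IsUnit B.det)
    (hP : IsUnit P.det) (hJ : IsLowerJordan J) (hPBJ : P⁻¹ * B * P = J) (i : Fin n) :
    J.diag i ≠ 0 := by
  intro h
  have h1 := hJ.det_eq_prod 0
  rw [map_zero, zero_sub, Finset.prod_eq_zero (Finset.mem_univ i) (by simpa using h),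
    Matrix.det_neg, ← hPBJ, Matrix.det_mul, Matrix.det_mul] at h1
  have hP' := (Matrix.isUnit_nonsing_inv_det P hP).ne_zero
  simp [hP.ne_zero, hB.ne_zero] at h1

theorem exists_log_norm_diag_ne_zero {B P J : Matrix (Fin n) (Fin n) ℂ} (hB : IsUnit B.det)
    (hP : IsUnit P.det) (hJ : IsLowerJordan J) (hPBJ : P⁻¹ * B * P = J)
    (hspec : ∃ z ∈ spectrum ℂ B, ‖z‖ ≠ 1) : ∃ i, Real.log ‖J.diag i‖ ≠ 0 := by
  obtain ⟨z, hz, hz1⟩ := hspec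
  have h1 : (algebraMap ℂ (Matrix (Fin n) (Fin n) ℂ) z - J).det = 0 := by
    have h2 : algebraMap ℂ (Matrix (Fin n) (Fin n) ℂ) z - J =
        P⁻¹ * (algebraMap ℂ (Matrix (Fin n) (Fin n) ℂ) z - B) * P := by
      rw [mul_sub, sub_mul, hPBJ, ← Algebra.commutes, mul_assoc, Matrix.nonsing_inv_mul P hP,
        mul_one]
    rw [spectrum.mem_iff, Matrix.isUnit_iff_isUnit_det, isUnit_iff_ne_zero, not_not] at hz
    rw [h2, Matrix.det_mul, Matrix.det_mul, hz, mul_zero, zero_mul]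
  rw [hJ.det_eq_prod, Finset.prod_eq_zero_iff] at h1
  obtain ⟨i, -, hi⟩ := h1
  have hi' : J.diag i = z := (sub_eq_zero.1 hi).symm
  refine ⟨i, Real.log_ne_zero_of_pos_of_ne_one
    (norm_pos_iff.2 (diag_ne_zero_of_conj hB hP hJ hPBJ i)) ?_⟩
  rwa [hi']

end ChangeOfVariables


/-! ### Sufficiency: integrals of scaling maps. -/

section ScalingMaps

variable {n : ℕ}

theorem analyticAt_monomialAt (m : Fin n →₀ ℕ) (x : Fin n → ℂ) :
    AnalyticAt ℂ (fun y => monomialAt y m) x := by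
  unfold monomialAt
  exact Finset.analyticAt_fun_prod _ fun i _ =>
    ((ContinuousLinearMap.proj (R := ℂ) (φ := fun _ : Fin n => ℂ) i).analyticAt x).pow _

/-- The partial Euler operators multiply a monomial by its exponents. -/
theorem fderiv_monomialAt_single (m : Fin n →₀ ℕ) (y : Fin n → ℂ) (i : Fin n) :
    fderiv ℂ (fun y => monomialAt y m) y (Pi.single i (y i)) = monomialAt y m * m i := by
  have h1 : HasDerivAt (fun t : ℂ => y + t • (Pi.single i (y i) : Fin n → ℂ))
      (Pi.single i (y i)) 0 := by
    simpa using ((hasDerivAt_id (0 : ℂ)).smul_const (Pi.single i (y i) : Fin n → ℂ)).const_add y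
  have h2 : HasFDerivAt (fun y => monomialAt y m) (fderiv ℂ (fun y => monomialAt y m) y)
      (y + (0 : ℂ) • (Pi.single i (y i) : Fin n → ℂ)) := by
    rw [zero_smul, add_zero]
    exact (analyticAt_monomialAt m y).differentiableAt.hasFDerivAt
  have h3 := h2.comp_hasDerivAt (0 : ℂ) h1
  have h4 : (fun y => monomialAt y m) ∘ (fun t : ℂ => y + t • (Pi.single i (y i) : Fin n → ℂ)) =
      fun t => monomialAt y m * (1 + t) ^ m i := by
    funext t
    simp only [Function.comp_def, monomialAt]
    rw [← Finset.mul_prod_erase _ _ (Finset.mem_univ i),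
      ← Finset.mul_prod_erase _ (fun j => y j ^ m j) (Finset.mem_univ i)]
    have h5 : ∏ j ∈ Finset.univ.erase i, (y + t • (Pi.single i (y i) : Fin n → ℂ)) j ^ m j =
        ∏ j ∈ Finset.univ.erase i, y j ^ m j :=
      Finset.prod_congr rfl fun j hj => by simp [Finset.ne_of_mem_erase hj]
    rw [h5]
    have h6 : (y + t • (Pi.single i (y i) : Fin n → ℂ)) i = y i * (1 + t) := by
      simp
      ring
    rw [h6, mul_pow]
    ring
  rw [h4] at h3
  have h5 : HasDerivAt (fun t : ℂ => monomialAt y m * (1 + t) ^ m i) (monomialAt y m * m i) 0 := by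
    simpa using (((hasDerivAt_id (0 : ℂ)).const_add 1).pow (m i)).const_mul (monomialAt y m)
  exact h3.unique h5

/-- Off the coordinate hyperplanes, evaluating the differential of y^m on the vectors y_i e_i gives
y^m times the exponent vector. The differentials are therefore as independent as the exponents. -/
theorem functionallyIndependent_monomialAt {r : ℕ} {m : Fin r → (Fin n →₀ ℕ)}
    (hm : LinearIndependent ℚ fun k => ratVec (m k)) :
    FunctionallyIndependent fun k y => monomialAt y (m k) := by
  refine ⟨Set.univ, Set.univ.pi fun _ => {0}ᶜ, isOpen_univ, trivial,
    isOpen_set_pi Set.finite_univ fun _ _ => isOpen_compl_singleton, Set.subset_univ _,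
    fun x _ => dense_pi (s := fun _ : Fin n => ({0}ᶜ : Set ℂ)) _
      (fun _ _ => dense_compl_singleton 0) x, fun y hy => ?_⟩
  have hy' : ∀ i, y i ≠ 0 := fun i => hy i trivial
  have hmy : ∀ k, monomialAt y (m k) ≠ 0 := fun k =>
    Finset.prod_ne_zero_iff.2 fun i _ => pow_ne_zero _ (hy' i)
  have h1 : LinearIndependent ℂ fun k => algebraMap ℚ ℂ ∘ ratVec (m k) :=
    linearIndependent_algebraMap_comp_iff.2 hm
  have h2 := h1.units_smul fun k => Units.mk0 _ (hmy k)
  let T : ((Fin n → ℂ) →L[ℂ] ℂ) →ₗ[ℂ] (Fin n → ℂ) :=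
    LinearMap.pi fun i =>
      (ContinuousLinearMap.apply ℂ ℂ (Pi.single i (y i) : Fin n → ℂ)).toLinearMap
  refine LinearIndependent.of_comp T ?_
  have h3 : (T ∘ fun k => fderiv ℂ (fun y => monomialAt y (m k)) y) =
      (fun k => Units.mk0 _ (hmy k)) • fun k => algebraMap ℚ ℂ ∘ ratVec (m k) := by
    funext k i
    simp [T, fderiv_monomialAt_single, ratVec, Units.smul_def]
  exact h3 ▸ h2

/-- Scaling maps whose scaling factors satisfy `n - 1` independent resonance relations are
integrable: the resonant monomials are first integrals. -/
theorem isAnalyticallyIntegrable_scalingMap {μ : Fin n → ℂ} {p : Fin n → (Fin n → ℂ) → ℂ}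
    {m : Fin (n - 1) → (Fin n →₀ ℕ)} (hμ : ∀ k, monomialAt μ (m k) = 1)
    (hm : LinearIndependent ℚ fun k => ratVec (m k))
    (hp : ∀ k, ∀ᶠ y in 𝓝 (0 : Fin n → ℂ), ∏ i, (1 + p i y) ^ (m k i) = 1) :
    IsAnalyticallyIntegrable (scalingMap μ p) := by
  refine ⟨fun k y => monomialAt y (m k), fun k => ⟨analyticAt_monomialAt _ _, ?_⟩,
    functionallyIndependent_monomialAt hm⟩
  filter_upwards [hp k] with y hy
  have h1 : monomialAt (scalingMap μ p y) (m k) =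
      monomialAt μ (m k) * monomialAt y (m k) * ∏ i, (1 + p i y) ^ (m k i) := by
    simp only [monomialAt, scalingMap, mul_pow, Finset.prod_mul_distrib]
  rw [h1, hμ, hy, one_mul, mul_one]

theorem ConsistsOfMonomials.hasFDerivAt_zero {g : (Fin n → ℂ) → ℂ}
    (hg : ConsistsOfMonomials g fun m => 2 ≤ totalDeg m) :
    HasFDerivAt g (0 : (Fin n → ℂ) →L[ℂ] ℂ) 0 := by
  obtain ⟨c, hc, hS⟩ := hg
  have h1 := hc.isBigO_sub_truncDeg 2
  have h2 : ∀ x, MvPolynomial.eval x (truncDeg c 2) = 0 := fun x => by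
    rw [eval_truncDeg]
    refine Finset.sum_eq_zero fun m hm => ?_
    rw [by_contra fun h => ((mem_degLT m).1 hm).not_ge (hS m h), zero_mul]
  simp only [h2, sub_zero] at h1
  refine IsBigO.hasFDerivAt (n := 2) ?_ one_lt_two
  simpa only [sub_zero] using h1

/-- A distinguished normalization is tangent to the identity. -/
theorem IsDistinguishedAnalyticNormalization.hasFDerivAt {μ : Fin n → ℂ}
    {F G Φ : (Fin n → ℂ) → (Fin n → ℂ)} (h : IsDistinguishedAnalyticNormalization μ F G Φ) :
    Φ 0 = 0 ∧ HasFDerivAt Φ (ContinuousLinearMap.id ℂ (Fin n → ℂ)) 0 := by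
  have h2 : ∀ j, ConsistsOfMonomials (fun y => Φ y j - y j) fun m => 2 ≤ totalDeg m := fun j =>
    (h.2.1 j).mono fun m hm => hm.1
  have hd : HasFDerivAt (fun y => Φ y - y) (0 : (Fin n → ℂ) →L[ℂ] (Fin n → ℂ)) 0 :=
    hasFDerivAt_pi.2 fun j => (h2 j).hasFDerivAt_zero
  refine ⟨funext fun j => ?_, ?_⟩
  · have h3 := (h2 j).apply_zero (by rw [totalDeg_zero]; omega)
    simpa using h3
  · have h4 := hd.add (hasFDerivAt_id (0 : Fin n → ℂ))
    rw [zero_add] at h4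
    exact h4.congr_of_eventuallyEq (Eventually.of_forall fun y => by simp)

/-- The normalization is tangent to the identity, so it has an analytic local inverse, and this
inverse semiconjugates `F` to `G`. -/
theorem IsAnalyticallyIntegrable.of_normalization {μ : Fin n → ℂ}
    {F G Φ : (Fin n → ℂ) → (Fin n → ℂ)} (hG : IsAnalyticallyIntegrable G)
    (hGc : ContinuousAt G 0) (hG0 : G 0 = 0)
    (h : IsDistinguishedAnalyticNormalization μ F G Φ) : IsAnalyticallyIntegrable F := by
  obtain ⟨hΦ0, hΦd⟩ := h.hasFDerivAt
  have hs : HasStrictFDerivAt Φ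
      ((ContinuousLinearEquiv.refl ℂ (Fin n → ℂ) : (Fin n → ℂ) ≃L[ℂ] (Fin n → ℂ)) :
        (Fin n → ℂ) →L[ℂ] (Fin n → ℂ)) 0 := by
    have := h.1.hasStrictFDerivAt
    rwa [hΦd.fderiv] at this
  let f := hs.toOpenPartialHomeomorph Φ
  have hf0 : (0 : Fin n → ℂ) ∈ f.source := hs.mem_toOpenPartialHomeomorph_source
  have hfa : AnalyticAt ℂ f.symm 0 := by
    have := f.analyticAt_symm' (i := ContinuousLinearEquiv.refl ℂ (Fin n → ℂ)) hf0 h.1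
      hs.hasFDerivAt.fderiv
    rwa [show f 0 = 0 from hΦ0] at this
  have hf00 : f.symm 0 = 0 := by
    have := f.left_inv hf0
    rwa [show f 0 = 0 from hΦ0] at this
  have hsymm : HasFDerivAt f.symm
      ((ContinuousLinearEquiv.refl ℂ (Fin n → ℂ) : (Fin n → ℂ) ≃L[ℂ] (Fin n → ℂ)) :
        (Fin n → ℂ) →L[ℂ] (Fin n → ℂ)) 0 := by
    have h1 : (0 : Fin n → ℂ) ∈ f.target := by
      have := f.map_source hf0
      rwa [show f 0 = 0 from hΦ0] at this
    refine f.hasFDerivAt_symm (f' := (ContinuousLinearEquiv.refl ℂ (Fin n → ℂ)).symm) h1 ?_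
    rw [hf00]
    exact hs.hasFDerivAt
  have ht : Tendsto f.symm (𝓝 0) (𝓝 0) := by simpa only [hf00] using hfa.continuousAt.tendsto
  have hGt : Tendsto G (𝓝 0) (𝓝 0) := by simpa only [hG0] using hGc.tendsto
  have htarget : f.target ∈ 𝓝 (0 : Fin n → ℂ) := by
    have := f.open_target.mem_nhds (f.map_source hf0)
    rwa [show f 0 = 0 from hΦ0] at this
  refine hG.of_semiconj hfa hf00 hsymm ?_
  filter_upwards [ht.eventually h.2.2, htarget,
    ht.eventually (hGt.eventually (f.open_source.mem_nhds hf0))] with x hx1 hx2 hx3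
  have h2 : Φ (f.symm x) = x := f.right_inv hx2
  rw [h2] at hx1
  rw [hx1]
  exact f.left_inv hx3

end ScalingMaps

/-! ### The equivalence. -/

theorem mainTheorem1 (n : ℕ) (F : (Fin n → ℂ) → (Fin n → ℂ))
    (B P J : Matrix (Fin n) (Fin n) ℂ)
    (hF : AnalyticAt ℂ F 0)
    (hB : IsUnit B.det)
    (hf : (fun x => F x - B.mulVec x) =O[𝓝 0] (fun x : Fin n → ℂ => ‖x‖ ^ 2))
    (hP : IsUnit P.det)
    (hJ : IsLowerJordan J)
    (hPBJ : P⁻¹ * B * P = J)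
    (hspec : ∃ z ∈ spectrum ℂ B, ‖z‖ ≠ 1) :
    IsAnalyticallyIntegrable F ↔
      (resonantRank J.diag = n - 1 ∧
        ∃ (Φ : (Fin n → ℂ) → (Fin n → ℂ)) (p : Fin n → (Fin n → ℂ) → ℂ)
          (m : Fin (n - 1) → (Fin n →₀ ℕ)),
          (∀ i, AnalyticAt ℂ (p i) 0) ∧
          IsNormalForm J (scalingMap J.diag p) ∧
          IsDistinguishedAnalyticNormalization J.diag
            (fun x => P⁻¹.mulVec (F (P.mulVec x))) (scalingMap J.diag p) Φ ∧
          (∀ k, IsSimpleResonant J.diag (m k)) ∧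
          LinearIndependent ℚ (fun k => ratVec (m k)) ∧
          ∀ k, ∀ᶠ y in 𝓝 (0 : Fin n → ℂ), ∏ i, (1 + p i y) ^ (m k i) = 1) := by
  constructor
  · intro h
    obtain ⟨i₀, hi₀⟩ := exists_log_norm_diag_ne_zero hB hP hJ hPBJ hspec
    refine exists_normalization_of_integrable hJ (consistsOfMonomials_conj hF hf hP hPBJ)
      (diag_ne_zero_of_conj hB hP hJ hPBJ) hi₀ (h.of_semiconj_mulVec hP fun x => ?_)
    rw [Matrix.mulVec_mulVec, Matrix.mul_nonsing_inv P hP, Matrix.one_mulVec]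
  · rintro ⟨-, Φ, p, m, hp, -, hΦ, hm, hmi, hpm⟩
    have hG := isAnalyticallyIntegrable_scalingMap (fun k => (hm k).1.1) hmi hpm
    have hGc : ContinuousAt (scalingMap J.diag p) 0 := continuousAt_pi.2 fun i =>
      (continuousAt_const.mul (continuous_apply i).continuousAt).mul
        (continuousAt_const.add (hp i).continuousAt)
    refine (hG.of_normalization hGc (funext fun i => by simp [scalingMap])
      hΦ).of_semiconj_mulVec (Matrix.isUnit_nonsing_inv_det P hP) fun x => ?_
    rw [Matrix.mulVec_mulVec, Matrix.mul_nonsing_inv P hP, Matrix.one_mulVec]
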